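/- Let $k$ be a field, $A$ a finite-dimensional $k$-algebra, $Q$ a finite non-empty acyclic quiver and $I$ an admissible ideal of the path algebra $kQ$ generated by paths. Products of paths are written from right to left; $s(p)$, $e(p)$, $l(p)$ denote the start, the end and the length of a path $p$. Let $A$-mod be the category of finitely generated left $A$-modules, and $\mathrm{rep}(Q,I,A)$ the category of representations $X=(X_i,X_\alpha)_{i\in Q_0,\,\alpha\in Q_1}$ of $(Q,I)$ over $A$: each $X_i$ (the $i$-th branch of $X$) is in $A$-mod, each $X_\alpha\colon X_{s(\alpha)}\to X_{e(\alpha)}$ is $A$-linear, and $X_p=0$ for each path $p$ of a generating set of $I$, where $X_{\alpha_l\cdots\alpha_1}=X_{\alpha_l}\cdots X_{\alpha_1}$. It is identified with the category of finitely generated left modules over $A\otimes_k kQ/I$. Subcategories are full and closed under isomorphisms. Let $\mathcal X$ be an additive subcategory of $A$-mod (it contains $0$ and is closed under finite direct sums) that is closed under extensions. Put $\mathrm{Cok}_i(X)=X_i/\sum_{e(\alpha)=i}\operatorname{Im}X_\alpha$ and $K_\alpha=\{p \text{ a path} : l(p)\ge 1,\ e(p)=s(\alpha),\ p\notin I,\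 \alpha p\in I\}$. Let $\mathrm{smon}(Q,I,\mathcal X)$ be the subcategory of $\mathrm{rep}(Q,I,A)$ of those $X$ such that (m1) for each $i\in Q_0$ the sum $\sum_{e(\alpha)=i}\operatorname{Im}X_\alpha$ is direct; (m2) $\operatorname{Ker}X_\alpha=\sum_{p\in K_\alpha}\operatorname{Im}X_p$ for each $\alpha\in Q_1$; (m3) $\mathrm{Cok}_i(X)\in\mathcal X$ for each $i\in Q_0$. For a subcategory $\mathcal B$ of an abelian category, an exact sequence in $\mathcal B$ is a short exact sequence of the abelian category with all terms in $\mathcal B$. An object $L\in\mathcal B$ is injective in $\mathcal B$ if for each exact sequence $0\to X\xrightarrow{f}Y\to Z\to 0$ in $\mathcal B$ every map $X\to L$ factors through $f$. The category $\mathcal B$ has enough injective objects if for each $X\in\mathcal B$ there is an exact sequence $0\to X\to L\to Z\to 0$ in $\mathcal B$ with $L$ injective in $\mathcal B$. Projective objects and having enough projective objects are defined dually. A nonzero object of $\mathcal B$ is indecomposable if it is not isomorphic to a direct sum of two nonzero objects of $\mathcal B$. Let $P(i)=(kQ/I)e_i$ be the indecomposable projective $kQ/I$-module at $i$. For $M\in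 A$-mod let $M\otimes P(i)$ be the representation with branches $M\otimes_k e_j(kQ/I)e_i$, on which an arrow $\alpha$ acts by $m\otimes p\mapsto m\otimes\alpha p$. Then: (1) $\mathrm{smon}(Q,I,\mathcal X)$ has enough projective objects if and only if $\mathcal X$ has enough projective objects. In this case, up to isomorphism, the indecomposable projective objects of $\mathrm{smon}(Q,I,\mathcal X)$ are exactly the $M\otimes P(i)$ with $M$ an indecomposable projective object of $\mathcal X$ and $i\in Q_0$; and, for each sink $i$ of $Q$, the projective objects of $\mathcal X$ are, up to isomorphism, exactly the $i$-th branches of the projective objects of $\mathrm{smon}(Q,I,\mathcal X)$. (2) $\mathrm{smon}(Q,I,\mathcal X)$ has enough injective objects if and only if $\mathcal X$ has enough injective objects. In this case, up to isomorphism, the indecomposable injective objects of $\mathrm{smon}(Q,I,\mathcal X)$ are exactly the $M\otimes P(i)$ with $M$ an indecomposable injective object of $\mathcal X$ and $i\in Q_0$; and, for each sink $i$ of $Q$, the injective objects of $\mathcal X$ are, up to isomorphism, exactly the $i$-th branches of the injective objects of $\mathrm{smon}(Q,I,\mathcal X)$. -/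

import Mathlib

open CategoryTheory CategoryTheory.Limits TensorProduct
open scoped ModuleCat

universe u

noncomputable section

namespace SMon

/-! ### Relative projective and injective objects of a subcategory

A full subcategory closed under isomorphisms of a category `C` is given by a property `P` of
objects.  In the two cases of interest (`C` the category of modules, or of representations of a
quiver) `C` is abelian, and an exact sequence in the subcategory is a short exact sequence of `C`
whose three terms satisfy `P`. -/

section Relative

universe v w

variable {C : Type w} [Category.{v} C] [HasZeroMorphisms C]

/-- `L` is an injective object of the subcategory `P`. -/
structure IsInjectiveIn (P : ObjectProperty C) (L : C) : Prop where
  mem : P L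
  extend : ∀ (S : ShortComplex C), S.ShortExact → P S.X₁ → P S.X₂ → P S.X₃ →
    ∀ h : S.X₁ ⟶ L, ∃ g : S.X₂ ⟶ L, S.f ≫ g = h

/-- `L` is a projective object of the subcategory `P`. -/
structure IsProjectiveIn (P : ObjectProperty C) (L : C) : Prop where
  mem : P L
  lift : ∀ (S : ShortComplex C), S.ShortExact → P S.X₁ → P S.X₂ → P S.X₃ →
    ∀ h : L ⟶ S.X₃, ∃ g : L ⟶ S.X₂, g ≫ S.g = h

/-- The subcategory `P` has enough injective objects: every object `X` of it is the left-hand term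
of an exact sequence `0 ⟶ X ⟶ L ⟶ Z ⟶ 0` in it with `L` injective in it. -/
def HasEnoughInjectives (P : ObjectProperty C) : Prop :=
  ∀ X : C, P X → ∃ (L Z : C) (f : X ⟶ L) (g : L ⟶ Z) (w : f ≫ g = 0),
    IsInjectiveIn P L ∧ P Z ∧ (ShortComplex.mk f g w).ShortExact

/-- The subcategory `P` has enough projective objects: every object `X` of it is the right-hand
term of an exact sequence `0 ⟶ Z ⟶ L ⟶ X ⟶ 0` in it with `L` projective in it. -/
def HasEnoughProjectives (P : ObjectProperty C) : Prop :=
  ∀ X : C, P X → ∃ (Z L : C) (f : Z ⟶ L) (g : L ⟶ X) (w : f ≫ g = 0),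
    P Z ∧ IsProjectiveIn P L ∧ (ShortComplex.mk f g w).ShortExact

/-- `X` is an indecomposable object of the subcategory `P`: it is a nonzero object of `P` and in
every decomposition of it as a direct sum of two objects of `P` one of the two is zero. -/
structure IsIndecomposableIn [HasBinaryBiproducts C] (P : ObjectProperty C) (X : C) : Prop where
  mem : P X
  not_isZero : ¬ IsZero X
  isZero_or_isZero : ∀ Y Z : C, P Y → P Z → Nonempty (X ≅ Y ⊞ Z) → IsZero Y ∨ IsZero Z

end Relative

/-! ### Bound quivers

Paths of a quiver are Mathlib's `Quiver.Path`, composed from left to right: `p.cons α` is the path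
`p` followed by the arrow `α`, usually written `α p`. -/

variable (k : Type u) [Field k] {V : Type} [Quiver.{0} V]

/-- A quiver is acyclic if the only paths from a vertex to itself are the trivial ones. -/
def IsAcyclicQuiver (V : Type) [Quiver.{0} V] : Prop :=
  ∀ (a : V) (p : Quiver.Path a a), p.length = 0

/-- The component `e_b I e_a` of the two-sided ideal `I` of the path algebra `kQ` generated by a
set `ρ` of paths.  The space `e_b (kQ) e_a` is the free vector space on the paths from `a` to `b`,
and since `kQ` is spanned by paths, `e_b I e_a` is spanned by the products `q r p` with `r ∈ ρ` and
paths `p` (starting at `a`) and `q` (ending at `b`). -/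
def pathIdeal (ρ : ∀ a b : V, Set (Quiver.Path a b)) (a b : V) :
    Submodule k (Quiver.Path a b →₀ k) :=
  Submodule.span k {x | ∃ (c d : V) (p : Quiver.Path a c) (r : Quiver.Path c d)
    (q : Quiver.Path d b), r ∈ ρ c d ∧ x = Finsupp.single (p.comp (r.comp q)) 1}

/-- The component from `a` to `b` of the `n`-th power of the arrow ideal of the path algebra. -/
def arrowIdealPow (n : ℕ) (a b : V) : Submodule k (Quiver.Path a b →₀ k) :=
  Submodule.span k {x | ∃ p : Quiver.Path a b, n ≤ p.length ∧ x = Finsupp.single p 1}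

/-- The ideal `I` generated by `ρ` is admissible: `R ^ m ⊆ I ⊆ R ^ 2` for some `m ≥ 2`, where `R`
is the arrow ideal. -/
def IsAdmissible (ρ : ∀ a b : V, Set (Quiver.Path a b)) : Prop :=
  ∃ m : ℕ, 2 ≤ m ∧ ∀ a b : V,
    arrowIdealPow k m a b ≤ pathIdeal k ρ a b ∧ pathIdeal k ρ a b ≤ arrowIdealPow k 2 a b

/-- A path belongs to the ideal `I` generated by `ρ`. -/
def MemIdeal (ρ : ∀ a b : V, Set (Quiver.Path a b)) {a b : V} (p : Quiver.Path a b) : Prop :=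
  Finsupp.single p 1 ∈ pathIdeal k ρ a b

/-- The set `K_α` of the paths `p` of length at least one ending at the source of `α` such that
`p ∉ I` and `α p ∈ I`. -/
def kerPaths (ρ : ∀ a b : V, Set (Quiver.Path a b)) {j i : V} (α : j ⟶ i) :
    Set (Σ a : V, Quiver.Path a j) :=
  {p | 1 ≤ p.2.length ∧ ¬ MemIdeal k ρ p.2 ∧ MemIdeal k ρ (p.2.cons α)}

/-! ### Representations

A representation of a quiver by (not necessarily finitely generated) `R`-modules is a functor from
the path category; it is determined by its values on vertices and arrows.  Exactness of sequences
of representations is computed at each vertex. -/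

/-- Representations of the quiver on `V` by `R`-modules. -/
abbrev QRep (V : Type) [Quiver.{0} V] (R : Type u) [Ring R] := Paths V ⥤ ModuleCat.{u} R

variable {R : Type u} [Ring R]

/-- The module at a vertex: the `i`-th branch of a representation. -/
abbrev QRep.branch (X : QRep V R) (i : V) : ModuleCat.{u} R := X.obj i

/-- The map of a representation along a path. -/
def QRep.mapPath (X : QRep V R) {i j : V} (p : Quiver.Path i j) :
    X.branch i →ₗ[R] X.branch j := (X.map p).hom

/-- The map of a representation along an arrow. -/
def QRep.mapArrow (X : QRep V R) {i j : V} (α : i ⟶ j) :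
    X.branch i →ₗ[R] X.branch j := X.mapPath α.toPath

/-- The representations of the bound quiver by finitely generated modules: `X_r = 0` for each
generator `r` of the ideal. -/
structure IsBoundRep (ρ : ∀ a b : V, Set (Quiver.Path a b)) (X : QRep V R) : Prop where
  finite : ∀ i : V, Module.Finite R (X.branch i)
  relation : ∀ (a b : V) (r : Quiver.Path a b), r ∈ ρ a b → X.mapPath r = 0

/-- The sum of the images of the arrows ending at `i`. -/
def QRep.arrowImage (X : QRep V R) (i : V) : Submodule R (X.branch i) :=
  ⨆ α : (Σ j : V, (j ⟶ i)), LinearMap.range (X.mapArrow α.2)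

/-- `Cok_i(X)`: the branch `X_i` modulo the sum of the images of the arrows ending at `i`. -/
def QRep.cok (X : QRep V R) (i : V) : ModuleCat.{u} R :=
  ModuleCat.of R (X.branch i ⧸ X.arrowImage i)

/-- The subcategory `smon(Q, I, 𝒳)` of separated monic representations over `𝒳`. -/
structure IsSeparatedMonic (ρ : ∀ a b : V, Set (Quiver.Path a b))
    (𝒳 : ObjectProperty (ModuleCat.{u} R)) (X : QRep V R) : Prop where
  isBoundRep : IsBoundRep ρ X
  /-- the sum of the images of the arrows ending at `i` is direct -/
  direct : ∀ i : V, iSupIndep fun α : (Σ j : V, (j ⟶ i)) => LinearMap.range (X.mapArrow α.2)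
  ker_eq : ∀ (j i : V) (α : j ⟶ i), LinearMap.ker (X.mapArrow α) =
    ⨆ p ∈ kerPaths k ρ α, LinearMap.range (X.mapPath p.2)
  cok_mem : ∀ i : V, 𝒳 (X.cok i)

/-- The subcategory `smon(Q, I, 𝒳)` as a property of representations. -/
def smon (ρ : ∀ a b : V, Set (Quiver.Path a b))
    (𝒳 : ObjectProperty (ModuleCat.{u} R)) : ObjectProperty (QRep V R) :=
  fun X => IsSeparatedMonic k ρ 𝒳 X

/-! ### The projective representations `P(i)` and the tensor products `M ⊗ P(i)` -/

/-- Left multiplication `p ↦ q p` by a path `q` on the path algebra. -/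
def compPath {i a b : V} (q : Quiver.Path a b) :
    (Quiver.Path i a →₀ k) →ₗ[k] (Quiver.Path i b →₀ k) :=
  Finsupp.lmapDomain k k fun p => p.comp q

theorem pathIdeal_le_comap (ρ : ∀ a b : V, Set (Quiver.Path a b)) {i a b : V}
    (q : Quiver.Path a b) :
    pathIdeal k ρ i a ≤ (pathIdeal k ρ i b).comap (compPath k q) := by
  refine Submodule.span_le.2 ?_
  rintro x ⟨c, d, p, r, s, hr, rfl⟩
  refine Submodule.subset_span ⟨c, d, p, r, s.comp q, hr, ?_⟩
  simp [compPath, Finsupp.mapDomain_single, Quiver.Path.comp_assoc]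

/-- The map `e_a (kQ/I) e_i ⟶ e_b (kQ/I) e_i` sending (the class of) a path `p` to `q p`. -/
def projMap (ρ : ∀ a b : V, Set (Quiver.Path a b)) (i : V) {a b : V} (q : Quiver.Path a b) :
    ((Quiver.Path i a →₀ k) ⧸ pathIdeal k ρ i a) →ₗ[k]
      ((Quiver.Path i b →₀ k) ⧸ pathIdeal k ρ i b) :=
  Submodule.mapQ _ _ (compPath k q) (pathIdeal_le_comap k ρ q)

theorem projMap_mk_single (ρ : ∀ a b : V, Set (Quiver.Path a b)) (i : V) {a b : V}
    (q : Quiver.Path a b) (p : Quiver.Path i a) (c : k) :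
    projMap k ρ i q (Submodule.Quotient.mk (Finsupp.single p c)) =
      Submodule.Quotient.mk (Finsupp.single (p.comp q) c) := by
  simp [projMap, compPath, Finsupp.mapDomain_single]

theorem projMap_nil (ρ : ∀ a b : V, Set (Quiver.Path a b)) (i a : V) :
    projMap k ρ i (Quiver.Path.nil : Quiver.Path a a) = LinearMap.id := by
  ext p
  simp [projMap, compPath, Finsupp.mapDomain_single]

theorem projMap_comp (ρ : ∀ a b : V, Set (Quiver.Path a b)) (i : V) {a b c : V}
    (q : Quiver.Path a b) (s : Quiver.Path b c) :
    projMap k ρ i (q.comp s) = projMap k ρ i s ∘ₗ projMap k ρ i q := by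
  ext p
  simp [projMap, compPath, Finsupp.mapDomain_single, Quiver.Path.comp_assoc]

/-- The indecomposable projective `kQ/I`-module `P(i) = (kQ/I) e_i`, as a representation: its
branch at `j` is `e_j (kQ/I) e_i`, and an arrow `α` acts by `p ↦ α p`. -/
def projRep (ρ : ∀ a b : V, Set (Quiver.Path a b)) (i : V) : QRep V k where
  obj j := ModuleCat.of k ((Quiver.Path i j →₀ k) ⧸ pathIdeal k ρ i j)
  map q := ModuleCat.ofHom (projMap k ρ i q)
  map_id j := congrArg ModuleCat.ofHom (projMap_nil k ρ i j)
  map_comp q s := congrArg ModuleCat.ofHom (projMap_comp k ρ i q s)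

variable {k} {A : Type u} [Ring A] [Algebra k A]

/-- The representation `M ⊗ N` over the `k`-algebra `A`, for an `A`-module `M` and a representation
`N` over `k`: its branches are `M ⊗ N_j` and its maps are `id ⊗ N_α`. -/
def tensorRep (M : ModuleCat.{u} A) (N : QRep V k) : QRep V A where
  obj j := ModuleCat.of A (M ⊗[k] N.obj j)
  map q := ModuleCat.ofHom (AlgebraTensorModule.map (LinearMap.id : M →ₗ[A] M) (N.map q).hom)
  map_id j := by
    ext x
    simp
  map_comp q s := by
    ext x
    simp

end SMon

end

noncomputable section

namespace SMon

/-! ### Elementwise description of representations -/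

section Elementwise

variable {k : Type u} [Field k] {V : Type} [Quiver.{0} V] {R : Type u} [Ring R]

namespace QRep

/-! Conditions (m1) and (m2) only involve addition and the arrow maps, so they can be tested after
restricting scalars from `A` to `k` (`IsMonic.restrictRep`). Over the field everything splits: a
monic representation is the direct sum of the `Cok_i(X) ⊗ P(i)`. Over `A` this fails in general, but
two consequences survive.

First, each branch `X_j` has a finite filtration whose subquotients are the `Cok_i(X)`, one for each
path from `i` to `j` outside `I`. Closure under extensions therefore puts `X_j` and the sum of the
arrow images at `j` into `𝒳` (`IsMonic.branch_mem`). Second, for a short exact sequence of monic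
representations, an element of the subobject that lies in the arrow images of the middle term
already lies in its own arrow images (`IsMonic.mem_arrowImage_of_exact`), so the sequence of the
`Cok_j` stays exact.

Morphisms out of a monic representation are built by recursion on the vertices
(`IsMonic.exists_hom`). The sum of the arrow images at `j` is a quotient of the direct sum of the
earlier branches by the kernels prescribed in (m2), so the maps at earlier vertices determine the
map there, and only an extension to `X_j` remains to be chosen. The choice is possible in the
required way when all `Cok_j(L)` are projective in `𝒳` (`isProjectiveIn_smon`) or, for maps into
`J`, when all `J_j` are injective in `𝒳` (`isInjectiveIn_smon`). In particular `M ⊗ P(i)` inherits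
either property from `M`.

Given enough projectives or injectives in `𝒳`, covers or hulls of the `Cok_i(X)` assemble into a
cover or hull of `X` by a direct sum of representations `L_i ⊗ P(i)` (`exists_freeRep_cover`,
`exists_freeRep_hull`). If `X` is itself projective or injective, that sequence splits, which makes
the arrow images of `X` complemented; then `X` is the direct sum of the `Cok_i(X) ⊗ P(i)` with each
`Cok_i(X)` projective or injective (`IsProjectiveIn.exists_iso_freeRep`,
`IsInjectiveIn.exists_iso_freeRep`). The classification of indecomposables and the statements on
branches follow.

To return from `smon` to `𝒳`, maps `L ⟶ M ⊗ P(i)` at a sink `i` are maps `Cok_i(L) → M`, so `Cok_i`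
carries projectives to projectives. For injectives, maps `M ⊗ P(i) ⟶ L` are maps `M → L_i`, so every
branch of an injective is injective. -/

theorem mapPath_nil (X : QRep V R) {i : V} (x : X.branch i) :
    X.mapPath (Quiver.Path.nil : Quiver.Path i i) x = x :=
  LinearMap.congr_fun (congrArg ModuleCat.Hom.hom (X.map_id i)) x

theorem mapPath_comp (X : QRep V R) {i j l : V} (p : Quiver.Path i j) (q : Quiver.Path j l)
    (x : X.branch i) : X.mapPath (p.comp q) x = X.mapPath q (X.mapPath p x) :=
  LinearMap.congr_fun (congrArg ModuleCat.Hom.hom (X.map_comp (X := i) (Y := j) (Z := l) p q)) x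

theorem mapPath_cons (X : QRep V R) {i j l : V} (p : Quiver.Path i j) (α : j ⟶ l)
    (x : X.branch i) : X.mapPath (p.cons α) x = X.mapArrow α (X.mapPath p x) :=
  X.mapPath_comp p α.toPath x

/-- The component of a morphism of representations at a vertex. -/
def homAt {X Y : QRep V R} (f : X ⟶ Y) (j : V) : X.branch j →ₗ[R] Y.branch j := (f.app j).hom

theorem homAt_mapPath {X Y : QRep V R} (f : X ⟶ Y) {i j : V} (p : Quiver.Path i j)
    (x : X.branch i) : homAt f j (X.mapPath p x) = Y.mapPath p (homAt f i x) :=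
  LinearMap.congr_fun (congrArg ModuleCat.Hom.hom (f.naturality (X := i) (Y := j) p)) x

theorem homAt_mapArrow {X Y : QRep V R} (f : X ⟶ Y) {i j : V} (α : i ⟶ j)
    (x : X.branch i) : homAt f j (X.mapArrow α x) = Y.mapArrow α (homAt f i x) :=
  homAt_mapPath f α.toPath x

@[simp]
theorem homAt_id (X : QRep V R) (j : V) (x : X.branch j) : homAt (𝟙 X) j x = x := rfl

@[simp]
theorem homAt_comp {X Y Z : QRep V R} (f : X ⟶ Y) (g : Y ⟶ Z) (j : V) (x : X.branch j) :
    homAt (f ≫ g) j x = homAt g j (homAt f j x) := rfl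

theorem hom_ext {X Y : QRep V R} {f g : X ⟶ Y} (h : ∀ j x, homAt f j x = homAt g j x) :
    f = g := by
  ext j : 2
  exact ModuleCat.hom_ext (LinearMap.ext (h j))

theorem map_mapPath_of_arrow {X Y : QRep V R} (h : ∀ j, X.branch j →ₗ[R] Y.branch j)
    (nat : ∀ ⦃i j : V⦄ (α : i ⟶ j) (x : X.branch i),
      h j (X.mapArrow α x) = Y.mapArrow α (h i x)) {i j : V} (p : Quiver.Path i j)
    (x : X.branch i) : h j (X.mapPath p x) = Y.mapPath p (h i x) := by
  induction p with
  | nil => simp only [mapPath_nil]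
  | cons p α ih => rw [mapPath_cons, mapPath_cons, nat, ih]

/-- A morphism of representations from a family of linear maps compatible with the arrows. -/
def homMk {X Y : QRep V R} (h : ∀ j, X.branch j →ₗ[R] Y.branch j)
    (nat : ∀ ⦃i j : V⦄ (α : i ⟶ j) (x : X.branch i),
      h j (X.mapArrow α x) = Y.mapArrow α (h i x)) : X ⟶ Y where
  app j := ModuleCat.ofHom (h j)
  naturality i j p := by
    apply ModuleCat.hom_ext
    ext x
    exact map_mapPath_of_arrow h nat p x

@[simp]
theorem homAt_homMk {X Y : QRep V R} (h : ∀ j, X.branch j →ₗ[R] Y.branch j)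
    (nat : ∀ ⦃i j : V⦄ (α : i ⟶ j) (x : X.branch i),
      h j (X.mapArrow α x) = Y.mapArrow α (h i x)) (j : V) : homAt (homMk h nat) j = h j := rfl

theorem isIso_of_bijective {X Y : QRep V R} (f : X ⟶ Y)
    (h : ∀ j, Function.Bijective (homAt f j)) : IsIso f := by
  have : ∀ j, IsIso (f.app j) := fun j =>
    (ConcreteCategory.isIso_iff_bijective (f.app j)).2 (h j)
  exact NatIso.isIso_of_isIso_app f

theorem mapArrow_mem_arrowImage (X : QRep V R) {i j : V} (α : i ⟶ j) (x : X.branch i) :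
    X.mapArrow α x ∈ X.arrowImage j :=
  Submodule.mem_iSup_of_mem (p := fun α : (Σ i : V, (i ⟶ j)) => LinearMap.range (X.mapArrow α.2))
    ⟨i, α⟩ ⟨x, rfl⟩

theorem arrowImage_induction (X : QRep V R) {j : V} {P : X.branch j → Prop}
    (h : ∀ (i : V) (α : i ⟶ j) (x : X.branch i), P (X.mapArrow α x)) (h0 : P 0)
    (hadd : ∀ x y, P x → P y → P (x + y)) {x : X.branch j} (hx : x ∈ X.arrowImage j) : P x :=
  Submodule.iSup_induction (fun α : (Σ i : V, (i ⟶ j)) => LinearMap.range (X.mapArrow α.2))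
    (motive := P) hx (by rintro ⟨i, α⟩ _ ⟨y, rfl⟩; exact h i α y) h0 hadd

theorem arrowImage_le_comap {X Y : QRep V R} (f : X ⟶ Y) (j : V) :
    X.arrowImage j ≤ (Y.arrowImage j).comap (homAt f j) := by
  refine iSup_le ?_
  rintro ⟨i, α⟩ _ ⟨x, rfl⟩
  rw [Submodule.mem_comap, homAt_mapArrow]
  exact Y.mapArrow_mem_arrowImage α _

theorem homAt_mem_arrowImage {X Y : QRep V R} (f : X ⟶ Y) {j : V} {x : X.branch j}
    (hx : x ∈ X.arrowImage j) : homAt f j x ∈ Y.arrowImage j := arrowImage_le_comap f j hx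

section Sum

variable [∀ j : V, Fintype (Σ i : V, (i ⟶ j))]

/-- The sum of the maps along all arrows ending at `j`. -/
def arrowSum (X : QRep V R) (j : V) :
    (∀ a : (Σ i : V, (i ⟶ j)), X.branch a.1) →ₗ[R] X.branch j :=
  ∑ a : (Σ i : V, (i ⟶ j)), X.mapArrow a.2 ∘ₗ LinearMap.proj a

theorem arrowSum_apply (X : QRep V R) (j : V) (x : ∀ a : (Σ i : V, (i ⟶ j)), X.branch a.1) :
    X.arrowSum j x = ∑ a : (Σ i : V, (i ⟶ j)), X.mapArrow a.2 (x a) := by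
  simp [arrowSum]

theorem range_arrowSum (X : QRep V R) (j : V) :
    LinearMap.range (X.arrowSum j) = X.arrowImage j := by
  classical
  apply le_antisymm
  · rintro _ ⟨x, rfl⟩
    rw [arrowSum_apply]
    exact Submodule.sum_mem _ fun a _ => X.mapArrow_mem_arrowImage a.2 _
  · refine iSup_le ?_
    rintro a _ ⟨x, rfl⟩
    refine ⟨Pi.single a x, ?_⟩
    rw [arrowSum_apply, Finset.sum_eq_single a]
    · simp
    · intro b _ hb
      simp [Pi.single_eq_of_ne hb]
    · simp

theorem mem_arrowImage_iff (X : QRep V R) (j : V) (x : X.branch j) :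
    x ∈ X.arrowImage j ↔ ∃ y : ∀ a : (Σ i : V, (i ⟶ j)), X.branch a.1,
      ∑ a : (Σ i : V, (i ⟶ j)), X.mapArrow a.2 (y a) = x := by
  simp only [← range_arrowSum, LinearMap.mem_range, arrowSum_apply]

end Sum

end QRep

/-- The images along the paths in `K_α` generate this subgroup. -/
def QRep.kerImage (k : Type u) [Field k] (ρ : ∀ a b : V, Set (Quiver.Path a b)) (X : QRep V R)
    {j i : V} (α : j ⟶ i) : AddSubgroup (X.branch j) :=
  AddSubgroup.closure {z | ∃ (a : V) (p : Quiver.Path a j) (y : X.branch a),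
    (⟨a, p⟩ : Σ a : V, Quiver.Path a j) ∈ kerPaths k ρ α ∧ z = X.mapPath p y}

theorem QRep.kerImage_induction {ρ : ∀ a b : V, Set (Quiver.Path a b)} {X : QRep V R}
    {j i : V} {α : j ⟶ i} {P : X.branch j → Prop}
    (h : ∀ (a : V) (p : Quiver.Path a j) (y : X.branch a),
      (⟨a, p⟩ : Σ a : V, Quiver.Path a j) ∈ kerPaths k ρ α → P (X.mapPath p y)) (h0 : P 0)
    (hadd : ∀ x y, P x → P y → P (x + y)) {x : X.branch j}
    (hx : x ∈ X.kerImage k ρ α) : P x := by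
  -- The motive is made symmetric because closure of a subgroup also involves negation; the
  -- generators are stable under negation, so no hypothesis on negatives is needed.
  refine AddSubgroup.closure_induction (p := fun x _ => P x ∧ P (-x)) ?_ ?_ ?_ ?_ hx |>.1
  · rintro _ ⟨a, p, y, hp, rfl⟩
    refine ⟨h a p y hp, ?_⟩
    rw [← map_neg]
    exact h a p (-y) hp
  · simpa using h0
  · rintro x y _ _ ⟨h1, h2⟩ ⟨h3, h4⟩
    refine ⟨hadd _ _ h1 h3, ?_⟩
    rw [neg_add]
    exact hadd _ _ h2 h4
  · rintro x _ ⟨h1, h2⟩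
    exact ⟨h2, by simpa using h1⟩

theorem QRep.mapPath_mem_kerImage {ρ : ∀ a b : V, Set (Quiver.Path a b)} (X : QRep V R)
    {j i a : V} {α : j ⟶ i} {p : Quiver.Path a j}
    (hp : (⟨a, p⟩ : Σ a : V, Quiver.Path a j) ∈ kerPaths k ρ α) (y : X.branch a) :
    X.mapPath p y ∈ X.kerImage k ρ α :=
  AddSubgroup.subset_closure ⟨a, p, y, hp, rfl⟩

theorem QRep.homAt_mem_kerImage {ρ : ∀ a b : V, Set (Quiver.Path a b)} {X Y : QRep V R}
    (f : X ⟶ Y) {j i : V} {α : j ⟶ i} {x : X.branch j} (hx : x ∈ X.kerImage k ρ α) :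
    homAt f j x ∈ Y.kerImage k ρ α := by
  refine QRep.kerImage_induction (P := fun x => homAt f j x ∈ Y.kerImage k ρ α)
    ?_ ?_ ?_ hx
  · intro a p y hp
    rw [homAt_mapPath]
    exact Y.mapPath_mem_kerImage hp _
  · rw [map_zero]
    exact zero_mem _
  · intro x y hx hy
    rw [map_add]
    exact add_mem hx hy

/-- The paths which belong to the ideal generated by `ρ` are those with a subpath in `ρ`. -/
theorem memIdeal_iff {ρ : ∀ a b : V, Set (Quiver.Path a b)} {a b : V} (s : Quiver.Path a b) :
    MemIdeal k ρ s ↔ ∃ (c d : V) (p : Quiver.Path a c) (r : Quiver.Path c d)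
      (q : Quiver.Path d b), r ∈ ρ c d ∧ s = p.comp (r.comp q) := by
  have h : pathIdeal k ρ a b = Finsupp.supported k k {s | ∃ (c d : V) (p : Quiver.Path a c)
      (r : Quiver.Path c d) (q : Quiver.Path d b), r ∈ ρ c d ∧ s = p.comp (r.comp q)} := by
    rw [Finsupp.supported_eq_span_single, pathIdeal]
    congr 1
    ext x
    constructor
    · rintro ⟨c, d, p, r, q, hr, rfl⟩
      exact ⟨_, ⟨c, d, p, r, q, hr, rfl⟩, rfl⟩
    · rintro ⟨_, ⟨c, d, p, r, q, hr, rfl⟩, rfl⟩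
      exact ⟨c, d, p, r, q, hr, rfl⟩
  rw [MemIdeal, h, Finsupp.mem_supported]
  simp

/-- An ideal generated by paths is monomial. This is what makes the paths outside `I` a basis of the
quotient. -/
theorem pathIdeal_eq_supported (ρ : ∀ a b : V, Set (Quiver.Path a b)) (a b : V) :
    pathIdeal k ρ a b = Finsupp.supported k k {s : Quiver.Path a b | MemIdeal k ρ s} := by
  rw [Finsupp.supported_eq_span_single, pathIdeal]
  congr 1
  ext x
  constructor
  · rintro ⟨c, d, p, r, q, hr, rfl⟩
    exact ⟨_, (memIdeal_iff _).2 ⟨c, d, p, r, q, hr, rfl⟩, rfl⟩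
  · rintro ⟨s, hs, rfl⟩
    obtain ⟨c, d, p, r, q, hr, rfl⟩ := (memIdeal_iff _).1 hs
    exact ⟨c, d, p, r, q, hr, rfl⟩

theorem MemIdeal.comp_left {ρ : ∀ a b : V, Set (Quiver.Path a b)} {a b c : V}
    {s : Quiver.Path a b} (hs : MemIdeal k ρ s) (t : Quiver.Path b c) :
    MemIdeal k ρ (s.comp t) := by
  obtain ⟨c, d, p, r, q, hr, rfl⟩ := (memIdeal_iff _).1 hs
  exact (memIdeal_iff _).2 ⟨c, d, p, r, q.comp t, hr, by simp only [Quiver.Path.comp_assoc]⟩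

/-- The inclusion of `I` in the square of the arrow ideal is the only part of admissibility used
here; it keeps trivial paths and arrows outside `I`. -/
theorem IsAdmissible.two_le_length {ρ : ∀ a b : V, Set (Quiver.Path a b)}
    (hρ : IsAdmissible k ρ) {a b : V} {s : Quiver.Path a b} (hs : MemIdeal k ρ s) :
    2 ≤ s.length := by
  obtain ⟨m, _, h⟩ := hρ
  have h2 := (h a b).2 hs
  have h3 : arrowIdealPow k 2 a b = Finsupp.supported k k {s : Quiver.Path a b | 2 ≤ s.length} := by
    rw [Finsupp.supported_eq_span_single, arrowIdealPow]
    congr 1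
    ext x
    exact ⟨fun ⟨p, hp, hx⟩ => ⟨p, hp, hx.symm⟩, fun ⟨p, hp, hx⟩ => ⟨p, hp, hx.symm⟩⟩
  rw [h3, Finsupp.mem_supported] at h2
  simpa [Finsupp.support_single] using h2

/-- The representation `X` satisfies the relations in `ρ`. -/
def SatisfiesRelations (ρ : ∀ a b : V, Set (Quiver.Path a b)) (X : QRep V R) : Prop :=
  ∀ ⦃a b : V⦄ (r : Quiver.Path a b), r ∈ ρ a b → ∀ x, X.mapPath r x = 0

theorem SatisfiesRelations.mapPath_eq_zero {ρ : ∀ a b : V, Set (Quiver.Path a b)} {X : QRep V R}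
    (hX : SatisfiesRelations ρ X) {a b : V} {s : Quiver.Path a b} (hs : MemIdeal k ρ s)
    (x : X.branch a) : X.mapPath s x = 0 := by
  obtain ⟨c, d, p, r, q, hr, rfl⟩ := (memIdeal_iff _).1 hs
  rw [QRep.mapPath_comp, QRep.mapPath_comp, hX r hr, map_zero]

theorem SatisfiesRelations.mapArrow_eq_zero {ρ : ∀ a b : V, Set (Quiver.Path a b)} {X : QRep V R}
    (hX : SatisfiesRelations ρ X) {i j : V} {α : j ⟶ i} {x : X.branch j}
    (hx : x ∈ X.kerImage k ρ α) : X.mapArrow α x = 0 := by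
  refine QRep.kerImage_induction (P := fun x => X.mapArrow α x = 0) ?_ (map_zero _) ?_ hx
  · intro a p y hp
    rw [← QRep.mapPath_cons]
    exact hX.mapPath_eq_zero hp.2.2 y
  · intro x y hx hy
    rw [map_add, hx, hy, add_zero]

/-- The representations satisfying the relations and the conditions (m1) and (m2), in a form
which does not refer to the ring of scalars. -/
structure IsMonic (k : Type u) [Field k] [∀ j : V, Fintype (Σ i : V, (i ⟶ j))]
    (ρ : ∀ a b : V, Set (Quiver.Path a b))
    (X : QRep V R) : Prop where
  relations : SatisfiesRelations ρ X
  direct : ∀ (j : V) (x : ∀ a : (Σ i : V, (i ⟶ j)), X.branch a.1),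
    ∑ a : (Σ i : V, (i ⟶ j)), X.mapArrow a.2 (x a) = 0 → ∀ a, X.mapArrow a.2 (x a) = 0
  ker_le : ∀ ⦃j i : V⦄ (α : j ⟶ i) (x : X.branch j), X.mapArrow α x = 0 → x ∈ X.kerImage k ρ α

/-- Each image is a submodule, so the additive subgroup and the submodule generated by the images
coincide. This links the scalar-free form of (m2) to the given one. -/
theorem mem_kerImage_iff {ρ : ∀ a b : V, Set (Quiver.Path a b)} (X : QRep V R)
    {j i : V} (α : j ⟶ i) (x : X.branch j) :
    x ∈ X.kerImage k ρ α ↔ x ∈ ⨆ p ∈ kerPaths k ρ α, LinearMap.range (X.mapPath p.2) := by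
  constructor
  · refine QRep.kerImage_induction (P := fun x =>
      x ∈ ⨆ p ∈ kerPaths k ρ α, LinearMap.range (X.mapPath p.2)) ?_ (zero_mem _)
      fun _ _ => add_mem
    intro a p y hp
    exact Submodule.mem_iSup_of_mem _ (Submodule.mem_iSup_of_mem hp ⟨y, rfl⟩)
  · rw [iSup_subtype']
    intro hx
    refine Submodule.iSup_induction (fun p : kerPaths k ρ α => LinearMap.range (X.mapPath p.1.2))
      (motive := fun x => x ∈ X.kerImage k ρ α) hx ?_ (zero_mem _) fun _ _ => add_mem
    rintro ⟨⟨a, p⟩, hp⟩ _ ⟨y, rfl⟩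
    exact X.mapPath_mem_kerImage hp y

variable [∀ j : V, Fintype (Σ i : V, (i ⟶ j))]

theorem direct_iff (X : QRep V R) (j : V) :
    (iSupIndep fun α : (Σ i : V, (i ⟶ j)) => LinearMap.range (X.mapArrow α.2)) ↔
    ∀ x : ∀ a : (Σ i : V, (i ⟶ j)), X.branch a.1,
      ∑ a : (Σ i : V, (i ⟶ j)), X.mapArrow a.2 (x a) = 0 → ∀ a, X.mapArrow a.2 (x a) = 0 := by
  classical
  rw [iSupIndep_iff_finsetSum_eq_zero_imp_eq_zero]
  constructor
  · intro h x hx a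
    exact h Finset.univ (fun a => X.mapArrow a.2 (x a)) (fun a _ => ⟨x a, rfl⟩) hx a
      (Finset.mem_univ a)
  · intro h s v hv hs a ha
    -- A relation supported on the finite set `s` is extended by zero to all arrows ending at `j`.
    have hy : ∀ a, ∃ y, X.mapArrow a.2 y = if a ∈ s then v a else 0 := fun a => by
      split_ifs with has
      · exact hv a has
      · exact ⟨0, map_zero _⟩
    choose y hy using hy
    have := h y (by simpa [hy] using hs) a
    rwa [hy, if_pos ha] at this

theorem isSeparatedMonic_iff (ρ : ∀ a b : V, Set (Quiver.Path a b))
    (𝒳 : ObjectProperty (ModuleCat.{u} R)) (X : QRep V R) :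
    smon k ρ 𝒳 X ↔ IsMonic k ρ X ∧ (∀ i, Module.Finite R (X.branch i)) ∧ ∀ i, 𝒳 (X.cok i) := by
  constructor
  · intro h
    refine ⟨⟨fun a b r hr x => ?_, fun j => (direct_iff X j).1 (h.direct j), ?_⟩,
      h.isBoundRep.finite, h.cok_mem⟩
    · rw [h.isBoundRep.relation a b r hr]
      rfl
    · intro j i α x hx
      rw [mem_kerImage_iff, ← h.ker_eq]
      exact hx
  · rintro ⟨h1, h2, h3⟩
    refine ⟨⟨h2, fun a b r hr => LinearMap.ext fun x => h1.relations r hr x⟩,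
      fun j => (direct_iff X j).2 (h1.direct j), fun j i α => ?_, h3⟩
    ext x
    rw [← mem_kerImage_iff]
    exact ⟨fun hx => h1.ker_le α x hx, fun hx => h1.relations.mapArrow_eq_zero hx⟩

end Elementwise

end SMon

namespace SMon

/-! ### Recursion along the vertices of an acyclic quiver -/

/-- The vertices of a finite acyclic quiver have a rank which increases along the arrows. -/
theorem IsAcyclicQuiver.exists_rank {V : Type} [Quiver.{0} V] [Finite V]
    (hQ : IsAcyclicQuiver V) : ∃ rk : V → ℕ, ∀ ⦃i j : V⦄, (i ⟶ j) → rk i < rk j := by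
  -- The rank counts the proper predecessors. Along an arrow from `i` to `j` it grows strictly,
  -- since `i` precedes `j` but, by acyclicity, not itself.
  refine ⟨fun j => Set.ncard {i : V | ∃ p : Quiver.Path i j, 0 < p.length}, fun i j α => ?_⟩
  refine Set.ncard_lt_ncard ⟨?_, ?_⟩ (Set.toFinite _)
  · rintro l ⟨p, hp⟩
    exact ⟨p.cons α, by simp⟩
  · intro h
    obtain ⟨p, hp⟩ := h ⟨α.toPath, by simp⟩
    exact hp.ne' (hQ i p)

section ArrowImage

variable {V : Type} [Quiver.{0} V] {R : Type u} [Ring R]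

/-- Two linear maps on the sum of the images of the arrows agree if they agree on each image. -/
theorem QRep.arrowImage_hom_ext (X : QRep V R) {j : V} {M : Type*} [AddCommGroup M] [Module R M]
    {φ ψ : X.arrowImage j →ₗ[R] M}
    (h : ∀ (i : V) (α : i ⟶ j) x, φ ⟨X.mapArrow α x, X.mapArrow_mem_arrowImage α x⟩ =
      ψ ⟨X.mapArrow α x, X.mapArrow_mem_arrowImage α x⟩) (w : X.arrowImage j) : φ w = ψ w := by
  obtain ⟨w, hw⟩ := w
  obtain ⟨hw', h'⟩ := QRep.arrowImage_induction X
    (P := fun w => ∃ hw : w ∈ X.arrowImage j, φ ⟨w, hw⟩ = ψ ⟨w, hw⟩)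
    (fun i α x => ⟨X.mapArrow_mem_arrowImage α x, h i α x⟩)
    ⟨zero_mem _, (map_zero φ).trans (map_zero ψ).symm⟩
    (fun x y ⟨hx, hx'⟩ ⟨hy, hy'⟩ => ⟨add_mem hx hy, by
      have h1 := map_add φ ⟨x, hx⟩ ⟨y, hy⟩
      have h2 := map_add ψ ⟨x, hx⟩ ⟨y, hy⟩
      rw [hx', hy'] at h1
      exact h1.trans h2.symm⟩) hw
  exact h'

theorem QRep.map_arrowImage_mem {X Y : QRep V R} {j : V}
    {h : ∀ i, X.branch i →ₗ[R] Y.branch i} {φ : X.arrowImage j →ₗ[R] Y.branch j}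
    (hφ : ∀ (i : V) (α : i ⟶ j) x,
        φ ⟨X.mapArrow α x, X.mapArrow_mem_arrowImage α x⟩ = Y.mapArrow α (h i x))
    (w : X.arrowImage j) : φ w ∈ Y.arrowImage j := by
  have := X.arrowImage_hom_ext (φ := (Y.arrowImage j).mkQ ∘ₗ φ) (ψ := 0) (fun i α x => by
    simpa [hφ] using Y.mapArrow_mem_arrowImage α _) w
  simpa using this

/-- A morphism is surjective if it is surjective modulo the images of the arrows. -/
theorem QRep.surjective_of_cok {X Y : QRep V R} (f : X ⟶ Y) {rk : V → ℕ}
    (hrk : ∀ ⦃i j : V⦄, (i ⟶ j) → rk i < rk j)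
    (hf : ∀ j (y : Y.branch j), ∃ x, y - QRep.homAt f j x ∈ Y.arrowImage j) (j : V) :
    Function.Surjective (QRep.homAt f j) := by
  suffices H : ∀ n j, rk j = n → Function.Surjective (QRep.homAt f j) from H _ j rfl
  intro n
  induction n using Nat.strong_induction_on with
  | _ n ih =>
  intro j hj y
  obtain ⟨x, hx⟩ := hf j y
  have : ∃ x', QRep.homAt f j x' = y - QRep.homAt f j x := by
    refine Y.arrowImage_induction (P := fun y => ∃ x', QRep.homAt f j x' = y) ?_ ?_ ?_ hx
    · intro i α z
      obtain ⟨z', rfl⟩ := ih _ (hj ▸ hrk α) i rfl z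
      exact ⟨X.mapArrow α z', homAt_mapArrow f α z'⟩
    · exact ⟨0, map_zero _⟩
    · rintro _ _ ⟨a, rfl⟩ ⟨b, rfl⟩
      exact ⟨a + b, map_add _ _ _⟩
  obtain ⟨x', hx'⟩ := this
  exact ⟨x' + x, by rw [map_add, hx', sub_add_cancel]⟩

end ArrowImage

section Recursion

variable {k : Type u} [Field k] {V : Type} [Quiver.{0} V] {R : Type u} [Ring R]
  [∀ j : V, Fintype (Σ i : V, (i ⟶ j))] {ρ : ∀ a b : V, Set (Quiver.Path a b)}

/-- By (m1), the sum of the arrow images at `j` is the direct sum of the source branches modulo the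
kernels of the single arrows. By (m2), each kernel is generated by images along paths `p` with `αp ∈
I`. Naturality below `j` moves such a path to `Y`, where `αp` acts as zero, so the maps at the
sources descend. -/
theorem IsMonic.exists_arrowImage_desc {X Y : QRep V R} (hX : IsMonic k ρ X)
    (hY : SatisfiesRelations ρ Y) {rk : V → ℕ} (hrk : ∀ ⦃i j : V⦄, (i ⟶ j) → rk i < rk j)
    (h : ∀ i, X.branch i →ₗ[R] Y.branch i) {j : V}
    (nat : ∀ ⦃i i' : V⦄ (α : i ⟶ i'), rk i' < rk j → ∀ x,
      h i' (X.mapArrow α x) = Y.mapArrow α (h i x)) :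
    ∃ φ : X.arrowImage j →ₗ[R] Y.branch j, ∀ (i : V) (α : i ⟶ j) x,
      φ ⟨X.mapArrow α x, X.mapArrow_mem_arrowImage α x⟩ = Y.mapArrow α (h i x) := by
  classical
  have natPath : ∀ {i i' : V} (p : Quiver.Path i i'), rk i' < rk j → ∀ x,
      h i' (X.mapPath p x) = Y.mapPath p (h i x) := by
    intro i i' p
    induction p with
    | nil => intro _ x; simp only [QRep.mapPath_nil]
    | cons p α ih =>
      intro hlt x
      rw [QRep.mapPath_cons, QRep.mapPath_cons, nat α hlt, ih ((hrk α).trans hlt)]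
  have hker : ∀ {i : V} (α : i ⟶ j) (x : X.branch i), X.mapArrow α x = 0 →
      Y.mapArrow α (h i x) = 0 := by
    intro i α x hx
    refine QRep.kerImage_induction (P := fun x => Y.mapArrow α (h i x) = 0) ?_ ?_ ?_
      (hX.ker_le α x hx)
    · intro a p y hp
      rw [natPath p (hrk α), ← QRep.mapPath_cons]
      exact hY.mapPath_eq_zero hp.2.2 _
    · rw [map_zero, map_zero]
    · intro x y hx hy
      rw [map_add, map_add, hx, hy, add_zero]
  let Φ : (∀ a : (Σ i : V, (i ⟶ j)), X.branch a.1) →ₗ[R] Y.branch j :=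
    ∑ a : (Σ i : V, (i ⟶ j)), Y.mapArrow a.2 ∘ₗ h a.1 ∘ₗ LinearMap.proj a
  have hΦ : ∀ x, Φ x = ∑ a : (Σ i : V, (i ⟶ j)), Y.mapArrow a.2 (h a.1 (x a)) := fun x => by
    simp [Φ]
  have hle : LinearMap.ker (X.arrowSum j) ≤ LinearMap.ker Φ := by
    intro x hx
    rw [LinearMap.mem_ker, QRep.arrowSum_apply] at hx
    rw [LinearMap.mem_ker, hΦ]
    exact Finset.sum_eq_zero fun a _ => hker a.2 _ (hX.direct j x hx a)
  let e := (X.arrowSum j).quotKerEquivRange.symm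
  let e' : X.arrowImage j ≃ₗ[R] LinearMap.range (X.arrowSum j) :=
    LinearEquiv.ofEq _ _ (X.range_arrowSum j).symm
  refine ⟨(LinearMap.ker (X.arrowSum j)).liftQ Φ hle ∘ₗ e.toLinearMap ∘ₗ e'.toLinearMap,
    fun i α x => ?_⟩
  have h1 : X.arrowSum j (Pi.single (⟨i, α⟩ : Σ i : V, (i ⟶ j)) x) = X.mapArrow α x := by
    rw [QRep.arrowSum_apply, Finset.sum_eq_single (⟨i, α⟩ : Σ i : V, (i ⟶ j))]
    · simp
    · intro b _ hb
      simp [Pi.single_eq_of_ne hb]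
    · simp
  have h2 : e (e' ⟨X.mapArrow α x, X.mapArrow_mem_arrowImage α x⟩) =
      Submodule.Quotient.mk (Pi.single (⟨i, α⟩ : Σ i : V, (i ⟶ j)) x) := by
    rw [LinearEquiv.symm_apply_eq]
    apply Subtype.ext
    exact h1.symm
  rw [LinearMap.comp_apply, LinearMap.comp_apply, LinearEquiv.coe_coe, LinearEquiv.coe_coe, h2,
    Submodule.liftQ_apply, hΦ, Finset.sum_eq_single (⟨i, α⟩ : Σ i : V, (i ⟶ j))]
  · simp
  · intro b _ hb
    simp [Pi.single_eq_of_ne hb]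
  · simp

/-- Morphisms out of a monic representation can be constructed by recursion on the vertices. -/
theorem IsMonic.exists_hom [Finite V] {X Y : QRep V R} (hX : IsMonic k ρ X)
    (hY : SatisfiesRelations ρ Y) {rk : V → ℕ} (hrk : ∀ ⦃i j : V⦄, (i ⟶ j) → rk i < rk j)
    (P : ∀ j : V, (X.branch j →ₗ[R] Y.branch j) → Prop)
    (step : ∀ (j : V) (h : ∀ i, X.branch i →ₗ[R] Y.branch i), (∀ i (_ : i ⟶ j), P i (h i)) →
      ∀ φ : X.arrowImage j →ₗ[R] Y.branch j,
      (∀ (i : V) (α : i ⟶ j) x,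
        φ ⟨X.mapArrow α x, X.mapArrow_mem_arrowImage α x⟩ = Y.mapArrow α (h i x)) →
      ∃ h' : X.branch j →ₗ[R] Y.branch j, (∀ w : X.arrowImage j, h' w = φ w) ∧ P j h') :
    ∃ f : X ⟶ Y, ∀ j, P j (QRep.homAt f j) := by
  classical
  -- The family is defined at all vertices but constrained only below rank `n`; stage `n` alters the
  -- maps at the vertices of rank exactly `n`, starting from the zero family.
  have key : ∀ n : ℕ, ∃ h : ∀ i, X.branch i →ₗ[R] Y.branch i,
      (∀ ⦃i j : V⦄ (α : i ⟶ j), rk j < n → ∀ x,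
        h j (X.mapArrow α x) = Y.mapArrow α (h i x)) ∧ ∀ j, rk j < n → P j (h j) := by
    intro n
    induction n with
    | zero => exact ⟨fun _ => 0, fun _ _ _ h => absurd h (Nat.not_lt_zero _),
        fun _ h => absurd h (Nat.not_lt_zero _)⟩
    | succ n ih =>
      obtain ⟨h, nat, hP⟩ := ih
      have ex : ∀ j, ∃ h' : X.branch j →ₗ[R] Y.branch j, rk j = n →
          (∀ i (α : i ⟶ j) x, h' (X.mapArrow α x) = Y.mapArrow α (h i x)) ∧ P j h' := by
        intro j
        by_cases hj : rk j = n
        · obtain ⟨φ, hφ⟩ := hX.exists_arrowImage_desc hY hrk h (j := j)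
            (fun i i' α hi' => nat α (hj ▸ hi'))
          obtain ⟨h', h1, h2⟩ := step j h (fun i α => hP i (hj ▸ hrk α)) φ hφ
          exact ⟨h', fun _ => ⟨fun i α x => (h1 ⟨_, X.mapArrow_mem_arrowImage α x⟩).trans
            (hφ i α x), h2⟩⟩
        · exact ⟨0, fun h => absurd h hj⟩
      choose h' hh' using ex
      refine ⟨fun j => if rk j = n then h' j else h j, fun i j α hj x => ?_, fun j hj => ?_⟩
      -- The source of an arrow whose target has rank at most `n` has rank below `n`, so its map is
      -- not altered.
      · have hi : rk i ≠ n := by have := hrk α; omega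
        simp only [if_neg hi]
        split_ifs with hjn
        · exact (hh' j hjn).1 i α x
        · exact nat α (by omega) x
      · dsimp only
        split_ifs with hjn
        · exact (hh' j hjn).2
        · exact hP j (by omega)
  obtain ⟨n, hn⟩ := (Set.finite_range rk).bddAbove
  obtain ⟨h, nat, hP⟩ := key (n + 1)
  have hlt : ∀ j, rk j < n + 1 := fun j => Nat.lt_succ_of_le (hn ⟨j, rfl⟩)
  exact ⟨QRep.homMk h fun i j α x => nat α (hlt j) x, fun j => hP j (hlt j)⟩

/-- A morphism to a monic representation is bijective if it is so modulo the images of the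
arrows. -/
theorem IsMonic.bijective_of_cok {X Y : QRep V R} (hX : SatisfiesRelations ρ X)
    (hY : IsMonic k ρ Y) (f : X ⟶ Y) {rk : V → ℕ}
    (hrk : ∀ ⦃i j : V⦄, (i ⟶ j) → rk i < rk j)
    (hsurj : ∀ j (y : Y.branch j), ∃ x, y - QRep.homAt f j x ∈ Y.arrowImage j)
    (hinj : ∀ j (x : X.branch j), QRep.homAt f j x ∈ Y.arrowImage j → x ∈ X.arrowImage j) (j : V) :
    Function.Bijective (QRep.homAt f j) := by
  have hs := QRep.surjective_of_cok f hrk hsurj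
  refine ⟨?_, hs j⟩
  suffices H : ∀ n j, rk j = n → Function.Injective (QRep.homAt f j) from H _ j rfl
  intro n
  induction n using Nat.strong_induction_on with
  | _ n ih =>
  intro j hj
  rw [injective_iff_map_eq_zero]
  intro x hx
  obtain ⟨y, rfl⟩ := (X.mem_arrowImage_iff j x).1 (hinj j x (by rw [hx]; exact zero_mem _))
  rw [map_sum] at hx
  simp only [QRep.homAt_mapArrow] at hx
  refine Finset.sum_eq_zero fun a _ => hX.mapArrow_eq_zero (k := k) ?_
  have h0 := hY.ker_le a.2 _ (hY.direct j (fun a => QRep.homAt f a.1 (y a)) hx a)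
  have hlt : rk a.1 < n := hj ▸ hrk a.2
  -- Surjectivity at all vertices lifts the images along `K_α` from `Y` to `X`. Injectivity at the
  -- source, which has smaller rank, then identifies the lift `z` with `y a`, so `y a` is killed by
  -- the arrow.
  have : ∃ z ∈ X.kerImage k ρ a.2, QRep.homAt f a.1 z = QRep.homAt f a.1 (y a) := by
    refine QRep.kerImage_induction (P := fun w => ∃ z ∈ X.kerImage k ρ a.2,
      QRep.homAt f a.1 z = w) ?_ ?_ ?_ h0
    · intro b p w hp
      obtain ⟨w', rfl⟩ := hs b w
      exact ⟨X.mapPath p w', X.mapPath_mem_kerImage hp w', QRep.homAt_mapPath f p w'⟩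
    · exact ⟨0, zero_mem _, map_zero _⟩
    · rintro _ _ ⟨z, hz, rfl⟩ ⟨z', hz', rfl⟩
      exact ⟨z + z', add_mem hz hz', map_add _ _ _⟩
  obtain ⟨z, hz, hz'⟩ := this
  rwa [← ih _ hlt a.1 rfl hz']

end Recursion

end SMon

namespace SMon

/-! ### Coordinates on the representations `M ⊗ P(i)` -/

section Coordinates

variable {k : Type u} [Field k] {V : Type} [Quiver.{0} V] {A : Type u} [Ring A] [Algebra k A]
  (ρ : ∀ a b : V, Set (Quiver.Path a b))

/-- The classes of the paths outside the ideal form a basis of `e_j (kQ/I) e_i`. -/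
def pathQuotientEquiv (k : Type u) [Field k] (i j : V) :
    ((Quiver.Path i j →₀ k) ⧸ pathIdeal k ρ i j) ≃ₗ[k]
      ({p : Quiver.Path i j // ¬ MemIdeal k ρ p} →₀ k) :=
  (Submodule.quotEquivOfEq _ _ (by
    rw [pathIdeal_eq_supported]
    ext x
    rw [Finsupp.mem_supported', LinearMap.mem_ker]
    constructor
    · intro h
      ext p
      exact h p.1 p.2
    · intro h p hp
      exact DFunLike.congr_fun h ⟨p, hp⟩)).trans
  (LinearMap.quotKerEquivOfSurjective
    (Finsupp.lsubtypeDomain {p : Quiver.Path i j | ¬ MemIdeal k ρ p} :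
      (Quiver.Path i j →₀ k) →ₗ[k] ({p : Quiver.Path i j | ¬ MemIdeal k ρ p} →₀ k)) (by
    intro x
    classical
    refine ⟨Finsupp.extendDomain x, ?_⟩
    exact Finsupp.subtypeDomain_extendDomain x))

theorem pathQuotientEquiv_single {i j : V} (p : Quiver.Path i j) (hp : ¬ MemIdeal k ρ p) (c : k) :
    pathQuotientEquiv ρ k i j (Submodule.Quotient.mk (Finsupp.single p c)) =
      Finsupp.single ⟨p, hp⟩ c := by
  change Finsupp.subtypeDomain _ (Finsupp.single p c) = _
  classical
  ext q
  simp only [Finsupp.subtypeDomain_apply, Finsupp.single_apply, Subtype.ext_iff]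

variable (M : ModuleCat.{u} A)

open Classical in
/-- The branch of `M ⊗ P(i)` at `j` is a direct sum of copies of `M`, indexed by the paths from
`i` to `j` outside the ideal. -/
def tensorEquiv (i j : V) : (tensorRep M (projRep k ρ i)).branch j ≃ₗ[A]
    ({p : Quiver.Path i j // ¬ MemIdeal k ρ p} →₀ M) :=
  (AlgebraTensorModule.congr (LinearEquiv.refl A M) (pathQuotientEquiv ρ k i j)).trans
    (TensorProduct.finsuppScalarRight k A M _)

/-- The map `m ↦ m ⊗ p` for a path `p`. -/
def tensorIncl {i j : V} (p : Quiver.Path i j) :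
    M →ₗ[A] (tensorRep M (projRep k ρ i)).branch j where
  toFun m := (m ⊗ₜ[k] (Submodule.Quotient.mk (Finsupp.single p 1) :
    (Quiver.Path i j →₀ k) ⧸ pathIdeal k ρ i j) :
      M ⊗[k] ((Quiver.Path i j →₀ k) ⧸ pathIdeal k ρ i j))
  map_add' m n := TensorProduct.add_tmul m n _
  map_smul' a m := (TensorProduct.smul_tmul' a m _).symm

open Classical in
theorem tensorEquiv_tensorIncl {i j : V} (p : Quiver.Path i j) (hp : ¬ MemIdeal k ρ p) (m : M) :
    tensorEquiv ρ M i j (tensorIncl ρ M p m) = Finsupp.single ⟨p, hp⟩ m := by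
  change TensorProduct.finsuppScalarRight k A M _ (AlgebraTensorModule.congr
    (LinearEquiv.refl A M) (pathQuotientEquiv ρ k i j) (m ⊗ₜ[k] _)) = _
  rw [AlgebraTensorModule.congr_tmul, pathQuotientEquiv_single ρ p hp]
  ext q
  rw [TensorProduct.finsuppScalarRight_apply_tmul_apply]
  simp only [Finsupp.single_apply]
  split_ifs <;> simp

theorem tensorIncl_eq_zero {i j : V} (p : Quiver.Path i j) (hp : MemIdeal k ρ p) (m : M) :
    tensorIncl (k := k) ρ M p m = 0 := by
  have : (Submodule.Quotient.mk (Finsupp.single p 1) :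
    (Quiver.Path i j →₀ k) ⧸ pathIdeal k ρ i j) = 0 := (Submodule.Quotient.mk_eq_zero _).2 hp
  change (m ⊗ₜ[k] (Submodule.Quotient.mk (Finsupp.single p 1) :
    (Quiver.Path i j →₀ k) ⧸ pathIdeal k ρ i j) :
      M ⊗[k] ((Quiver.Path i j →₀ k) ⧸ pathIdeal k ρ i j)) = 0
  rw [this, TensorProduct.tmul_zero]

theorem mapPath_tensorIncl {i j l : V} (p : Quiver.Path i j) (q : Quiver.Path j l) (m : M) :
    (tensorRep M (projRep k ρ i)).mapPath q (tensorIncl ρ M p m) =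
      tensorIncl ρ M (p.comp q) m := by
  change AlgebraTensorModule.map (LinearMap.id : M →ₗ[A] M) (projMap k ρ i q)
    (m ⊗ₜ[k] (Submodule.Quotient.mk (Finsupp.single p 1))) = _
  rw [AlgebraTensorModule.map_tmul, projMap_mk_single]
  rfl

theorem mapArrow_tensorIncl {i j l : V} (p : Quiver.Path i j) (α : j ⟶ l) (m : M) :
    (tensorRep M (projRep k ρ i)).mapArrow α (tensorIncl ρ M p m) =
      tensorIncl ρ M (p.cons α) m :=
  mapPath_tensorIncl ρ M p α.toPath m

variable {M} in
-- The elements `m ⊗ p` with `p` outside `I` span additively, by `tensorEquiv`.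
theorem tensor_induction {i j : V} {P : (tensorRep M (projRep k ρ i)).branch j → Prop}
    (h : ∀ (p : Quiver.Path i j) m, ¬ MemIdeal k ρ p → P (tensorIncl ρ M p m)) (h0 : P 0)
    (hadd : ∀ s t, P s → P t → P (s + t)) (t) : P t := by
  obtain ⟨x, rfl⟩ := (tensorEquiv ρ M i j).symm.surjective t
  induction x using Finsupp.induction_linear with
  | zero => rwa [map_zero]
  | add x y hx hy =>
    rw [map_add]
    exact hadd _ _ hx hy
  | single p m =>
    rw [← tensorEquiv_tensorIncl ρ M p.1 p.2 m, LinearEquiv.symm_apply_apply]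
    exact h p.1 m p.2

open Classical in
/-- The coordinate of the elements of `M ⊗ P(i)` along a path. -/
def tensorCoord {i j : V} (p : Quiver.Path i j) :
    (tensorRep M (projRep k ρ i)).branch j →ₗ[A] M :=
  if hp : MemIdeal k ρ p then 0 else
    Finsupp.lapply (R := A) (⟨p, hp⟩ : {p : Quiver.Path i j // ¬ MemIdeal k ρ p}) ∘ₗ
      (tensorEquiv ρ M i j).toLinearMap

theorem tensorCoord_eq_zero {i j : V} (p : Quiver.Path i j) (hp : MemIdeal k ρ p)
    (t : (tensorRep M (projRep k ρ i)).branch j) : tensorCoord ρ M p t = 0 := by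
  rw [tensorCoord, dif_pos hp]
  rfl

theorem tensorCoord_eq {i j : V} (p : Quiver.Path i j) (hp : ¬ MemIdeal k ρ p)
    (t : (tensorRep M (projRep k ρ i)).branch j) :
    tensorCoord ρ M p t = tensorEquiv ρ M i j t ⟨p, hp⟩ := by
  rw [tensorCoord, dif_neg hp]
  rfl

theorem tensorCoord_tensorIncl {i j : V} (p : Quiver.Path i j) (hp : ¬ MemIdeal k ρ p) (m : M) :
    tensorCoord (k := k) ρ M p (tensorIncl ρ M p m) = m := by
  rw [tensorCoord_eq ρ M p hp, tensorEquiv_tensorIncl ρ M p hp, Finsupp.single_eq_same]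

theorem tensorCoord_tensorIncl_of_ne {i j : V} {p q : Quiver.Path i j} (h : p ≠ q) (m : M) :
    tensorCoord (k := k) ρ M q (tensorIncl ρ M p m) = 0 := by
  by_cases hq : MemIdeal k ρ q
  · exact tensorCoord_eq_zero ρ M q hq _
  by_cases hp : MemIdeal k ρ p
  · rw [tensorIncl_eq_zero ρ M p hp, map_zero]
  rw [tensorCoord_eq ρ M q hq, tensorEquiv_tensorIncl ρ M p hp, Finsupp.single_eq_of_ne]
  exact fun h' => h (congrArg Subtype.val h').symm

variable {M} in
theorem tensor_eq_zero {i j : V} {t : (tensorRep M (projRep k ρ i)).branch j}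
    (h : ∀ p : Quiver.Path i j, tensorCoord ρ M p t = 0) : t = 0 := by
  apply (tensorEquiv ρ M i j).injective
  rw [map_zero]
  ext p
  rw [← tensorCoord_eq ρ M p.1 p.2, h]
  rfl

variable {M}

/-- Appending `α` is injective on paths, so an arrow only relabels coordinates as long as the longer
path stays outside `I`. -/
theorem tensorCoord_cons_mapArrow {i j l : V} (p : Quiver.Path i j) (α : j ⟶ l)
    (hp : ¬ MemIdeal k ρ (p.cons α)) (t : (tensorRep M (projRep k ρ i)).branch j) :
    tensorCoord ρ M (p.cons α) ((tensorRep M (projRep k ρ i)).mapArrow α t) =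
      tensorCoord ρ M p t := by
  have hp' : ¬ MemIdeal k ρ p := fun h => hp (h.comp_left α.toPath)
  refine tensor_induction ρ (P := fun t => tensorCoord ρ M (p.cons α)
    ((tensorRep M (projRep k ρ i)).mapArrow α t) = tensorCoord ρ M p t) ?_ ?_ ?_ t
  · intro q m hq
    rw [mapArrow_tensorIncl]
    by_cases h : q = p
    · subst h
      rw [tensorCoord_tensorIncl _ _ _ hp, tensorCoord_tensorIncl _ _ _ hp']
    · rw [tensorCoord_tensorIncl_of_ne _ _ h, tensorCoord_tensorIncl_of_ne]
      intro h'
      injection h' with _ _ h1 _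
      exact h h1
  · simp only [map_zero]
  · intro s t hs ht
    simp only [map_add, hs, ht]

/-- A path determines its last arrow, so different arrows have images supported on disjoint sets of
paths. This gives (m1) for `M ⊗ P(i)`. -/
theorem tensorCoord_cons_mapArrow_of_ne {i j j' l : V} (p : Quiver.Path i j') (β : j' ⟶ l)
    (α : j ⟶ l) (h : (⟨j, α⟩ : Σ j, (j ⟶ l)) ≠ ⟨j', β⟩)
    (t : (tensorRep M (projRep k ρ i)).branch j) :
    tensorCoord ρ M (p.cons β) ((tensorRep M (projRep k ρ i)).mapArrow α t) = 0 := by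
  refine tensor_induction ρ (P := fun t => tensorCoord ρ M (p.cons β)
    ((tensorRep M (projRep k ρ i)).mapArrow α t) = 0) ?_ ?_ ?_ t
  · intro q m hq
    rw [mapArrow_tensorIncl, tensorCoord_tensorIncl_of_ne]
    intro h'
    injection h' with h1 _ _ h3
    subst h1
    rw [eq_of_heq h3] at h
    exact h rfl
  · simp only [map_zero]
  · intro s t hs ht
    simp only [map_add, hs, ht, add_zero]

theorem tensorCoord_nil_of_mem {i : V} {t : (tensorRep M (projRep k ρ i)).branch i}
    (ht : t ∈ (tensorRep M (projRep k ρ i)).arrowImage i) :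
    tensorCoord ρ M Quiver.Path.nil t = 0 := by
  refine QRep.arrowImage_induction _
    (P := fun t => tensorCoord ρ M Quiver.Path.nil t = 0) ?_ (map_zero _) ?_ ht
  · intro j α t
    refine tensor_induction ρ (P := fun t => tensorCoord ρ M Quiver.Path.nil
      ((tensorRep M (projRep k ρ i)).mapArrow α t) = 0) ?_ ?_ ?_ t
    · intro q m hq
      rw [mapArrow_tensorIncl, tensorCoord_tensorIncl_of_ne]
      rintro ⟨⟩
    · simp only [map_zero]
    · intro s t hs ht
      simp only [map_add, hs, ht, add_zero]
  · intro s t hs ht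
    rw [map_add, hs, ht, add_zero]

theorem tensorIncl_mem_arrowImage {i j : V} (p : Quiver.Path i j) (hp : 0 < p.length) (m : M) :
    tensorIncl (k := k) ρ M p m ∈ (tensorRep M (projRep k ρ i)).arrowImage j := by
  cases p with
  | nil => exact absurd hp (lt_irrefl _)
  | cons p α =>
    rw [← mapArrow_tensorIncl]
    exact QRep.mapArrow_mem_arrowImage _ α _

theorem arrowImage_tensor_eq_top {i j : V} (h : i ≠ j)
    (t : (tensorRep M (projRep k ρ i)).branch j) :
    t ∈ (tensorRep M (projRep k ρ i)).arrowImage j := by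
  refine tensor_induction ρ (P := fun t => t ∈ (tensorRep M (projRep k ρ i)).arrowImage j)
    ?_ (zero_mem _) (fun _ _ => add_mem) t
  intro p m _
  refine tensorIncl_mem_arrowImage ρ p ?_ m
  cases p with
  | nil => exact absurd rfl h
  | cons p α => simp

theorem eq_tensorIncl_nil (hQ : IsAcyclicQuiver V) {i : V}
    (t : (tensorRep M (projRep k ρ i)).branch i) :
    t = tensorIncl ρ M Quiver.Path.nil (tensorCoord ρ M Quiver.Path.nil t) := by
  refine tensor_induction ρ (P := fun t => t =
    tensorIncl ρ M Quiver.Path.nil (tensorCoord ρ M Quiver.Path.nil t)) ?_ ?_ ?_ t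
  · intro p m hp
    obtain rfl : p = Quiver.Path.nil := Quiver.Path.eq_nil_of_length_zero p (hQ i p)
    rw [tensorCoord_tensorIncl _ _ _ hp]
  · simp only [map_zero]
  · intro s t hs ht
    rw [map_add, map_add, ← hs, ← ht]

theorem IsAdmissible.not_memIdeal_nil (hρ : IsAdmissible k ρ) (i : V) :
    ¬ MemIdeal k ρ (Quiver.Path.nil : Quiver.Path i i) := fun h => by
  simpa using hρ.two_le_length h

variable (M) in
theorem satisfiesRelations_tensorRep (i : V) :
    SatisfiesRelations ρ (tensorRep M (projRep k ρ i)) := by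
  intro a b r hr t
  refine tensor_induction ρ (P := fun t => (tensorRep M (projRep k ρ i)).mapPath r t = 0)
    ?_ (map_zero _) ?_ t
  · intro p m _
    rw [mapPath_tensorIncl]
    exact tensorIncl_eq_zero ρ M _
      ((memIdeal_iff _).2 ⟨a, b, p, r, Quiver.Path.nil, hr, rfl⟩) m
  · intro s t hs ht
    rw [map_add, hs, ht, add_zero]

variable [∀ j : V, Fintype (Σ i : V, (i ⟶ j))]

variable (M) in
-- In the path coordinates an arrow acts by the partial injection `p ↦ αp`, undefined exactly when
-- `αp ∈ I`. The images of different arrows involve different paths, and the kernel of an arrow is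
-- spanned by the paths on which it is undefined.
theorem isMonic_tensorRep (hρ : IsAdmissible k ρ) (i : V) :
    IsMonic k ρ (tensorRep M (projRep k ρ i)) where
  relations := satisfiesRelations_tensorRep ρ M i
  direct j x hx a := by
    refine tensor_eq_zero (k := k) ρ fun p => ?_
    cases p with
    | nil => exact tensorCoord_nil_of_mem ρ (QRep.mapArrow_mem_arrowImage _ a.2 _)
    | cons p β =>
      by_cases h : a = ⟨_, β⟩
      · subst h
        have h1 := congrArg (tensorCoord ρ M (p.cons β)) hx
        rw [map_sum, map_zero, Finset.sum_eq_single ⟨_, β⟩] at h1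
        · exact h1
        · intro b _ hb
          exact tensorCoord_cons_mapArrow_of_ne ρ p β b.2 hb _
        · simp
      · exact tensorCoord_cons_mapArrow_of_ne ρ p β a.2 h _
  ker_le j l α t ht := by
    have h1 : ∀ p : Quiver.Path i j, ¬ MemIdeal k ρ (p.cons α) →
        tensorCoord (k := k) ρ M p t = 0 := by
      intro p hp
      rw [← tensorCoord_cons_mapArrow ρ p α hp, ht, map_zero]
    rw [← (tensorEquiv ρ M i j).symm_apply_apply t,
      ← Finsupp.sum_single (tensorEquiv ρ M i j t), Finsupp.sum, map_sum]
    refine sum_mem fun p hp => ?_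
    rw [← tensorEquiv_tensorIncl ρ M p.1 p.2, LinearEquiv.symm_apply_apply]
    have hpα : MemIdeal k ρ (p.1.cons α) := by
      by_contra h
      rw [Finsupp.mem_support_iff, ← tensorCoord_eq ρ M p.1 p.2] at hp
      exact hp (h1 p.1 h)
    -- The element `m ⊗ p` is the image along `p` of `m ⊗ e_i`, hence a generator of the required
    -- subgroup.
    have h2 := mapPath_tensorIncl (k := k) ρ M (Quiver.Path.nil : Quiver.Path i i) p.1
      (tensorEquiv ρ M i j t p)
    rw [Quiver.Path.nil_comp] at h2
    rw [← h2]
    refine QRep.mapPath_mem_kerImage _ ⟨?_, p.2, hpα⟩ _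
    -- Since `αp ∈ I` has length at least two, `p` is nontrivial, as membership in `K_α` demands.
    have := hρ.two_le_length hpα
    rw [Quiver.Path.length_cons] at this
    change 1 ≤ p.1.length
    omega

end Coordinates

end SMon

namespace SMon

/-! ### Short exact sequences, products and the universal property of `M ⊗ P(i)` -/

section Exactness

variable {V : Type} [Quiver.{0} V] {R : Type u} [Ring R]

theorem exists_comp_eq_of_range_le {M N L : Type*} [AddCommGroup M] [AddCommGroup N]
    [AddCommGroup L] [Module R M] [Module R N] [Module R L] {f : M →ₗ[R] N}
    (hf : Function.Injective f) (h : L →ₗ[R] N) (hh : ∀ x, ∃ y, f y = h x) :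
    ∃ l : L →ₗ[R] M, ∀ x, f (l x) = h x := by
  refine ⟨(LinearEquiv.ofInjective f hf).symm.toLinearMap ∘ₗ
    h.codRestrict (LinearMap.range f) hh, fun x => ?_⟩
  exact congrArg Subtype.val ((LinearEquiv.ofInjective f hf).apply_symm_apply ⟨h x, hh x⟩)

theorem shortExact_module_iff (S : ShortComplex (ModuleCat.{u} R)) :
    S.ShortExact ↔ Function.Injective S.f.hom ∧ Function.Surjective S.g.hom ∧
      Function.Exact S.f.hom S.g.hom :=
  ⟨fun h => ⟨h.moduleCat_injective_f, h.moduleCat_surjective_g,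
    (ShortComplex.ShortExact.moduleCat_exact_iff_function_exact S).1 h.exact⟩,
    fun h => ModuleCat.shortComplex_shortExact S h.2.2 h.1 h.2.1⟩

theorem shortExact_iff (S : ShortComplex (QRep V R)) :
    S.ShortExact ↔ ∀ j, Function.Injective (QRep.homAt S.f j) ∧
      Function.Surjective (QRep.homAt S.g j) ∧
      Function.Exact (QRep.homAt S.f j) (QRep.homAt S.g j) := by
  constructor
  · intro h j
    exact (shortExact_module_iff _).1
      (h.map_of_exact ((evaluation (Paths V) (ModuleCat.{u} R)).obj (show Paths V from j)))
  · intro h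
    have : ∀ j, Mono (S.f.app j) := fun j => (ModuleCat.mono_iff_injective _).2 (h j).1
    have : ∀ j, Epi (S.g.app j) := fun j => (ModuleCat.epi_iff_surjective _).2 (h j).2.1
    have hf : Mono S.f := NatTrans.mono_of_mono_app S.f
    have hg : Epi S.g := NatTrans.epi_of_epi_app S.g
    refine ⟨S.exact_of_f_is_kernel (KernelFork.IsLimit.ofι' S.f S.zero fun {W} l hl => ?_)⟩
    -- The factorization through the kernel is chosen at each vertex separately; injectivity of
    -- `S.f` makes these choices compatible with the arrows.
    have ex : ∀ j, ∃ m : W.branch j →ₗ[R] S.X₁.branch j, ∀ x,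
        QRep.homAt S.f j (m x) = QRep.homAt l j x := fun j =>
      exists_comp_eq_of_range_le (h j).1 (QRep.homAt l j) fun x =>
        ((h j).2.2 _).1 (LinearMap.congr_fun (congrArg (fun t => QRep.homAt t j) hl) x)
    choose m hm using ex
    refine ⟨QRep.homMk m fun i j α x => (h j).1 ?_, QRep.hom_ext fun j x => hm j x⟩
    rw [hm, QRep.homAt_mapArrow, QRep.homAt_mapArrow, hm]

end Exactness

/-! ### Quotients of the branches by the arrow images. -/

section Cokernels

variable {V : Type} [Quiver.{0} V] {R : Type u} [Ring R]

namespace QRep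

/-- The projection of a branch onto its quotient by the images of the arrows. -/
def cokMk (X : QRep V R) (j : V) : X.branch j →ₗ[R] X.cok j := (X.arrowImage j).mkQ

theorem cokMk_surjective (X : QRep V R) (j : V) : Function.Surjective (X.cokMk j) :=
  (X.arrowImage j).mkQ_surjective

theorem cokMk_eq_zero (X : QRep V R) {j : V} {x : X.branch j} :
    X.cokMk j x = 0 ↔ x ∈ X.arrowImage j := Submodule.Quotient.mk_eq_zero _

theorem sub_mem_arrowImage (X : QRep V R) {j : V} {x y : X.branch j} :
    x - y ∈ X.arrowImage j ↔ X.cokMk j x = X.cokMk j y := by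
  rw [← cokMk_eq_zero, map_sub, sub_eq_zero]

/-- The map induced by a morphism on the quotients by the images of the arrows. -/
def cokMap {X Y : QRep V R} (f : X ⟶ Y) (j : V) : X.cok j →ₗ[R] Y.cok j :=
  Submodule.mapQ _ _ (homAt f j) (arrowImage_le_comap f j)

theorem cokMap_cokMk {X Y : QRep V R} (f : X ⟶ Y) {j : V} (x : X.branch j) :
    cokMap f j (X.cokMk j x) = Y.cokMk j (homAt f j x) := rfl

/-- The linear map out of the quotient by the images of the arrows. -/
def cokDesc (X : QRep V R) {j : V} {M : Type*} [AddCommGroup M] [Module R M]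
    (g : X.branch j →ₗ[R] M) (hg : ∀ x ∈ X.arrowImage j, g x = 0) : X.cok j →ₗ[R] M :=
  (X.arrowImage j).liftQ g hg

theorem cokDesc_cokMk (X : QRep V R) {j : V} {M : Type*} [AddCommGroup M] [Module R M]
    (g : X.branch j →ₗ[R] M) (hg : ∀ x ∈ X.arrowImage j, g x = 0) (x : X.branch j) :
    X.cokDesc g hg (X.cokMk j x) = g x := rfl

end QRep

end Cokernels

/-! ### Finite products of representations. -/

section Products

variable {V : Type} [Quiver.{0} V] {R : Type u} [Ring R] {ι : Type}

/-- The product of a family of representations, with the products of modules as branches. -/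
def piRep (T : ι → QRep V R) : QRep V R where
  obj j := ModuleCat.of R (∀ a, (T a).branch j)
  map p := ModuleCat.ofHom (LinearMap.pi fun a => (T a).mapPath p ∘ₗ LinearMap.proj a)
  map_id j := by
    apply ModuleCat.hom_ext
    ext x a
    exact (T a).mapPath_nil (x a)
  map_comp p q := by
    apply ModuleCat.hom_ext
    ext x a
    exact (T a).mapPath_comp p q (x a)

variable (T : ι → QRep V R)

theorem piRep_mapArrow {i j : V} (α : i ⟶ j) (x : (piRep T).branch i) (a : ι) :
    ((piRep T).mapArrow α x : ∀ a, (T a).branch j) a =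
      (T a).mapArrow α ((x : ∀ a, (T a).branch i) a) := rfl

/-- The projections of a product. -/
def piProj (a : ι) : piRep T ⟶ T a :=
  QRep.homMk (fun j => (LinearMap.proj a : (∀ a, (T a).branch j) →ₗ[R] (T a).branch j))
    fun _ _ _ _ => rfl

theorem piProj_apply (a : ι) {j : V} (x : (piRep T).branch j) :
    QRep.homAt (piProj T a) j x = (x : ∀ a, (T a).branch j) a := rfl

open Classical in
/-- The inclusions of the factors of a product. -/
def piIncl (a : ι) : T a ⟶ piRep T :=
  QRep.homMk (fun j => (LinearMap.single R (fun a => (T a).branch j) a :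
      (T a).branch j →ₗ[R] (∀ a, (T a).branch j)))
    fun i j α x => by
      funext b
      rw [piRep_mapArrow]
      change (Pi.single a ((T a).mapArrow α x) : ∀ a, (T a).branch j) b =
        (T b).mapArrow α ((Pi.single a x : ∀ a, (T a).branch i) b)
      by_cases h : b = a
      · subst h
        rw [Pi.single_eq_same, Pi.single_eq_same]
      · rw [Pi.single_eq_of_ne h, Pi.single_eq_of_ne h, map_zero]

theorem piIncl_apply_same (a : ι) {j : V} (x : (T a).branch j) :
    (QRep.homAt (piIncl T a) j x : ∀ a, (T a).branch j) a = x := by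
  classical
  change (Pi.single a x : ∀ a, (T a).branch j) a = x
  rw [Pi.single_eq_same]

theorem piIncl_apply_of_ne {a b : ι} (h : b ≠ a) {j : V} (x : (T a).branch j) :
    (QRep.homAt (piIncl T a) j x : ∀ a, (T a).branch j) b = 0 := by
  classical
  change (Pi.single a x : ∀ a, (T a).branch j) b = 0
  rw [Pi.single_eq_of_ne h]

theorem sum_piIncl [Fintype ι] {j : V} (x : (piRep T).branch j) :
    ∑ a, QRep.homAt (piIncl T a) j ((x : ∀ a, (T a).branch j) a) = x := by
  funext b
  have h : (∑ a, QRep.homAt (piIncl T a) j ((x : ∀ a, (T a).branch j) a) :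
      ∀ a, (T a).branch j) b = ∑ a, (QRep.homAt (piIncl T a) j
        ((x : ∀ a, (T a).branch j) a) : ∀ a, (T a).branch j) b :=
    Finset.sum_apply (M := fun a => (T a).branch j) b Finset.univ _
  refine h.trans ?_
  rw [Finset.sum_eq_single b]
  · exact piIncl_apply_same T b _
  · intro c _ hc
    exact piIncl_apply_of_ne T hc.symm _
  · simp

theorem mem_arrowImage_piRep_iff [∀ j : V, Fintype (Σ i : V, (i ⟶ j))] {j : V}
    (x : (piRep T).branch j) :
    x ∈ (piRep T).arrowImage j ↔ ∀ a, (x : ∀ a, (T a).branch j) a ∈ (T a).arrowImage j := by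
  constructor
  · intro hx a
    exact QRep.homAt_mem_arrowImage (piProj T a) hx
  · intro hx
    choose y hy using fun a => ((T a).mem_arrowImage_iff j _).1 (hx a)
    refine ((piRep T).mem_arrowImage_iff j x).2 ⟨fun b a => y a b, ?_⟩
    funext a
    rw [← hy]
    exact Finset.sum_apply (M := fun a => (T a).branch j) a Finset.univ _

theorem isMonic_piRep {k : Type u} [Field k] [∀ j : V, Fintype (Σ i : V, (i ⟶ j))]
    {ρ : ∀ a b : V, Set (Quiver.Path a b)} [Finite ι] (hT : ∀ a, IsMonic k ρ (T a)) :
    IsMonic k ρ (piRep T) where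
  relations a b r hr x := by
    funext c
    exact (hT c).relations r hr _
  direct j x hx b := by
    funext a
    refine (hT a).direct j (fun b => (x b : ∀ a, (T a).branch b.1) a) ?_ b
    have := congrArg (QRep.homAt (piProj T a) j) hx
    rwa [map_sum, map_zero] at this
  ker_le j i α x hx := by
    have := Fintype.ofFinite ι
    rw [← sum_piIncl T x]
    refine sum_mem fun a _ => QRep.homAt_mem_kerImage _ ((hT a).ker_le α _ ?_)
    have := congrArg (QRep.homAt (piProj T a) i) hx
    rwa [map_zero, QRep.homAt_mapArrow] at this

end Products

/-! ### Maps out of direct sums of the `M ⊗ P(i)`. -/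

section Universal

variable {k : Type u} [Field k] {V : Type} [Quiver.{0} V] {A : Type u} [Ring A] [Algebra k A]
  {ρ : ∀ a b : V, Set (Quiver.Path a b)}

/-- The morphism from `M ⊗ P(i)` determined by a linear map from `M` to the branch at `i`. -/
def tensorDesc (k : Type u) [Field k] [Algebra k A] {M : ModuleCat.{u} A} {i : V} {Y : QRep V A}
    (hY : SatisfiesRelations ρ Y)
    (v : M →ₗ[A] Y.branch i) : tensorRep M (projRep k ρ i) ⟶ Y :=
  QRep.homMk (fun j => Finsupp.lsum ℕ
      (fun p : {p : Quiver.Path i j // ¬ MemIdeal k ρ p} => Y.mapPath p.1 ∘ₗ v) ∘ₗ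
        (tensorEquiv ρ M i j).toLinearMap) fun j l α t => by
    refine tensor_induction ρ (P := fun t => (Finsupp.lsum ℕ
      (fun p : {p : Quiver.Path i l // ¬ MemIdeal k ρ p} => Y.mapPath p.1 ∘ₗ v) ∘ₗ
        (tensorEquiv ρ M i l).toLinearMap) ((tensorRep M (projRep k ρ i)).mapArrow α t) =
      Y.mapArrow α ((Finsupp.lsum ℕ
      (fun p : {p : Quiver.Path i j // ¬ MemIdeal k ρ p} => Y.mapPath p.1 ∘ₗ v) ∘ₗ
        (tensorEquiv ρ M i j).toLinearMap) t)) ?_ ?_ ?_ t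
    · intro p m hp
      rw [mapArrow_tensorIncl, LinearMap.comp_apply, LinearMap.comp_apply, LinearEquiv.coe_coe,
        LinearEquiv.coe_coe, tensorEquiv_tensorIncl ρ M p hp, Finsupp.lsum_single,
        LinearMap.comp_apply, ← QRep.mapPath_cons]
      by_cases h : MemIdeal k ρ (p.cons α)
      · rw [tensorIncl_eq_zero ρ M _ h, map_zero, map_zero, hY.mapPath_eq_zero h]
      · rw [tensorEquiv_tensorIncl ρ M _ h, Finsupp.lsum_single, LinearMap.comp_apply]
    · simp only [map_zero]
    · intro s t hs ht
      rw [map_add, map_add, map_add, map_add, hs, ht]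

theorem tensorDesc_tensorIncl {M : ModuleCat.{u} A} {i j : V} {Y : QRep V A}
    (hY : SatisfiesRelations ρ Y) (v : M →ₗ[A] Y.branch i) (p : Quiver.Path i j) (m : M) :
    QRep.homAt (tensorDesc k hY v) j (tensorIncl ρ M p m) = Y.mapPath p (v m) := by
  by_cases h : MemIdeal k ρ p
  · rw [tensorIncl_eq_zero ρ M _ h, map_zero, hY.mapPath_eq_zero h]
  · rw [tensorDesc, QRep.homAt_homMk, LinearMap.comp_apply, LinearEquiv.coe_coe,
      tensorEquiv_tensorIncl ρ M _ h, Finsupp.lsum_single, LinearMap.comp_apply]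

/-- The representation `M ⊗ P(i)` is generated by its elements `m ⊗ e_i` at the vertex `i`. -/
theorem tensor_hom_ext {M : ModuleCat.{u} A} {i : V} {Y : QRep V A}
    {f g : tensorRep M (projRep k ρ i) ⟶ Y}
    (h : ∀ m, QRep.homAt f i (tensorIncl ρ M Quiver.Path.nil m) =
      QRep.homAt g i (tensorIncl ρ M Quiver.Path.nil m)) : f = g := by
  refine QRep.hom_ext fun j t => tensor_induction ρ
    (P := fun t => QRep.homAt f j t = QRep.homAt g j t) ?_ ?_ ?_ t
  · intro p m _
    have := mapPath_tensorIncl (k := k) ρ M (Quiver.Path.nil : Quiver.Path i i) p m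
    rw [Quiver.Path.nil_comp] at this
    rw [← this, QRep.homAt_mapPath, QRep.homAt_mapPath, h]
  · simp only [map_zero]
  · intro s t hs ht
    rw [map_add, map_add, hs, ht]

variable (ρ)

/-- The direct sum of the representations `M i ⊗ P(i)`. -/
abbrev freeRep (k : Type u) [Field k] [Algebra k A] (M : V → ModuleCat.{u} A) : QRep V A :=
  piRep fun i : V => tensorRep (M i) (projRep k ρ i)

variable (M : V → ModuleCat.{u} A)

/-- The projection of the branch of `freeRep` onto its quotient by the images of the arrows. -/
def freeTop (k : Type u) [Field k] [Algebra k A] (j : V) :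
    (freeRep ρ k M).branch j →ₗ[A] M j :=
  tensorCoord ρ (M j) Quiver.Path.nil ∘ₗ
    QRep.homAt (piProj (fun i : V => tensorRep (M i) (projRep k ρ i)) j) j

/-- The inclusion of the generators of `freeRep`. -/
def freeGen (k : Type u) [Field k] [Algebra k A] (j : V) :
    M j →ₗ[A] (freeRep ρ k M).branch j :=
  QRep.homAt (piIncl (fun i : V => tensorRep (M i) (projRep k ρ i)) j) j ∘ₗ
    tensorIncl ρ (M j) Quiver.Path.nil

theorem freeTop_freeGen (hρ : IsAdmissible k ρ) {j : V} (m : M j) :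
    freeTop ρ M k j (freeGen ρ M k j m) = m := by
  rw [freeTop, freeGen, LinearMap.comp_apply, LinearMap.comp_apply, piProj_apply,
    piIncl_apply_same, tensorCoord_tensorIncl ρ (M j) _ (hρ.not_memIdeal_nil ρ j)]

theorem exists_freeRep_hom [Finite V] {Y : QRep V A} (hY : SatisfiesRelations ρ Y)
    (v : ∀ i, M i →ₗ[A] Y.branch i) :
    ∃ f : freeRep ρ k M ⟶ Y, ∀ i m, QRep.homAt f i (freeGen ρ M k i m) = v i m := by
  classical
  have := Fintype.ofFinite V
  let T : V → QRep V A := fun i => tensorRep (M i) (projRep k ρ i)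
  have hsum : ∀ j (x : (freeRep ρ k M).branch j), ∀ (s : Finset V),
      QRep.homAt (∑ i ∈ s, piProj T i ≫ tensorDesc k hY (v i)) j x =
        ∑ i ∈ s, QRep.homAt (tensorDesc k hY (v i)) j ((x : ∀ a, (T a).branch j) i) := by
    intro j x s
    induction s using Finset.induction_on with
    | empty => simp only [Finset.sum_empty]; rfl
    | insert a s ha ih =>
      rw [Finset.sum_insert ha, Finset.sum_insert ha, ← ih]
      rfl
  refine ⟨∑ i, piProj T i ≫ tensorDesc k hY (v i), fun i m => ?_⟩
  rw [hsum, freeGen, LinearMap.comp_apply, Finset.sum_eq_single i]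
  · rw [piIncl_apply_same, tensorDesc_tensorIncl, QRep.mapPath_nil]
  · intro b _ hb
    rw [piIncl_apply_of_ne _ hb, map_zero]
  · simp

variable [∀ j : V, Fintype (Σ i : V, (i ⟶ j))]

theorem isMonic_freeRep [Finite V] (hρ : IsAdmissible k ρ) : IsMonic k ρ (freeRep ρ k M) :=
  isMonic_piRep _ fun i => isMonic_tensorRep ρ (M i) hρ i

/-- At `j`, the summands with `i ≠ j` only involve nontrivial paths, hence lie in the arrow images,
while the summand with `i = j` only involves the trivial path by acyclicity. Thus `Cok_j` of the
direct sum is `M j`. -/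
theorem mem_arrowImage_freeRep_iff (hQ : IsAcyclicQuiver V) {j : V}
    (x : (freeRep ρ k M).branch j) :
    x ∈ (freeRep ρ k M).arrowImage j ↔ freeTop ρ M k j x = 0 := by
  rw [mem_arrowImage_piRep_iff]
  constructor
  · intro h
    exact tensorCoord_nil_of_mem ρ (h j)
  · intro h i
    by_cases hij : i = j
    · subst hij
      have h0 : tensorCoord (k := k) ρ (M i) Quiver.Path.nil
          ((x : ∀ a, (tensorRep (M a) (projRep k ρ a)).branch i) i) = 0 := h
      rw [eq_tensorIncl_nil ρ hQ ((x : ∀ a, (tensorRep (M a) (projRep k ρ a)).branch i) i), h0,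
        map_zero]
      exact zero_mem _
    · exact arrowImage_tensor_eq_top ρ hij _

theorem sub_freeGen_mem_arrowImage (hQ : IsAcyclicQuiver V) (hρ : IsAdmissible k ρ) {j : V}
    (x : (freeRep ρ k M).branch j) :
    x - freeGen ρ M k j (freeTop ρ M k j x) ∈ (freeRep ρ k M).arrowImage j := by
  rw [mem_arrowImage_freeRep_iff ρ M hQ, map_sub, freeTop_freeGen ρ M hρ, sub_self]

/-- A monic representation in which the images of the arrows have complements is a direct sum of
representations `M ⊗ P(i)`. -/
theorem IsMonic.exists_iso_freeRep [Finite V] (hQ : IsAcyclicQuiver V) (hρ : IsAdmissible k ρ)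
    {X : QRep V A} (hX : IsMonic k ρ X)
    (σ : ∀ j, X.cok j →ₗ[A] X.branch j) (hσ : ∀ j c, X.cokMk j (σ j c) = c) :
    Nonempty (freeRep ρ k (fun j => X.cok j) ≅ X) := by
  obtain ⟨rk, hrk⟩ := hQ.exists_rank
  obtain ⟨f, hf⟩ := exists_freeRep_hom (k := k) ρ (fun j => X.cok j) hX.relations σ
  -- Because `f` sends generators to the chosen representatives `σ`, it induces on each `Cok_j` the
  -- canonical identification, and the bijectivity criterion applies.
  have key : ∀ j x, X.cokMk j (QRep.homAt f j x) = freeTop ρ (fun j => X.cok j) k j x := by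
    intro j x
    have h1 := QRep.homAt_mem_arrowImage f (sub_freeGen_mem_arrowImage ρ _ hQ hρ x)
    rwa [map_sub, hf, QRep.sub_mem_arrowImage, hσ] at h1
  have hb := IsMonic.bijective_of_cok (isMonic_freeRep ρ _ hρ).relations hX f hrk
    (fun j y => ⟨freeGen ρ _ k j (X.cokMk j y), by
      rw [QRep.sub_mem_arrowImage, key, freeTop_freeGen ρ _ hρ]⟩)
    (fun j x hx => by
      rwa [mem_arrowImage_freeRep_iff ρ _ hQ, ← key, QRep.cokMk_eq_zero])
  have := QRep.isIso_of_bijective f hb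
  exact ⟨asIso f⟩

end Universal

end SMon

namespace SMon

/-! ### Kernels and cokernels of morphisms between monic representations -/

section Extension

variable {k : Type u} [Field k] {V : Type} [Quiver.{0} V] {R : Type u} [Ring R]
  [∀ j : V, Fintype (Σ i : V, (i ⟶ j))] {ρ : ∀ a b : V, Set (Quiver.Path a b)}

/-- Write `f x` as a sum of terms `Y_α(y_α)`. In `Z` the terms sum to zero, so by (m1) each `g(y_α)`
is killed by `α`, and by (m2) it lifts to some `y'` in the subgroup generated along `K_α` in `Y`. As
`α` kills `y'`, replacing `y_α` by `y_α - y'`, which comes from `X`, changes nothing. This is left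
exactness of `Cok_j`. -/
theorem IsMonic.mem_arrowImage_of_exact {X Y Z : QRep V R} (hY : SatisfiesRelations ρ Y)
    (hZ : IsMonic k ρ Z) (f : X ⟶ Y) (g : Y ⟶ Z)
    (hf : ∀ j, Function.Injective (QRep.homAt f j))
    (hg : ∀ j, Function.Surjective (QRep.homAt g j))
    (hfg : ∀ j, Function.Exact (QRep.homAt f j) (QRep.homAt g j)) {j : V} {x : X.branch j}
    (hx : QRep.homAt f j x ∈ Y.arrowImage j) : x ∈ X.arrowImage j := by
  obtain ⟨y, hy⟩ := (Y.mem_arrowImage_iff j _).1 hx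
  have h0 : ∑ a : (Σ i : V, (i ⟶ j)), Z.mapArrow a.2 (QRep.homAt g a.1 (y a)) = 0 := by
    simp only [← QRep.homAt_mapArrow]
    rw [← map_sum, hy, (hfg j).apply_apply_eq_zero]
  have h1 : ∀ a : (Σ i : V, (i ⟶ j)), ∃ z, Y.mapArrow a.2 (y a) =
      Y.mapArrow a.2 (QRep.homAt f a.1 z) := by
    intro a
    obtain ⟨y', hy', hgy'⟩ : ∃ y' ∈ Y.kerImage k ρ a.2,
        QRep.homAt g a.1 y' = QRep.homAt g a.1 (y a) := by
      refine QRep.kerImage_induction (P := fun w => ∃ y' ∈ Y.kerImage k ρ a.2,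
        QRep.homAt g a.1 y' = w) ?_ ?_ ?_
        (hZ.ker_le a.2 _ (hZ.direct j (fun a => QRep.homAt g a.1 (y a)) h0 a))
      · intro b p w hp
        obtain ⟨w', rfl⟩ := hg b w
        exact ⟨Y.mapPath p w', Y.mapPath_mem_kerImage hp w', QRep.homAt_mapPath g p w'⟩
      · exact ⟨0, zero_mem _, map_zero _⟩
      · rintro _ _ ⟨z, hz, rfl⟩ ⟨z', hz', rfl⟩
        exact ⟨z + z', add_mem hz hz', map_add _ _ _⟩
    obtain ⟨z, hz⟩ := (hfg a.1 (y a - y')).1 (by rw [map_sub, hgy', sub_self])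
    exact ⟨z, by rw [hz, map_sub, hY.mapArrow_eq_zero hy', sub_zero]⟩
  choose z hz using h1
  refine (X.mem_arrowImage_iff j x).2 ⟨z, hf j ?_⟩
  rw [map_sum, ← hy]
  exact Finset.sum_congr rfl fun a _ => by rw [QRep.homAt_mapArrow, hz]

/-- A morphism extends along a monomorphism of monic representations if certain linear maps
at the vertices extend. -/
theorem IsMonic.exists_extension [Finite V] {X Y J : QRep V R} (hY : IsMonic k ρ Y)
    (hJ : SatisfiesRelations ρ J) {rk : V → ℕ} (hrk : ∀ ⦃i j : V⦄, (i ⟶ j) → rk i < rk j)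
    (f : X ⟶ Y) (hf : ∀ j, Function.Injective (QRep.homAt f j))
    (hcok : ∀ j (x : X.branch j), QRep.homAt f j x ∈ Y.arrowImage j → x ∈ X.arrowImage j)
    (g : X ⟶ J)
    (ext : ∀ j (ψ : ↥(Y.arrowImage j ⊔ LinearMap.range (QRep.homAt f j)) →ₗ[R] J.branch j),
      ∃ ψ' : Y.branch j →ₗ[R] J.branch j,
        ∀ w : ↥(Y.arrowImage j ⊔ LinearMap.range (QRep.homAt f j)),
        ψ' w = ψ w) :
    ∃ h : Y ⟶ J, f ≫ h = g := by
  obtain ⟨h, hh⟩ := hY.exists_hom hJ hrk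
    (fun j h => ∀ x, h (QRep.homAt f j x) = QRep.homAt g j x) (by
    intro j h hP φ hφ
    -- The value on the arrow images of `Y` and the value on the image of `f` are both prescribed.
    -- An element of the overlap comes from the arrow images of `X` by `hcok`, and there both
    -- prescriptions agree by naturality of `g` and compatibility at the earlier vertices.
    have agree : ∀ (w : Y.arrowImage j) (x : X.branch j), QRep.homAt f j x = w →
        φ w = QRep.homAt g j x := by
      intro w x hxw
      have hx : x ∈ X.arrowImage j := hcok j x (hxw ▸ w.2)
      have h1 := X.arrowImage_hom_ext
        (φ := φ ∘ₗ (QRep.homAt f j).restrict (QRep.arrowImage_le_comap f j))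
        (ψ := QRep.homAt g j ∘ₗ (X.arrowImage j).subtype) (fun i α x => by
          have h2 : (QRep.homAt f j).restrict (QRep.arrowImage_le_comap f j)
            ⟨X.mapArrow α x, X.mapArrow_mem_arrowImage α x⟩ =
            ⟨Y.mapArrow α (QRep.homAt f i x), Y.mapArrow_mem_arrowImage α _⟩ :=
            Subtype.ext (QRep.homAt_mapArrow f α x)
          rw [LinearMap.comp_apply, h2, hφ, hP i α, ← QRep.homAt_mapArrow]
          rfl) ⟨x, hx⟩
      have h3 : (QRep.homAt f j).restrict (QRep.arrowImage_le_comap f j) ⟨x, hx⟩ = w :=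
        Subtype.ext hxw
      rw [LinearMap.comp_apply, h3] at h1
      exact h1
    let e := LinearEquiv.ofInjective (QRep.homAt f j) (hf j)
    -- The two prescriptions are glued as partial linear maps to a map on the sum of the two
    -- submodules, which `ext` then extends to the whole branch.
    let P : Y.branch j →ₗ.[R] J.branch j := ⟨Y.arrowImage j, φ⟩
    let Q : Y.branch j →ₗ.[R] J.branch j :=
      ⟨LinearMap.range (QRep.homAt f j), QRep.homAt g j ∘ₗ e.symm.toLinearMap⟩
    have hPQ : ∀ (x : P.domain) (y : Q.domain), (x : Y.branch j) = y → P x = Q y := by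
      intro x y hxy
      exact agree x (e.symm y) (((congrArg Subtype.val (e.apply_symm_apply y))).trans hxy.symm)
    obtain ⟨ψ, hψ⟩ := ext j (P.sup Q hPQ).toFun
    refine ⟨ψ, fun w => ?_, fun x => ?_⟩
    · have := (P.left_le_sup Q hPQ).2 (x := w)
        (y := ⟨w, (le_sup_left : Y.arrowImage j ≤ _) w.2⟩) rfl
      exact (hψ ⟨w, _⟩).trans this.symm
    · have := (P.right_le_sup Q hPQ).2 (x := e x)
        (y := ⟨QRep.homAt f j x, (le_sup_right : LinearMap.range (QRep.homAt f j) ≤ _) ⟨x, rfl⟩⟩)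
        rfl
      refine (hψ ⟨QRep.homAt f j x, _⟩).trans (this.symm.trans ?_)
      exact congrArg (QRep.homAt g j) (e.symm_apply_apply x))
  exact ⟨h, QRep.hom_ext hh⟩

/-- A morphism of monic representations over a field which is injective modulo the images of the
arrows is a split monomorphism. -/
theorem IsMonic.exists_retraction [Finite V] {X Y : QRep V k} (hX : IsMonic k ρ X)
    (hY : IsMonic k ρ Y) {rk : V → ℕ} (hrk : ∀ ⦃i j : V⦄, (i ⟶ j) → rk i < rk j)
    (f : X ⟶ Y)
    (hcok : ∀ j (x : X.branch j), QRep.homAt f j x ∈ Y.arrowImage j → x ∈ X.arrowImage j) :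
    ∃ r : Y ⟶ X, f ≫ r = 𝟙 X := by
  obtain ⟨h, hh⟩ := hY.exists_hom hX.relations hrk
    (fun j h => ∀ x, x - h (QRep.homAt f j x) ∈ X.arrowImage j) (by
    intro j h _ φ hφ
    have hproj : ∀ M : ModuleCat.{u} k, Module.Projective k M := fun M => inferInstance
    have := hproj (Y.cok j)
    have := hproj (X.cok j)
    obtain ⟨φ', hφ'⟩ := LinearMap.exists_extend φ
    obtain ⟨s, hs⟩ := (Y.cokMk j).exists_rightInverse_of_surjective
      (LinearMap.range_eq_top.2 (Y.cokMk_surjective j))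
    obtain ⟨t, ht⟩ := (X.cokMk j).exists_rightInverse_of_surjective
      (LinearMap.range_eq_top.2 (X.cokMk_surjective j))
    obtain ⟨l, hl⟩ := (QRep.cokMap f j).exists_leftInverse_of_injective (by
      rw [LinearMap.ker_eq_bot']
      intro c hc
      obtain ⟨x, rfl⟩ := X.cokMk_surjective j c
      rw [QRep.cokMap_cokMk, QRep.cokMk_eq_zero] at hc
      exact X.cokMk_eq_zero.2 (hcok j x hc))
    have hs' : ∀ c, Y.cokMk j (s c) = c := LinearMap.congr_fun hs
    have ht' : ∀ c, X.cokMk j (t c) = c := LinearMap.congr_fun ht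
    have hl' : ∀ c, l (QRep.cokMap f j c) = c := LinearMap.congr_fun hl
    have hφ'' : ∀ y (hy : y ∈ Y.arrowImage j), φ' y = φ ⟨y, hy⟩ := fun y hy =>
      LinearMap.congr_fun hφ' ⟨y, hy⟩
    -- On the arrow images this is `φ`; on the complement given by `s` it is replaced by a lift of
    -- `l`. The induced map on `Cok_j` is then `l`, a left inverse of the map induced by `f`.
    refine ⟨φ' - φ' ∘ₗ s ∘ₗ Y.cokMk j + t ∘ₗ l ∘ₗ Y.cokMk j, fun w => ?_, fun x => ?_⟩
    · have h0 : Y.cokMk j w = 0 := Y.cokMk_eq_zero.2 w.2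
      simp only [LinearMap.add_apply, LinearMap.sub_apply, LinearMap.comp_apply, h0, map_zero,
        sub_zero, add_zero]
      exact hφ'' w w.2
    · have h1 : QRep.homAt f j x - s (Y.cokMk j (QRep.homAt f j x)) ∈ Y.arrowImage j := by
        rw [QRep.sub_mem_arrowImage, hs']
      rw [QRep.sub_mem_arrowImage]
      simp only [LinearMap.add_apply, LinearMap.sub_apply, LinearMap.comp_apply]
      rw [← map_sub, hφ'' _ h1, map_add, ht',
        X.cokMk_eq_zero.2 (QRep.map_arrowImage_mem hφ _), zero_add, ← QRep.cokMap_cokMk, hl'])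
  -- The composite `f ≫ h` is only the identity modulo arrow images, but that makes it an
  -- isomorphism, and composing `h` with its inverse gives a retraction.
  have hb := IsMonic.bijective_of_cok (k := k) hX.relations hX (f ≫ h) hrk
    (fun j y => ⟨y, hh j y⟩) (fun j x hx => by
      have := add_mem (hh j x) hx
      rwa [QRep.homAt_comp, sub_add_cancel] at this)
  have := QRep.isIso_of_bijective (f ≫ h) hb
  exact ⟨h ≫ inv (f ≫ h), by rw [← Category.assoc, IsIso.hom_inv_id]⟩

end Extension

/-! ### Subobjects and quotients of monic representations, by restriction to the ground field. -/

section Restriction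

variable {k : Type u} [Field k] {V : Type} [Quiver.{0} V] {A : Type u} [Ring A] [Algebra k A]
  {ρ : ∀ a b : V, Set (Quiver.Path a b)}

/-- The restriction of the scalars of a representation to the ground field. -/
def restrictRep (k : Type u) [Field k] [Algebra k A] (X : QRep V A) : QRep V k :=
  X ⋙ ModuleCat.restrictScalars (algebraMap k A)

/-- The restriction of the scalars of a morphism to the ground field. -/
def restrictHom (k : Type u) [Field k] [Algebra k A] {X Y : QRep V A} (f : X ⟶ Y) :
    restrictRep k X ⟶ restrictRep k Y :=
  Functor.whiskerRight f (ModuleCat.restrictScalars (algebraMap k A))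

variable [∀ j : V, Fintype (Σ i : V, (i ⟶ j))]

theorem IsMonic.restrictRep {X : QRep V A} (hX : IsMonic k ρ X) :
    IsMonic k ρ (restrictRep k X) where
  relations := hX.relations
  direct := hX.direct
  ker_le := hX.ker_le

theorem mem_arrowImage_restrictRep_iff (X : QRep V A) {j : V} (x : X.branch j) :
    (x : (restrictRep k X).branch j) ∈ (restrictRep k X).arrowImage j ↔ x ∈ X.arrowImage j := by
  exact ((restrictRep k X).mem_arrowImage_iff j x).trans (X.mem_arrowImage_iff j x).symm

/-- A subrepresentation of a monic representation which is embedded modulo the images of the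
arrows is monic. -/
theorem IsMonic.of_injective [Finite V] (hQ : IsAcyclicQuiver V) {X Y : QRep V A}
    (hY : IsMonic k ρ Y) (f : X ⟶ Y) (hf : ∀ j, Function.Injective (QRep.homAt f j))
    (hcok : ∀ j (x : X.branch j), QRep.homAt f j x ∈ Y.arrowImage j → x ∈ X.arrowImage j) :
    IsMonic k ρ X := by
  obtain ⟨rk, hrk⟩ := hQ.exists_rank
  have hrel : SatisfiesRelations ρ X := fun a b r hr x => hf b (by
    rw [QRep.homAt_mapPath, hY.relations r hr, map_zero])
  -- Over `k` all partial linear maps extend, so the identity of `X` extends along `f` to a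
  -- retraction `r`. Being natural, `r` carries the subgroup generated along `K_α` in `Y` into that
  -- of `X`, which yields (m2) for `X`.
  obtain ⟨r, hr⟩ := hY.restrictRep.exists_extension (J := SMon.restrictRep k X) hrel hrk
    (restrictHom k f) hf
    (fun j x hx => (mem_arrowImage_restrictRep_iff X x).2
      (hcok j x ((mem_arrowImage_restrictRep_iff Y _).1 hx))) (𝟙 _)
    (fun j ψ => by
      obtain ⟨ψ', hψ'⟩ := LinearMap.exists_extend ψ
      exact ⟨ψ', LinearMap.congr_fun hψ'⟩)
  refine ⟨hrel, fun j x hx a => hf j ?_, fun j i α x hx => ?_⟩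
  · rw [map_zero, QRep.homAt_mapArrow]
    refine hY.direct j (fun a => QRep.homAt f a.1 (x a)) ?_ a
    simp only [← QRep.homAt_mapArrow]
    rw [← map_sum, hx, map_zero]
  · have h1 : QRep.homAt f j x ∈ Y.kerImage k ρ α := hY.ker_le α _ (by
      rw [← QRep.homAt_mapArrow, hx, map_zero])
    have h2 : QRep.homAt r j (QRep.homAt f j x) ∈ (SMon.restrictRep k X).kerImage k ρ α :=
      QRep.homAt_mem_kerImage r h1
    have h3 : QRep.homAt r j (QRep.homAt f j x) = x :=
      LinearMap.congr_fun (congrArg (fun t => QRep.homAt t j) hr) x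
    rw [h3] at h2
    exact h2

/-- The retraction exists over `k` and need not be `A`-linear. Additivity and compatibility with the
arrows suffice for conditions that do not mention scalars. -/
theorem IsMonic.exists_additive_retraction [Finite V] (hQ : IsAcyclicQuiver V) {X Y : QRep V A}
    (hX : IsMonic k ρ X) (hY : IsMonic k ρ Y) (f : X ⟶ Y)
    (hcok : ∀ j (x : X.branch j), QRep.homAt f j x ∈ Y.arrowImage j → x ∈ X.arrowImage j) :
    ∃ r : ∀ j, Y.branch j →+ X.branch j, (∀ j x, r j (QRep.homAt f j x) = x) ∧
      ∀ ⦃i j : V⦄ (α : i ⟶ j) y, r j (Y.mapArrow α y) = X.mapArrow α (r i y) := by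
  obtain ⟨rk, hrk⟩ := hQ.exists_rank
  obtain ⟨r, hr⟩ := hX.restrictRep.exists_retraction hY.restrictRep hrk (restrictHom k f)
    (fun j x hx => (mem_arrowImage_restrictRep_iff X x).2
      (hcok j x ((mem_arrowImage_restrictRep_iff Y _).1 hx)))
  exact ⟨fun j => (QRep.homAt r j).toAddMonoidHom,
    fun j x => LinearMap.congr_fun (congrArg (fun t => QRep.homAt t j) hr) x,
    fun i j α y => QRep.homAt_mapArrow r α y⟩

/-- A morphism of monic representations which is injective modulo the images of the arrows is
injective. -/
theorem IsMonic.injective_of_cok [Finite V] (hQ : IsAcyclicQuiver V) {X Y : QRep V A}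
    (hX : IsMonic k ρ X) (hY : IsMonic k ρ Y) (f : X ⟶ Y)
    (hcok : ∀ j (x : X.branch j), QRep.homAt f j x ∈ Y.arrowImage j → x ∈ X.arrowImage j) (j : V) :
    Function.Injective (QRep.homAt f j) := by
  obtain ⟨r, hr, -⟩ := hX.exists_additive_retraction hQ hY f hcok
  exact Function.LeftInverse.injective (hr j)

/-- The cokernel of a morphism of monic representations which is injective modulo the images of
the arrows is monic. -/
theorem IsMonic.of_exact [Finite V] (hQ : IsAcyclicQuiver V) {X Y Z : QRep V A}
    (hX : IsMonic k ρ X) (hY : IsMonic k ρ Y) (f : X ⟶ Y) (g : Y ⟶ Z)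
    (hcok : ∀ j (x : X.branch j), QRep.homAt f j x ∈ Y.arrowImage j → x ∈ X.arrowImage j)
    (hg : ∀ j, Function.Surjective (QRep.homAt g j))
    (hfg : ∀ j, Function.Exact (QRep.homAt f j) (QRep.homAt g j)) : IsMonic k ρ Z := by
  obtain ⟨r, hr, hrα⟩ := hX.exists_additive_retraction hQ hY f hcok
  -- The complementary projection `id - f r` vanishes on the kernel of `g` and does not change the
  -- image under `g`. It plays the role of an additive section of `g` compatible with the arrows,
  -- through which (m1) and (m2) pass from `Y` to `Z`.
  let s : ∀ j, Y.branch j →+ Y.branch j := fun j =>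
    AddMonoidHom.id _ - (QRep.homAt f j).toAddMonoidHom.comp (r j)
  have hsdef : ∀ j y, s j y = y - QRep.homAt f j (r j y) := fun j y => rfl
  have hs : ∀ j y, QRep.homAt g j (s j y) = QRep.homAt g j y := fun j y => by
    rw [hsdef, map_sub, (hfg j).apply_apply_eq_zero, sub_zero]
  have hs0 : ∀ j y, QRep.homAt g j y = 0 → s j y = 0 := fun j y hy => by
    obtain ⟨x, rfl⟩ := (hfg j y).1 hy
    rw [hsdef, hr, sub_self]
  have hsα : ∀ {i j : V} (α : i ⟶ j) (y : Y.branch i),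
      s j (Y.mapArrow α y) = Y.mapArrow α (s i y) := fun {i j} α y => by
    rw [hsdef, hsdef, map_sub, hrα, QRep.homAt_mapArrow]
  refine ⟨fun a b p hp z => ?_, fun j z hz a => ?_, fun j i α z hz => ?_⟩
  · obtain ⟨y, rfl⟩ := hg a z
    rw [← QRep.homAt_mapPath, hY.relations p hp, map_zero]
  · choose y hy using fun a : (Σ i : V, (i ⟶ j)) => hg a.1 (z a)
    have h1 : ∑ a : (Σ i : V, (i ⟶ j)), Y.mapArrow a.2 (s a.1 (y a)) = 0 := by
      simp only [← hsα]
      rw [← map_sum]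
      apply hs0
      rw [map_sum, ← hz]
      exact Finset.sum_congr rfl fun a _ => by rw [QRep.homAt_mapArrow, hy]
    rw [← hy, ← hs, ← QRep.homAt_mapArrow, hY.direct j _ h1 a, map_zero]
  · obtain ⟨y, rfl⟩ := hg j z
    rw [← hs]
    refine QRep.homAt_mem_kerImage g (hY.ker_le α _ ?_)
    rw [← hsα]
    exact hs0 i _ (by rw [QRep.homAt_mapArrow, hz])

end Restriction

end SMon

namespace SMon

/-! ### Relative projective and injective modules -/

section Modules

variable {A : Type u} [Ring A] {𝒳 : ObjectProperty (ModuleCat.{u} A)}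

theorem isProjectiveIn_module_iff {P : ModuleCat.{u} A} : IsProjectiveIn 𝒳 P ↔ 𝒳 P ∧
    ∀ (X Y Z : ModuleCat.{u} A) (f : X →ₗ[A] Y) (g : Y →ₗ[A] Z), Function.Injective f →
      Function.Surjective g → Function.Exact f g → 𝒳 X → 𝒳 Y → 𝒳 Z → ∀ h : P →ₗ[A] Z,
      ∃ l : P →ₗ[A] Y, ∀ x, g (l x) = h x := by
  constructor
  · intro hP
    refine ⟨hP.mem, fun X Y Z f g hf hg hfg hX hY hZ h => ?_⟩
    obtain ⟨l, hl⟩ := hP.lift (ShortComplex.mk (ModuleCat.ofHom f) (ModuleCat.ofHom g)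
      (ModuleCat.hom_ext hfg.linearMap_comp_eq_zero))
      ((shortExact_module_iff _).2 ⟨hf, hg, hfg⟩) hX hY hZ (ModuleCat.ofHom h)
    exact ⟨l.hom, LinearMap.congr_fun (congrArg ModuleCat.Hom.hom hl)⟩
  · rintro ⟨hP, H⟩
    refine ⟨hP, fun S hS h1 h2 h3 h => ?_⟩
    obtain ⟨hf, hg, hfg⟩ := (shortExact_module_iff S).1 hS
    obtain ⟨l, hl⟩ := H _ _ _ S.f.hom S.g.hom hf hg hfg h1 h2 h3 h.hom
    exact ⟨ModuleCat.ofHom l, ModuleCat.hom_ext (LinearMap.ext hl)⟩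

theorem isInjectiveIn_module_iff {L : ModuleCat.{u} A} : IsInjectiveIn 𝒳 L ↔ 𝒳 L ∧
    ∀ (X Y Z : ModuleCat.{u} A) (f : X →ₗ[A] Y) (g : Y →ₗ[A] Z), Function.Injective f →
      Function.Surjective g → Function.Exact f g → 𝒳 X → 𝒳 Y → 𝒳 Z → ∀ h : X →ₗ[A] L,
      ∃ l : Y →ₗ[A] L, ∀ x, l (f x) = h x := by
  constructor
  · intro hP
    refine ⟨hP.mem, fun X Y Z f g hf hg hfg hX hY hZ h => ?_⟩
    obtain ⟨l, hl⟩ := hP.extend (ShortComplex.mk (ModuleCat.ofHom f) (ModuleCat.ofHom g)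
      (ModuleCat.hom_ext hfg.linearMap_comp_eq_zero))
      ((shortExact_module_iff _).2 ⟨hf, hg, hfg⟩) hX hY hZ (ModuleCat.ofHom h)
    exact ⟨l.hom, LinearMap.congr_fun (congrArg ModuleCat.Hom.hom hl)⟩
  · rintro ⟨hP, H⟩
    refine ⟨hP, fun S hS h1 h2 h3 h => ?_⟩
    obtain ⟨hf, hg, hfg⟩ := (shortExact_module_iff S).1 hS
    obtain ⟨l, hl⟩ := H _ _ _ S.f.hom S.g.hom hf hg hfg h1 h2 h3 h.hom
    exact ⟨ModuleCat.ofHom l, ModuleCat.hom_ext (LinearMap.ext hl)⟩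

theorem IsProjectiveIn.of_retract {P M : ModuleCat.{u} A} (hP : IsProjectiveIn 𝒳 P) (hM : 𝒳 M)
    (i : M →ₗ[A] P) (r : P →ₗ[A] M) (hr : ∀ m, r (i m) = m) : IsProjectiveIn 𝒳 M := by
  rw [isProjectiveIn_module_iff] at hP ⊢
  refine ⟨hM, fun X Y Z f g hf hg hfg hX hY hZ h => ?_⟩
  obtain ⟨l, hl⟩ := hP.2 X Y Z f g hf hg hfg hX hY hZ (h ∘ₗ r)
  exact ⟨l ∘ₗ i, fun x => by rw [LinearMap.comp_apply, hl, LinearMap.comp_apply, hr]⟩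

theorem IsInjectiveIn.of_retract {P M : ModuleCat.{u} A} (hP : IsInjectiveIn 𝒳 P) (hM : 𝒳 M)
    (i : M →ₗ[A] P) (r : P →ₗ[A] M) (hr : ∀ m, r (i m) = m) : IsInjectiveIn 𝒳 M := by
  rw [isInjectiveIn_module_iff] at hP ⊢
  refine ⟨hM, fun X Y Z f g hf hg hfg hX hY hZ h => ?_⟩
  obtain ⟨l, hl⟩ := hP.2 X Y Z f g hf hg hfg hX hY hZ (i ∘ₗ h)
  exact ⟨r ∘ₗ l, fun x => by rw [LinearMap.comp_apply, hl, LinearMap.comp_apply, hr]⟩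

/-! ### Closure properties of `𝒳` and finite products. -/

section Closure

theorem mem_of_linearEquiv [𝒳.IsClosedUnderIsomorphisms] {M N : ModuleCat.{u} A}
    (e : M ≃ₗ[A] N) (hM : 𝒳 M) : 𝒳 N :=
  𝒳.prop_of_iso e.toModuleIso hM

theorem mem_of_subsingleton [𝒳.IsClosedUnderIsomorphisms] [𝒳.ContainsZero] (M : ModuleCat.{u} A)
    [Subsingleton M] : 𝒳 M :=
  𝒳.prop_of_isZero (ModuleCat.isZero_of_subsingleton M)

theorem mem_of_exact [𝒳.IsClosedUnderExtensions] {K M Q : ModuleCat.{u} A}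
    (f : K →ₗ[A] M) (g : M →ₗ[A] Q) (hf : Function.Injective f) (hg : Function.Surjective g)
    (hfg : Function.Exact f g) (hK : 𝒳 K) (hQ : 𝒳 Q) : 𝒳 M :=
  𝒳.prop_X₂_of_shortExact (S := ShortComplex.mk (ModuleCat.ofHom f) (ModuleCat.ofHom g)
      (ModuleCat.hom_ext hfg.linearMap_comp_eq_zero))
    ((shortExact_module_iff _).2 ⟨hf, hg, hfg⟩) hK hQ

theorem mem_of_submodule [𝒳.IsClosedUnderExtensions] {M Q : ModuleCat.{u} A}
    (N : Submodule A M) (g : M →ₗ[A] Q) (hg : Function.Surjective g)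
    (hN : LinearMap.ker g = N) (hK : 𝒳 (ModuleCat.of A N)) (hQ : 𝒳 Q) : 𝒳 M :=
  mem_of_exact (K := ModuleCat.of A N) N.subtype g N.injective_subtype hg
    (by rw [LinearMap.exact_iff, hN, Submodule.range_subtype]) hK hQ

variable [𝒳.IsClosedUnderIsomorphisms] [𝒳.ContainsZero] [𝒳.IsClosedUnderExtensions]

/-- Adding one factor is an extension of that factor by the product of the others, so induction on
the index set needs only zero and closure under extensions. The isomorphism `e` is a parameter so
that the induction covers any model of the product. -/
theorem mem_pi {ι : Type} [Finite ι] (M : ι → ModuleCat.{u} A) (h : ∀ a, 𝒳 (M a))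
    (N : ModuleCat.{u} A) (e : N ≃ₗ[A] (∀ a, M a)) : 𝒳 N := by
  induction ι using Finite.induction_empty_option generalizing N with
  | of_equiv σ ih =>
    exact ih (fun a => M (σ a)) (fun a => h _) N
      (e.trans (LinearEquiv.piCongrLeft A (fun a => M a) σ).symm)
  | h_empty =>
    have := e.toEquiv.subsingleton
    exact mem_of_subsingleton N
  | h_option ih =>
    let c : (∀ a, M (some a)) →ₗ[A] (∀ o, M o) := LinearMap.pi fun o => match o with
      | none => 0
      | some a => LinearMap.proj a
    refine mem_of_exact (K := ModuleCat.of A (∀ a, M (some a))) (Q := M none)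
      (e.symm.toLinearMap ∘ₗ c) (LinearMap.proj none ∘ₗ e.toLinearMap) ?_ ?_ ?_
      (ih (fun a => M (some a)) (fun a => h _) _ (LinearEquiv.refl A _)) (h none)
    · intro x y hxy
      have h1 : c x = c y := e.symm.injective hxy
      funext a
      exact congrFun h1 (some a)
    · intro m
      refine ⟨e.symm fun o => match o with
        | none => m
        | some a => 0, ?_⟩
      change e (e.symm _) none = m
      rw [LinearEquiv.apply_symm_apply]
    · intro n
      constructor
      · intro hn
        refine ⟨fun a => e n (some a), ?_⟩
        change e.symm (c _) = n
        rw [LinearEquiv.symm_apply_eq]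
        funext o
        cases o with
        | none => exact hn.symm
        | some a => rfl
      · rintro ⟨x, rfl⟩
        change e (e.symm (c x)) none = 0
        rw [LinearEquiv.apply_symm_apply]
        rfl

theorem isProjectiveIn_pi {ι : Type} [Finite ι] (M : ι → ModuleCat.{u} A)
    (h : ∀ a, IsProjectiveIn 𝒳 (M a)) (N : ModuleCat.{u} A) (e : N ≃ₗ[A] (∀ a, M a)) :
    IsProjectiveIn 𝒳 N := by
  classical
  have := Fintype.ofFinite ι
  rw [isProjectiveIn_module_iff]
  refine ⟨mem_pi M (fun a => (h a).mem) N e, fun X Y Z f g hf hg hfg hX hY hZ t => ?_⟩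
  choose l hl using fun a => (isProjectiveIn_module_iff.1 (h a)).2 X Y Z f g hf hg hfg hX hY hZ
    (t ∘ₗ e.symm.toLinearMap ∘ₗ LinearMap.single A (fun a => M a) a)
  refine ⟨(∑ a, l a ∘ₗ LinearMap.proj a) ∘ₗ e.toLinearMap, fun x => ?_⟩
  obtain ⟨x, rfl⟩ := e.symm.surjective x
  simp only [LinearMap.comp_apply, LinearEquiv.coe_coe, LinearEquiv.apply_symm_apply,
    LinearMap.sum_apply, map_sum, hl, LinearMap.proj_apply]
  rw [← map_sum, ← map_sum]
  congr 2
  exact Finset.univ_sum_single (M := fun a => M a) x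

theorem isInjectiveIn_pi {ι : Type} [Finite ι] (M : ι → ModuleCat.{u} A)
    (h : ∀ a, IsInjectiveIn 𝒳 (M a)) (N : ModuleCat.{u} A) (e : N ≃ₗ[A] (∀ a, M a)) :
    IsInjectiveIn 𝒳 N := by
  rw [isInjectiveIn_module_iff]
  refine ⟨mem_pi M (fun a => (h a).mem) N e, fun X Y Z f g hf hg hfg hX hY hZ t => ?_⟩
  choose l hl using fun a => (isInjectiveIn_module_iff.1 (h a)).2 X Y Z f g hf hg hfg hX hY hZ
    (LinearMap.proj a ∘ₗ e.toLinearMap ∘ₗ t)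
  refine ⟨e.symm.toLinearMap ∘ₗ LinearMap.pi l, fun x => ?_⟩
  rw [LinearMap.comp_apply, LinearEquiv.coe_coe, LinearEquiv.symm_apply_eq]
  funext a
  exact hl a x

end Closure

end Modules

/-! ### The branches of the separated monic representations -/

section Paths

variable {k : Type u} [Field k] {V : Type} [Quiver.{0} V]

/-- A path to `j` is trivial or a path to a vertex of smaller rank followed by one of finitely many
arrows. -/
theorem finite_paths_to [∀ j : V, Finite (Σ i : V, (i ⟶ j))] {rk : V → ℕ}
    (hrk : ∀ ⦃i j : V⦄, (i ⟶ j) → rk i < rk j) (j : V) : Finite (Σ i : V, Quiver.Path i j) := by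
  suffices H : ∀ n j, rk j = n → Finite (Σ i : V, Quiver.Path i j) from H _ j rfl
  intro n
  induction n using Nat.strong_induction_on with
  | _ n ih =>
  intro j hj
  have : ∀ a : (Σ i : V, (i ⟶ j)), Finite (Σ i : V, Quiver.Path i a.1) := fun a =>
    ih _ (hj ▸ hrk a.2) _ rfl
  let F : Option (Σ a : (Σ i : V, (i ⟶ j)), (Σ i : V, Quiver.Path i a.1)) →
      (Σ i : V, Quiver.Path i j)
    | none => ⟨j, Quiver.Path.nil⟩
    | some ⟨a, p⟩ => ⟨p.1, p.2.cons a.2⟩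
  refine Finite.of_surjective F ?_
  rintro ⟨i, p⟩
  cases p with
  | nil => exact ⟨none, rfl⟩
  | cons p α => exact ⟨some ⟨⟨_, α⟩, ⟨_, p⟩⟩, rfl⟩

end Paths

section Coordinates

variable {k : Type u} [Field k] {V : Type} [Quiver.{0} V] {A : Type u} [Ring A] [Algebra k A]
  {ρ : ∀ a b : V, Set (Quiver.Path a b)}

theorem tensorCoord_mapPath_of_ne {M : ModuleCat.{u} A} {i j l : V} (p : Quiver.Path i j)
    (q : Quiver.Path l j) (h : ∀ r : Quiver.Path i l, p ≠ r.comp q)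
    (t : (tensorRep M (projRep k ρ i)).branch l) :
    tensorCoord ρ M p ((tensorRep M (projRep k ρ i)).mapPath q t) = 0 := by
  refine tensor_induction ρ (P := fun t => tensorCoord ρ M p
    ((tensorRep M (projRep k ρ i)).mapPath q t) = 0) ?_ ?_ ?_ t
  · intro r m _
    rw [mapPath_tensorIncl, tensorCoord_tensorIncl_of_ne ρ M (h r).symm]
  · simp only [map_zero]
  · intro s t hs ht
    rw [map_add, map_add, hs, ht, add_zero]

end Coordinates

/-! ### The filtration of a branch by paths. -/

section Branches

variable {k : Type u} [Field k] {V : Type} [Quiver.{0} V] [Finite V]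
  [∀ j : V, Fintype (Σ i : V, (i ⟶ j))] {A : Type u} [Ring A] [Algebra k A]
  {ρ : ∀ a b : V, Set (Quiver.Path a b)}

/-- Over the field, `Y` is a direct sum of the `Cok_i(Y) ⊗ P(i)`, and `K` is the kernel of the
coordinate along `p` in the summand at `i`. A path `q` reaches this coordinate only if `p` ends with
`q`. -/
theorem IsMonic.exists_coordKer_field (hQ : IsAcyclicQuiver V) (hρ : IsAdmissible k ρ)
    {Y : QRep V k} (hY : IsMonic k ρ Y) {i j : V} (p : Quiver.Path i j) (hp : ¬ MemIdeal k ρ p) :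
    ∃ K : AddSubgroup (Y.branch j), (∀ x, Y.mapPath p x ∈ K → x ∈ Y.arrowImage i) ∧
      ∀ (l : V) (q : Quiver.Path l j), (∀ r : Quiver.Path i l, p ≠ r.comp q) →
        ∀ y, Y.mapPath q y ∈ K := by
  have hproj : ∀ M : ModuleCat.{u} k, Module.Projective k M := fun M => inferInstance
  have hs : ∀ j, ∃ s : Y.cok j →ₗ[k] Y.branch j, ∀ c, Y.cokMk j (s c) = c := fun j => by
    have := hproj (Y.cok j)
    obtain ⟨s, hs⟩ := (Y.cokMk j).exists_rightInverse_of_surjective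
      (LinearMap.range_eq_top.2 (Y.cokMk_surjective j))
    exact ⟨s, LinearMap.congr_fun hs⟩
  choose s hs using hs
  obtain ⟨e⟩ := hY.exists_iso_freeRep ρ hQ hρ s hs
  let T : V → QRep V k := fun i => tensorRep (Y.cok i) (projRep k ρ i)
  let c : Y.branch j →ₗ[k] Y.cok i := tensorCoord ρ (Y.cok i) p ∘ₗ
    QRep.homAt (piProj T i) j ∘ₗ QRep.homAt e.inv j
  have hc : ∀ (l : V) (q : Quiver.Path l j) (y : Y.branch l), c (Y.mapPath q y) =
      tensorCoord ρ (Y.cok i) p ((T i).mapPath q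
        (QRep.homAt (piProj T i) l (QRep.homAt e.inv l y))) := by
    intro l q y
    rw [← QRep.homAt_mapPath, ← QRep.homAt_mapPath]
    rfl
  refine ⟨c.toAddMonoidHom.ker, fun x hx => ?_, fun l q hq y => ?_⟩
  · have h1 : c (Y.mapPath p x) = 0 := hx
    have h2 : ∀ t : (T i).branch i, tensorCoord ρ (Y.cok i) p ((T i).mapPath p t) =
        tensorCoord ρ (Y.cok i) Quiver.Path.nil t := by
      intro t
      conv_lhs => rw [eq_tensorIncl_nil ρ hQ t]
      rw [mapPath_tensorIncl, Quiver.Path.nil_comp, tensorCoord_tensorIncl ρ _ p hp]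
    rw [hc, h2] at h1
    have h3 : QRep.homAt e.inv i x ∈ (freeRep ρ k fun j => Y.cok j).arrowImage i :=
      (mem_arrowImage_freeRep_iff ρ _ hQ _).2 h1
    have h4 := QRep.homAt_mem_arrowImage e.hom h3
    rw [← QRep.homAt_comp, e.inv_hom_id] at h4
    exact h4
  · change c (Y.mapPath q y) = 0
    rw [hc]
    exact tensorCoord_mapPath_of_ne p q hq _

/-- The kernel of the coordinate along a path outside the ideal. -/
theorem IsMonic.exists_coordKer (hQ : IsAcyclicQuiver V) (hρ : IsAdmissible k ρ) {X : QRep V A}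
    (hX : IsMonic k ρ X) {i j : V} (p : Quiver.Path i j) (hp : ¬ MemIdeal k ρ p) :
    ∃ K : AddSubgroup (X.branch j), (∀ x, X.mapPath p x ∈ K → x ∈ X.arrowImage i) ∧
      ∀ (l : V) (q : Quiver.Path l j), (∀ r : Quiver.Path i l, p ≠ r.comp q) →
        ∀ y, X.mapPath q y ∈ K := by
  obtain ⟨K, h1, h2⟩ := hX.restrictRep.exists_coordKer_field hQ hρ p hp
  exact ⟨K, fun x hx => (mem_arrowImage_restrictRep_iff X x).1 (h1 x hx), h2⟩

variable {𝒳 : ObjectProperty (ModuleCat.{u} A)} [𝒳.IsClosedUnderIsomorphisms] [𝒳.ContainsZero]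
  [𝒳.IsClosedUnderExtensions]

/-- The sum of the images along a set of paths which is closed under precomposition belongs to
`𝒳` if the quotients by the images of the arrows do. -/
theorem IsMonic.iSup_range_mem (hQ : IsAcyclicQuiver V) (hρ : IsAdmissible k ρ) {X : QRep V A}
    (hX : IsMonic k ρ X) (hcok : ∀ i, 𝒳 (X.cok i)) {j : V}
    (S : Finset (Σ i : V, Quiver.Path i j)) (hS : ∀ p ∈ S, ¬ MemIdeal k ρ p.2)
    (hclosed : ∀ p ∈ S, ∀ (l : V) (r : Quiver.Path l p.1), ¬ MemIdeal k ρ (r.comp p.2) →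
      (⟨l, r.comp p.2⟩ : Σ i : V, Quiver.Path i j) ∈ S) :
    𝒳 (ModuleCat.of A ↥(⨆ p ∈ S, LinearMap.range (X.mapPath p.2))) := by
  classical
  induction S using Finset.strongInduction with
  | H S ih =>
  by_cases hne : S.Nonempty
  swap
  · rw [Finset.not_nonempty_iff_eq_empty] at hne
    subst hne
    have : Subsingleton ↥(⨆ p ∈ (∅ : Finset (Σ i : V, Quiver.Path i j)),
        LinearMap.range (X.mapPath p.2)) := by
      simp only [Finset.notMem_empty, iSup_false, iSup_bot]
      infer_instance
    exact mem_of_subsingleton _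
  -- Removing a shortest path keeps `S` closed under precomposition: no other member of `S` can be a
  -- final segment of `p`.
  obtain ⟨⟨i, p⟩, hpS, hmin⟩ := S.exists_min_image (fun p => p.2.length) hne
  have hne' : ∀ q ∈ S.erase ⟨i, p⟩, ∀ r : Quiver.Path i q.1, p ≠ r.comp q.2 := by
    rintro ⟨l, q⟩ hq r h
    have h1 := hmin _ (Finset.mem_of_mem_erase hq)
    have h2 : r.length = 0 := by
      have h3 := congrArg Quiver.Path.length h
      rw [Quiver.Path.length_comp] at h3
      dsimp only at h1 h3
      omega
    obtain rfl := Quiver.Path.eq_of_length_zero r h2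
    obtain rfl := Quiver.Path.eq_nil_of_length_zero r h2
    dsimp only at h
    rw [Quiver.Path.nil_comp] at h
    subst h
    exact Finset.notMem_erase _ _ hq
  let N := ⨆ q ∈ S.erase ⟨i, p⟩, LinearMap.range (X.mapPath q.2)
  let L := ⨆ p ∈ S, LinearMap.range (X.mapPath p.2)
  have hN : 𝒳 (ModuleCat.of A N) := by
    refine ih _ (Finset.erase_ssubset hpS) (fun q hq => hS q (Finset.mem_of_mem_erase hq)) ?_
    intro q hq l r hr
    refine Finset.mem_erase.2 ⟨fun h => ?_, hclosed q (Finset.mem_of_mem_erase hq) l r hr⟩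
    obtain rfl : l = i := congrArg Sigma.fst h
    exact hne' q hq r (eq_of_heq (Sigma.mk.inj h).2).symm
  have hNL : N ≤ L := by
    refine iSup₂_le fun q hq => ?_
    exact le_iSup₂_of_le (f := fun q (_ : q ∈ S) => LinearMap.range (X.mapPath q.2)) q
      (Finset.mem_of_mem_erase hq) le_rfl
  have hpL : ∀ x, X.mapPath p x ∈ L := fun x =>
    le_iSup₂_of_le (f := fun q (_ : q ∈ S) => LinearMap.range (X.mapPath q.2)) ⟨i, p⟩ hpS le_rfl
      ⟨x, rfl⟩
  have hL : ∀ y ∈ L, ∃ x, y - X.mapPath p x ∈ N := by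
    have : L ≤ LinearMap.range (X.mapPath p) ⊔ N := by
      refine iSup₂_le fun q hq => ?_
      by_cases h : q = ⟨i, p⟩
      · subst h
        exact le_sup_left
      · exact le_sup_of_le_right (le_iSup₂_of_le
          (f := fun q (_ : q ∈ S.erase ⟨i, p⟩) => LinearMap.range (X.mapPath q.2)) q
          (Finset.mem_erase.2 ⟨h, hq⟩) le_rfl)
    intro y hy
    obtain ⟨_, ⟨x, rfl⟩, z, hz, rfl⟩ := Submodule.mem_sup.1 (this hy)
    exact ⟨x, by rwa [add_sub_cancel_left]⟩
  -- The subgroup `K` contains the images along all other paths in `S`, so `X_p(x) ∈ N` forces `x`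
  -- into the arrow images at `i`.
  obtain ⟨K, hK1, hK2⟩ := hX.exists_coordKer hQ hρ p (hS _ hpS)
  have hNK : ∀ x ∈ N, x ∈ K := by
    intro x hx
    have hx' : x ∈ ⨆ q : S.erase ⟨i, p⟩, LinearMap.range (X.mapPath q.1.2) := by
      rw [iSup_subtype (f := fun q : S.erase ⟨i, p⟩ => LinearMap.range (X.mapPath q.1.2))]
      exact hx
    refine Submodule.iSup_induction
      (fun q : S.erase ⟨i, p⟩ => LinearMap.range (X.mapPath q.1.2)) (motive := fun x => x ∈ K)
      hx' ?_ (zero_mem _) fun _ _ => add_mem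
    rintro ⟨q, hq⟩ _ ⟨y, rfl⟩
    exact hK2 q.1 q.2 (hne' q hq) y
  let N' : Submodule A L := N.comap L.subtype
  let v : X.branch i →ₗ[A] L ⧸ N' := N'.mkQ ∘ₗ (X.mapPath p).codRestrict L hpL
  have hv : ∀ x, v x = 0 ↔ X.mapPath p x ∈ N := fun x => Submodule.Quotient.mk_eq_zero _
  have hvs : Function.Surjective v := by
    intro y
    obtain ⟨⟨y, hy⟩, rfl⟩ := N'.mkQ_surjective y
    obtain ⟨x, hx⟩ := hL y hy
    refine ⟨x, ((Submodule.Quotient.eq N').2 ?_).symm⟩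
    exact hx
  -- Hence the layer `L / N` is a copy of `Cok_i(X)`. For the reverse inclusion, an arrow followed
  -- by `p` either lies in `I` or is a longer path in `S`, so its image is in `N`.
  have hvk : LinearMap.ker v = X.arrowImage i := by
    ext x
    rw [LinearMap.mem_ker, hv]
    refine ⟨fun h => hK1 x (hNK _ h), fun h => ?_⟩
    refine X.arrowImage_induction (P := fun x => X.mapPath p x ∈ N) ?_ ?_ ?_ h
    · intro l α y
      have h1 : X.mapPath p (X.mapArrow α y) = X.mapPath (α.toPath.comp p) y :=
        (X.mapPath_comp α.toPath p y).symm
      rw [h1]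
      by_cases h2 : MemIdeal k ρ (α.toPath.comp p)
      · rw [hX.relations.mapPath_eq_zero h2]
        exact zero_mem _
      · refine le_iSup₂_of_le (f := fun q (_ : q ∈ S.erase ⟨i, p⟩) =>
          LinearMap.range (X.mapPath q.2)) ⟨l, α.toPath.comp p⟩
          (Finset.mem_erase.2 ⟨fun h3 => ?_, hclosed _ hpS l α.toPath h2⟩) le_rfl ⟨y, rfl⟩
        have h4 := congrArg (fun q : (Σ i : V, Quiver.Path i j) => q.2.length) h3
        simp [Quiver.Path.length_comp] at h4
    · rw [map_zero]
      exact zero_mem _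
    · intro x y hx hy
      rw [map_add]
      exact add_mem hx hy
  have hQ' : 𝒳 (ModuleCat.of A (L ⧸ N')) :=
    mem_of_linearEquiv (M := X.cok i) (N := ModuleCat.of A (L ⧸ N'))
      ((Submodule.quotEquivOfEq _ _ hvk.symm).trans (v.quotKerEquivOfSurjective hvs)) (hcok i)
  refine mem_of_exact (K := ModuleCat.of A N) (M := ModuleCat.of A L)
    (Q := ModuleCat.of A (L ⧸ N')) (Submodule.inclusion hNL) N'.mkQ
    (Submodule.inclusion_injective hNL) N'.mkQ_surjective ?_ hN hQ'
  rw [LinearMap.exact_iff, Submodule.ker_mkQ, Submodule.range_inclusion]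

/-- All nontrivial paths to `j` outside `I` form a set closed under precomposition by paths not
leading into `I`, and their images span the arrow images, because arrows themselves are outside `I`.
The branch is then an extension of `Cok_j(X)` by this sum. -/
theorem IsMonic.branch_mem (hQ : IsAcyclicQuiver V) (hρ : IsAdmissible k ρ) {X : QRep V A}
    (hX : IsMonic k ρ X) (hcok : ∀ i, 𝒳 (X.cok i)) (j : V) :
    𝒳 (X.branch j) ∧ 𝒳 (ModuleCat.of A (X.arrowImage j)) := by
  classical
  obtain ⟨rk, hrk⟩ := hQ.exists_rank
  have := finite_paths_to hrk j
  have := Fintype.ofFinite (Σ i : V, Quiver.Path i j)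
  let S := Finset.univ.filter fun p : (Σ i : V, Quiver.Path i j) =>
    ¬ MemIdeal k ρ p.2 ∧ 0 < p.2.length
  have hS : ∀ p, p ∈ S ↔ ¬ MemIdeal k ρ p.2 ∧ 0 < p.2.length := fun p => by simp [S]
  have h1 := hX.iSup_range_mem hQ hρ hcok S (fun p hp => ((hS p).1 hp).1) (fun p hp l r hr => by
    rw [hS] at hp ⊢
    exact ⟨hr, by rw [Quiver.Path.length_comp]; omega⟩)
  have h2 : (⨆ p ∈ S, LinearMap.range (X.mapPath p.2)) = X.arrowImage j := by
    apply le_antisymm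
    · refine iSup₂_le ?_
      rintro ⟨i, p⟩ hp _ ⟨x, rfl⟩
      rw [hS] at hp
      cases p with
      | nil => exact absurd hp.2 (lt_irrefl _)
      | cons p α =>
        dsimp only
        rw [QRep.mapPath_cons]
        exact X.mapArrow_mem_arrowImage α _
    · refine iSup_le ?_
      rintro ⟨i, α⟩
      have hα : (⟨i, α.toPath⟩ : Σ i : V, Quiver.Path i j) ∈ S := by
        rw [hS]
        refine ⟨fun h => ?_, by simp⟩
        have := hρ.two_le_length h
        simp at this
      exact le_iSup₂_of_le (f := fun q (_ : q ∈ S) => LinearMap.range (X.mapPath q.2)) _ hα le_rfl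
  rw [h2] at h1
  exact ⟨mem_of_submodule (X.arrowImage j) (X.cokMk j) (X.cokMk_surjective j)
    (Submodule.ker_mkQ _) h1 (hcok j), h1⟩

end Branches

end SMon

namespace SMon

/-! ### Relative projective and injective representations -/

section Representations

variable {V : Type} [Quiver.{0} V] {R : Type u} [Ring R] {P : ObjectProperty (QRep V R)}

theorem IsProjectiveIn.exists_lift {L X Y Z : QRep V R} (hL : IsProjectiveIn P L) (f : X ⟶ Y)
    (g : Y ⟶ Z) (hf : ∀ j, Function.Injective (QRep.homAt f j))
    (hg : ∀ j, Function.Surjective (QRep.homAt g j))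
    (hfg : ∀ j, Function.Exact (QRep.homAt f j) (QRep.homAt g j)) (hX : P X) (hY : P Y) (hZ : P Z)
    (h : L ⟶ Z) : ∃ l : L ⟶ Y, l ≫ g = h := by
  have w : f ≫ g = 0 := QRep.hom_ext fun j x => (hfg j).apply_apply_eq_zero x
  exact hL.lift (ShortComplex.mk f g w)
    ((shortExact_iff _).2 fun j => ⟨hf j, hg j, hfg j⟩) hX hY hZ h

theorem IsInjectiveIn.exists_extension {L X Y Z : QRep V R} (hL : IsInjectiveIn P L) (f : X ⟶ Y)
    (g : Y ⟶ Z) (hf : ∀ j, Function.Injective (QRep.homAt f j))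
    (hg : ∀ j, Function.Surjective (QRep.homAt g j))
    (hfg : ∀ j, Function.Exact (QRep.homAt f j) (QRep.homAt g j)) (hX : P X) (hY : P Y) (hZ : P Z)
    (h : X ⟶ L) : ∃ l : Y ⟶ L, f ≫ l = h := by
  have w : f ≫ g = 0 := QRep.hom_ext fun j x => (hfg j).apply_apply_eq_zero x
  exact hL.extend (ShortComplex.mk f g w)
    ((shortExact_iff _).2 fun j => ⟨hf j, hg j, hfg j⟩) hX hY hZ h

theorem QRep.exists_arrowProj (X : QRep V R) {j : V} (σ : X.cok j →ₗ[R] X.branch j)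
    (hσ : ∀ c, X.cokMk j (σ c) = c) :
    ∃ π : X.branch j →ₗ[R] X.arrowImage j, ∀ x, (π x : X.branch j) = x - σ (X.cokMk j x) :=
  ⟨(LinearMap.id - σ ∘ₗ X.cokMk j).codRestrict _ fun x => by
    change x - σ (X.cokMk j x) ∈ _
    rw [X.sub_mem_arrowImage, hσ], fun _ => rfl⟩

theorem QRep.exact_arrowImage (X : QRep V R) (j : V) :
    Function.Exact (X.arrowImage j).subtype (X.cokMk j) := by
  rw [LinearMap.exact_iff, Submodule.range_subtype]
  exact Submodule.ker_mkQ _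

theorem QRep.exists_arrowImage_lift {X Y : QRep V R} (f : X ⟶ Y)
    (hf : ∀ j, Function.Surjective (QRep.homAt f j)) {j : V} {y : Y.branch j}
    (hy : y ∈ Y.arrowImage j) : ∃ x ∈ X.arrowImage j, QRep.homAt f j x = y := by
  refine Y.arrowImage_induction (P := fun y => ∃ x ∈ X.arrowImage j, QRep.homAt f j x = y)
    ?_ ⟨0, zero_mem _, map_zero _⟩ ?_ hy
  · intro i α y
    obtain ⟨x, rfl⟩ := hf i y
    exact ⟨X.mapArrow α x, X.mapArrow_mem_arrowImage α x, QRep.homAt_mapArrow f α x⟩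
  · rintro _ _ ⟨x, hx, rfl⟩ ⟨y, hy, rfl⟩
    exact ⟨x + y, add_mem hx hy, map_add _ _ _⟩

end Representations

/-! ### The quotients `Cok_j` of the `M ⊗ P(i)` and of their direct sums. -/

section Tops

variable {k : Type u} [Field k] {V : Type} [Quiver.{0} V] {A : Type u} [Ring A] [Algebra k A]
  {ρ : ∀ a b : V, Set (Quiver.Path a b)}

theorem tensorIncl_nil_bijective (hQ : IsAcyclicQuiver V) (hρ : IsAdmissible k ρ)
    (M : ModuleCat.{u} A) (i : V) :
    Function.Bijective (tensorIncl (k := k) ρ M (Quiver.Path.nil : Quiver.Path i i)) :=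
  ⟨Function.LeftInverse.injective
    (tensorCoord_tensorIncl ρ M _ (hρ.not_memIdeal_nil ρ i)),
    fun t => ⟨_, (eq_tensorIncl_nil ρ hQ t).symm⟩⟩

/-- The module `M` is isomorphic to the branch of `M ⊗ P(i)` at `i`. -/
def tensorBranchEquiv (hQ : IsAcyclicQuiver V) (hρ : IsAdmissible k ρ)
    (M : ModuleCat.{u} A) (i : V) : M ≃ₗ[A] (tensorRep M (projRep k ρ i)).branch i :=
  LinearEquiv.ofBijective _ (tensorIncl_nil_bijective hQ hρ M i)

theorem cokMk_tensorIncl_nil_bijective (hQ : IsAcyclicQuiver V) (hρ : IsAdmissible k ρ)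
    (M : ModuleCat.{u} A) (i : V) :
    Function.Bijective ((tensorRep M (projRep k ρ i)).cokMk i ∘ₗ
      tensorIncl (k := k) ρ M (Quiver.Path.nil : Quiver.Path i i)) := by
  constructor
  · rw [injective_iff_map_eq_zero]
    intro m hm
    rw [LinearMap.comp_apply, QRep.cokMk_eq_zero] at hm
    rw [← tensorCoord_tensorIncl ρ M _ (hρ.not_memIdeal_nil ρ i) m]
    exact tensorCoord_nil_of_mem ρ hm
  · exact (QRep.cokMk_surjective _ i).comp (tensorIncl_nil_bijective hQ hρ M i).2

theorem subsingleton_cok_tensorRep {M : ModuleCat.{u} A} {i j : V} (h : i ≠ j) :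
    Subsingleton ((tensorRep M (projRep k ρ i)).cok j) := by
  refine subsingleton_of_forall_eq 0 fun c => ?_
  obtain ⟨t, rfl⟩ := QRep.cokMk_surjective _ j c
  exact (QRep.cokMk_eq_zero _).2 (arrowImage_tensor_eq_top ρ h t)

/-- The module `M` is isomorphic to the quotient of the branch of `M ⊗ P(i)` at `i` by the
images of the arrows. -/
def tensorCokEquiv (hQ : IsAcyclicQuiver V) (hρ : IsAdmissible k ρ)
    (M : ModuleCat.{u} A) (i : V) : M ≃ₗ[A] (tensorRep M (projRep k ρ i)).cok i :=
  LinearEquiv.ofBijective _ (cokMk_tensorIncl_nil_bijective hQ hρ M i)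

variable [∀ j : V, Fintype (Σ i : V, (i ⟶ j))]

/-- The quotient of a branch of `freeRep` by the images of the arrows. -/
def freeCokEquiv (hQ : IsAcyclicQuiver V) (hρ : IsAdmissible k ρ) (M : V → ModuleCat.{u} A)
    (j : V) : (freeRep ρ k M).cok j ≃ₗ[A] M j :=
  LinearEquiv.ofBijective ((freeRep ρ k M).cokDesc (freeTop ρ M k j)
    fun x hx => (mem_arrowImage_freeRep_iff ρ M hQ x).1 hx) (by
    constructor
    · rw [injective_iff_map_eq_zero]
      intro c hc
      obtain ⟨x, rfl⟩ := QRep.cokMk_surjective _ j c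
      rw [QRep.cokDesc_cokMk] at hc
      rwa [QRep.cokMk_eq_zero, mem_arrowImage_freeRep_iff ρ M hQ]
    · intro m
      exact ⟨(freeRep ρ k M).cokMk j (freeGen ρ M k j m), by
        rw [QRep.cokDesc_cokMk, freeTop_freeGen ρ M hρ]⟩)

end Tops

section Objects

variable {k : Type u} [Field k] {V : Type} [Quiver.{0} V] [Finite V]
  [∀ j : V, Fintype (Σ i : V, (i ⟶ j))] {A : Type u} [Ring A] [Algebra k A]
  {ρ : ∀ a b : V, Set (Quiver.Path a b)}
  {𝒳 : ObjectProperty (ModuleCat.{u} A)} [𝒳.IsClosedUnderIsomorphisms] [𝒳.ContainsZero]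
  [𝒳.IsClosedUnderExtensions]

/-- Finite generation of the branches is automatic, since they lie in `𝒳`. -/
theorem smon_iff (hQ : IsAcyclicQuiver V) (hρ : IsAdmissible k ρ)
    (h𝒳 : ∀ M : ModuleCat.{u} A, 𝒳 M → Module.Finite A M) (X : QRep V A) :
    smon k ρ 𝒳 X ↔ IsMonic k ρ X ∧ ∀ i, 𝒳 (X.cok i) := by
  rw [isSeparatedMonic_iff]
  exact ⟨fun h => ⟨h.1, h.2.2⟩, fun h => ⟨h.1, fun i =>
    h𝒳 _ (h.1.branch_mem hQ hρ h.2 i).1, h.2⟩⟩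

theorem smon_tensorRep (hQ : IsAcyclicQuiver V) (hρ : IsAdmissible k ρ)
    (h𝒳 : ∀ M : ModuleCat.{u} A, 𝒳 M → Module.Finite A M) {M : ModuleCat.{u} A} (hM : 𝒳 M)
    (i : V) : smon k ρ 𝒳 (tensorRep M (projRep k ρ i)) := by
  rw [smon_iff hQ hρ h𝒳]
  refine ⟨isMonic_tensorRep ρ M hρ i, fun j => ?_⟩
  by_cases h : i = j
  · subst h
    exact mem_of_linearEquiv (tensorCokEquiv hQ hρ M i) hM
  · have := subsingleton_cok_tensorRep (k := k) (ρ := ρ) (M := M) h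
    exact mem_of_subsingleton _

theorem smon_freeRep (hQ : IsAcyclicQuiver V) (hρ : IsAdmissible k ρ)
    (h𝒳 : ∀ M : ModuleCat.{u} A, 𝒳 M → Module.Finite A M) {M : V → ModuleCat.{u} A}
    (hM : ∀ i, 𝒳 (M i)) : smon k ρ 𝒳 (freeRep ρ k M) := by
  rw [smon_iff hQ hρ h𝒳]
  exact ⟨isMonic_freeRep ρ M hρ, fun j =>
    mem_of_linearEquiv (freeCokEquiv hQ hρ M j).symm (hM j)⟩

/-- The branches of `M ⊗ P(i)` are finite powers of `M`. -/
theorem exists_tensorPowEquiv (hQ : IsAcyclicQuiver V) (ρ : ∀ a b : V, Set (Quiver.Path a b))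
    (M : ModuleCat.{u} A) (i j : V) :
    ∃ (ι : Type) (_ : Finite ι), Nonempty
      ((tensorRep M (projRep k ρ i)).branch j ≃ₗ[A] (ι → M)) := by
  obtain ⟨rk, hrk⟩ := hQ.exists_rank
  have := finite_paths_to hrk j
  have h : Finite {p : Quiver.Path i j // ¬ MemIdeal k ρ p} :=
    Finite.of_injective (fun p => (⟨i, p.1⟩ : Σ i : V, Quiver.Path i j)) fun p q hpq =>
      Subtype.ext (eq_of_heq (Sigma.mk.inj hpq).2)
  exact ⟨_, h, ⟨(tensorEquiv ρ M i j).trans (Finsupp.linearEquivFunOnFinite A M _)⟩⟩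

theorem isProjectiveIn_branch_tensorRep (hQ : IsAcyclicQuiver V) {M : ModuleCat.{u} A}
    (hM : IsProjectiveIn 𝒳 M) (i j : V) :
    IsProjectiveIn 𝒳 ((tensorRep M (projRep k ρ i)).branch j) := by
  obtain ⟨ι, _, ⟨e⟩⟩ := exists_tensorPowEquiv (k := k) hQ ρ M i j
  exact isProjectiveIn_pi (fun _ => M) (fun _ => hM) _ e

theorem isInjectiveIn_branch_tensorRep (hQ : IsAcyclicQuiver V) {M : ModuleCat.{u} A}
    (hM : IsInjectiveIn 𝒳 M) (i j : V) :
    IsInjectiveIn 𝒳 ((tensorRep M (projRep k ρ i)).branch j) := by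
  obtain ⟨ι, _, ⟨e⟩⟩ := exists_tensorPowEquiv (k := k) hQ ρ M i j
  exact isInjectiveIn_pi (fun _ => M) (fun _ => hM) _ e

theorem isProjectiveIn_branch_freeRep (hQ : IsAcyclicQuiver V) {M : V → ModuleCat.{u} A}
    (hM : ∀ i, IsProjectiveIn 𝒳 (M i)) (j : V) :
    IsProjectiveIn 𝒳 ((freeRep ρ k M).branch j) :=
  isProjectiveIn_pi _ (fun i => isProjectiveIn_branch_tensorRep hQ (hM i) i j) _
    (LinearEquiv.refl A _)

theorem isInjectiveIn_branch_freeRep (hQ : IsAcyclicQuiver V) {M : V → ModuleCat.{u} A}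
    (hM : ∀ i, IsInjectiveIn 𝒳 (M i)) (j : V) :
    IsInjectiveIn 𝒳 ((freeRep ρ k M).branch j) :=
  isInjectiveIn_pi _ (fun i => isInjectiveIn_branch_tensorRep hQ (hM i) i j) _
    (LinearEquiv.refl A _)

/-- A separated monic representation is relatively projective if its quotients by the images of
the arrows are. -/
theorem isProjectiveIn_smon (hQ : IsAcyclicQuiver V) (hρ : IsAdmissible k ρ)
    (h𝒳 : ∀ M : ModuleCat.{u} A, 𝒳 M → Module.Finite A M) {L : QRep V A}
    (hL : smon k ρ 𝒳 L) (hcok : ∀ j, IsProjectiveIn 𝒳 (L.cok j)) :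
    IsProjectiveIn (smon k ρ 𝒳) L := by
  refine ⟨hL, fun S hS h1 h2 h3 q => ?_⟩
  obtain ⟨rk, hrk⟩ := hQ.exists_rank
  rw [smon_iff hQ hρ h𝒳] at hL h1 h2 h3
  rw [shortExact_iff] at hS
  have mem : ∀ {X : QRep V A}, (IsMonic k ρ X ∧ ∀ i, 𝒳 (X.cok i)) → ∀ j, 𝒳 (X.branch j) :=
    fun h j => (h.1.branch_mem hQ hρ h.2 j).1
  obtain ⟨h, hh⟩ := hL.1.exists_hom h2.1.relations hrk
    (fun j h => ∀ x, QRep.homAt S.g j (h x) = QRep.homAt q j x) (by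
    intro j h hP φ hφ
    -- The sequence of the arrow images, the branch and `Cok_j(L)` lies in `𝒳`, so projectivity of
    -- `Cok_j(L)` splits it. On the complement of the arrow images the map is then chosen as a lift
    -- `τ` of `q ∘ σ`.
    obtain ⟨σ, hσ⟩ := (isProjectiveIn_module_iff.1 (hcok j)).2
      (ModuleCat.of A (L.arrowImage j)) (L.branch j) (L.cok j) (L.arrowImage j).subtype
      (L.cokMk j) (Submodule.injective_subtype _) (L.cokMk_surjective j) (L.exact_arrowImage j)
      (hL.1.branch_mem hQ hρ hL.2 j).2 (mem hL j) (hL.2 j) LinearMap.id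
    obtain ⟨τ, hτ⟩ := (isProjectiveIn_module_iff.1 (hcok j)).2 _ _ _ _ _ (hS j).1 (hS j).2.1
      (hS j).2.2 (mem h1 j) (mem h2 j) (mem h3 j) (QRep.homAt q j ∘ₗ σ)
    obtain ⟨π, hπ⟩ := L.exists_arrowProj σ hσ
    have hgφ : ∀ w : L.arrowImage j, QRep.homAt S.g j (φ w) = QRep.homAt q j w := fun w =>
      L.arrowImage_hom_ext (φ := QRep.homAt S.g j ∘ₗ φ)
        (ψ := QRep.homAt q j ∘ₗ (L.arrowImage j).subtype) (fun i α x => by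
          rw [LinearMap.comp_apply, hφ, QRep.homAt_mapArrow, hP i α, ← QRep.homAt_mapArrow]
          rfl) w
    refine ⟨φ ∘ₗ π + τ ∘ₗ L.cokMk j, fun w => ?_, fun x => ?_⟩
    · have h0 : L.cokMk j w = 0 := L.cokMk_eq_zero.2 w.2
      have h4 : π w = w := Subtype.ext (by rw [hπ, h0, map_zero, sub_zero])
      rw [LinearMap.add_apply, LinearMap.comp_apply, LinearMap.comp_apply, h0, h4, map_zero,
        add_zero]
    · rw [LinearMap.add_apply, LinearMap.comp_apply, LinearMap.comp_apply, map_add, hgφ, hτ, hπ,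
        LinearMap.comp_apply, map_sub, sub_add_cancel])
  exact ⟨h, QRep.hom_ext hh⟩

/-- A separated monic representation is relatively injective if its branches are. -/
theorem isInjectiveIn_smon (hQ : IsAcyclicQuiver V) (hρ : IsAdmissible k ρ)
    (h𝒳 : ∀ M : ModuleCat.{u} A, 𝒳 M → Module.Finite A M) {J : QRep V A}
    (hJ : smon k ρ 𝒳 J) (hbr : ∀ j, IsInjectiveIn 𝒳 (J.branch j)) :
    IsInjectiveIn (smon k ρ 𝒳) J := by
  refine ⟨hJ, fun S hS h1 h2 h3 q => ?_⟩
  obtain ⟨rk, hrk⟩ := hQ.exists_rank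
  rw [smon_iff hQ hρ h𝒳] at hJ h1 h2 h3
  rw [shortExact_iff] at hS
  refine h2.1.exists_extension hJ.1.relations hrk S.f (fun j => (hS j).1)
    (fun j x hx => IsMonic.mem_arrowImage_of_exact h2.1.relations h3.1 S.f S.g
      (fun j => (hS j).1) (fun j => (hS j).2.1) (fun j => (hS j).2.2) hx) q (fun j ψ => ?_)
  -- This is the preimage under `g` of the arrow images of the third term. It is therefore an
  -- extension of those by the branch of the first term, and the quotient by it is `Cok_j` of the
  -- third term, so `ψ` extends along a sequence in `𝒳`.
  let W := S.X₂.arrowImage j ⊔ LinearMap.range (QRep.homAt S.f j)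
  let f := QRep.homAt S.f j
  let g := QRep.homAt S.g j
  have hgf : ∀ x, g (f x) = 0 := (hS j).2.2.apply_apply_eq_zero
  have hgW : ∀ w : S.X₂.branch j, w ∈ W ↔ g w ∈ S.X₃.arrowImage j := by
    intro w
    constructor
    · intro hw
      obtain ⟨a, ha, _, ⟨x, rfl⟩, rfl⟩ := Submodule.mem_sup.1 hw
      rw [map_add, hgf, add_zero]
      exact QRep.homAt_mem_arrowImage S.g ha
    · intro hw
      obtain ⟨a, ha, hga⟩ := QRep.exists_arrowImage_lift S.g (fun j => (hS j).2.1) hw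
      obtain ⟨x, hx⟩ := ((hS j).2.2 (w - a)).1 (by rw [map_sub, hga, sub_self])
      exact Submodule.mem_sup.2 ⟨a, ha, _, ⟨x, rfl⟩, by rw [hx, add_sub_cancel]⟩
  have hW : 𝒳 (ModuleCat.of A W) := by
    refine mem_of_exact (K := S.X₁.branch j) (M := ModuleCat.of A W)
      (Q := ModuleCat.of A (S.X₃.arrowImage j))
      (f.codRestrict W fun x => (le_sup_right : LinearMap.range f ≤ W) ⟨x, rfl⟩)
      (g.restrict fun w hw => (hgW w).1 hw) ?_ ?_ ?_ (h1.1.branch_mem hQ hρ h1.2 j).1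
      (h3.1.branch_mem hQ hρ h3.2 j).2
    · intro x y hxy
      exact (hS j).1 (congrArg Subtype.val hxy)
    · rintro ⟨z, hz⟩
      obtain ⟨a, ha, rfl⟩ := QRep.exists_arrowImage_lift S.g (fun j => (hS j).2.1) hz
      exact ⟨⟨a, (le_sup_left : S.X₂.arrowImage j ≤ W) ha⟩, rfl⟩
    · rintro ⟨w, hw⟩
      constructor
      · intro h
        obtain ⟨x, hx⟩ := ((hS j).2.2 w).1 (congrArg Subtype.val h)
        exact ⟨x, Subtype.ext hx⟩
      · rintro ⟨x, hx⟩
        apply Subtype.ext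
        have := congrArg Subtype.val hx
        change g w = 0
        exact (congrArg g this).symm.trans (hgf x)
  obtain ⟨ψ', hψ'⟩ := (isInjectiveIn_module_iff.1 (hbr j)).2 (ModuleCat.of A W) (S.X₂.branch j)
    (S.X₃.cok j) W.subtype (S.X₃.cokMk j ∘ₗ g) W.injective_subtype
    ((S.X₃.cokMk_surjective j).comp (hS j).2.1) (by
      rw [LinearMap.exact_iff, Submodule.range_subtype]
      ext w
      rw [LinearMap.mem_ker, LinearMap.comp_apply, QRep.cokMk_eq_zero, hgW]) hW
    (h2.1.branch_mem hQ hρ h2.2 j).1 (h3.2 j) ψ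
  exact ⟨ψ', hψ'⟩

end Objects

end SMon

namespace SMon

/-! ### Enough relative projective and injective objects -/

section Comparison

variable {A : Type u} [Ring A] {𝒳 : ObjectProperty (ModuleCat.{u} A)}
  [𝒳.IsClosedUnderIsomorphisms]

theorem mem_of_range_eq {K Z L : ModuleCat.{u} A} (f : K →ₗ[A] L) (g : Z →ₗ[A] L)
    (hf : Function.Injective f) (hg : Function.Injective g)
    (h : LinearMap.range f = LinearMap.range g) (hZ : 𝒳 Z) : 𝒳 K :=
  mem_of_linearEquiv (((LinearEquiv.ofInjective g hg).trans (LinearEquiv.ofEq _ _ h.symm)).trans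
    (LinearEquiv.ofInjective f hf).symm) hZ

theorem mem_of_ker_eq {K Z L : ModuleCat.{u} A} (f : L →ₗ[A] K) (g : L →ₗ[A] Z)
    (hf : Function.Surjective f) (hg : Function.Surjective g)
    (h : LinearMap.ker f = LinearMap.ker g) (hZ : 𝒳 Z) : 𝒳 K :=
  mem_of_linearEquiv (((g.quotKerEquivOfSurjective hg).symm.trans
    (Submodule.quotEquivOfEq _ _ h.symm)).trans (f.quotKerEquivOfSurjective hf)) hZ

end Comparison

section Retracts

variable {k : Type u} [Field k] {V : Type} [Quiver.{0} V]
  [∀ j : V, Fintype (Σ i : V, (i ⟶ j))] {A : Type u} [Ring A] [Algebra k A]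
  {ρ : ∀ a b : V, Set (Quiver.Path a b)}

/-- In a retract of a direct sum of representations `M ⊗ P(i)` the images of the arrows have
complements. -/
theorem exists_section_of_retract (hQ : IsAcyclicQuiver V) (hρ : IsAdmissible k ρ)
    {X : QRep V A} {L : V → ModuleCat.{u} A} (s : X ⟶ freeRep ρ k L) (f : freeRep ρ k L ⟶ X)
    (hsf : s ≫ f = 𝟙 X) (j : V) :
    ∃ (i : X.cok j →ₗ[A] L j) (r : L j →ₗ[A] X.branch j), ∀ c, X.cokMk j (r (i c)) = c := by
  refine ⟨(freeCokEquiv hQ hρ L j).toLinearMap ∘ₗ QRep.cokMap s j,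
    QRep.homAt f j ∘ₗ freeGen ρ L k j, fun c => ?_⟩
  obtain ⟨x, rfl⟩ := X.cokMk_surjective j c
  change X.cokMk j (QRep.homAt f j (freeGen ρ L k j (freeTop ρ L k j (QRep.homAt s j x)))) = _
  have h1 := QRep.homAt_mem_arrowImage f
    (sub_freeGen_mem_arrowImage ρ L hQ hρ (QRep.homAt s j x))
  rw [map_sub, ← QRep.homAt_comp, hsf, QRep.homAt_id, QRep.sub_mem_arrowImage] at h1
  exact h1.symm

end Retracts

section Enough

variable {k : Type u} [Field k] {V : Type} [Quiver.{0} V] [Finite V]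
  [∀ j : V, Fintype (Σ i : V, (i ⟶ j))] {A : Type u} [Ring A] [Algebra k A]
  {ρ : ∀ a b : V, Set (Quiver.Path a b)}
  {𝒳 : ObjectProperty (ModuleCat.{u} A)} [𝒳.IsClosedUnderIsomorphisms] [𝒳.ContainsZero]
  [𝒳.IsClosedUnderExtensions]

theorem isProjectiveIn_freeRep (hQ : IsAcyclicQuiver V) (hρ : IsAdmissible k ρ)
    (h𝒳 : ∀ M : ModuleCat.{u} A, 𝒳 M → Module.Finite A M) {M : V → ModuleCat.{u} A}
    (hM : ∀ i, IsProjectiveIn 𝒳 (M i)) : IsProjectiveIn (smon k ρ 𝒳) (freeRep ρ k M) :=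
  isProjectiveIn_smon hQ hρ h𝒳 (smon_freeRep hQ hρ h𝒳 fun i => (hM i).mem) fun j =>
    (hM j).of_retract (mem_of_linearEquiv (freeCokEquiv hQ hρ M j).symm (hM j).mem)
      (freeCokEquiv hQ hρ M j).toLinearMap (freeCokEquiv hQ hρ M j).symm.toLinearMap
      (freeCokEquiv hQ hρ M j).symm_apply_apply

theorem isInjectiveIn_freeRep (hQ : IsAcyclicQuiver V) (hρ : IsAdmissible k ρ)
    (h𝒳 : ∀ M : ModuleCat.{u} A, 𝒳 M → Module.Finite A M) {M : V → ModuleCat.{u} A}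
    (hM : ∀ i, IsInjectiveIn 𝒳 (M i)) : IsInjectiveIn (smon k ρ 𝒳) (freeRep ρ k M) :=
  isInjectiveIn_smon hQ hρ h𝒳 (smon_freeRep hQ hρ h𝒳 fun i => (hM i).mem)
    (isInjectiveIn_branch_freeRep hQ hM)

/-- Relative projective covers `L_i → Cok_i(X)` lift to the branches `X_i` and so define a map from
the direct sum of the `L_i ⊗ P(i)`. It is onto because it is onto modulo arrow images; its kernel is
monic, with `Cok_j` equal to the kernel of `L_j → Cok_j(X)`. -/
theorem exists_freeRep_cover (hQ : IsAcyclicQuiver V) (hρ : IsAdmissible k ρ)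
    (h𝒳 : ∀ M : ModuleCat.{u} A, 𝒳 M → Module.Finite A M) (hE : HasEnoughProjectives 𝒳)
    {X : QRep V A} (hX : smon k ρ 𝒳 X) :
    ∃ (L : V → ModuleCat.{u} A) (K : QRep V A) (f : K ⟶ freeRep ρ k L) (g : freeRep ρ k L ⟶ X)
      (w : f ≫ g = 0), (∀ i, IsProjectiveIn 𝒳 (L i)) ∧ smon k ρ 𝒳 K ∧
      (ShortComplex.mk f g w).ShortExact := by
  obtain ⟨rk, hrk⟩ := hQ.exists_rank
  have hX' := (smon_iff hQ hρ h𝒳 X).1 hX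
  choose Z L z l w hZ hL hzl using fun i => hE (X.cok i) (hX'.2 i)
  have hzl := fun i => (shortExact_module_iff _).1 (hzl i)
  have hv : ∀ i, ∃ v : L i →ₗ[A] X.branch i, ∀ m, X.cokMk i (v m) = (l i).hom m := fun i =>
    (isProjectiveIn_module_iff.1 (hL i)).2
      (ModuleCat.of A (X.arrowImage i)) (X.branch i) (X.cok i) (X.arrowImage i).subtype
      (X.cokMk i) (Submodule.injective_subtype _) (X.cokMk_surjective i) (X.exact_arrowImage i)
      (hX'.1.branch_mem hQ hρ hX'.2 i).2 (hX'.1.branch_mem hQ hρ hX'.2 i).1 (hX'.2 i) (l i).hom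
  choose v hv using hv
  obtain ⟨g, hg⟩ := exists_freeRep_hom (k := k) ρ L hX'.1.relations v
  have hgl : ∀ j x, X.cokMk j (QRep.homAt g j x) = (l j).hom (freeTop ρ L k j x) := by
    intro j x
    have h1 := QRep.homAt_mem_arrowImage g (sub_freeGen_mem_arrowImage ρ L hQ hρ x)
    rwa [map_sub, hg, QRep.sub_mem_arrowImage, hv] at h1
  have hsurj : ∀ j, Function.Surjective (QRep.homAt g j) :=
    QRep.surjective_of_cok g hrk fun j y => by
      obtain ⟨m, hm⟩ := (hzl j).2.1 (X.cokMk j y)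
      exact ⟨freeGen ρ L k j m, by
        rw [QRep.sub_mem_arrowImage, hgl, freeTop_freeGen ρ L hρ]
        exact hm.symm⟩
  have : ∀ j, Epi (g.app j) := fun j => (ModuleCat.epi_iff_surjective _).2 (hsurj j)
  have hepi : Epi g := NatTrans.epi_of_epi_app g
  have hexact : (ShortComplex.mk (kernel.ι g) g (kernel.condition g)).ShortExact :=
    { exact := ShortComplex.exact_kernel g }
  have hS := (shortExact_iff _).1 hexact
  have hF := isMonic_freeRep (k := k) ρ L hρ
  have hcok : ∀ j (x : (kernel g).branch j), QRep.homAt (kernel.ι g) j x ∈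
      (freeRep ρ k L).arrowImage j → x ∈ (kernel g).arrowImage j := fun j x hx =>
    IsMonic.mem_arrowImage_of_exact hF.relations hX'.1 (kernel.ι g) g (fun j => (hS j).1)
      hsurj (fun j => (hS j).2.2) hx
  refine ⟨L, kernel g, kernel.ι g, g, kernel.condition g, hL, ?_, hexact⟩
  rw [smon_iff hQ hρ h𝒳]
  refine ⟨hF.of_injective hQ (kernel.ι g) (fun j => (hS j).1) hcok, fun j => ?_⟩
  have hfg : ∀ x, QRep.homAt g j (QRep.homAt (kernel.ι g) j x) = 0 :=
    (hS j).2.2.apply_apply_eq_zero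
  -- Both `Cok_j` of the kernel and `Z j` embed in `L j`, with the same image, namely the kernel of
  -- `l j`.
  refine mem_of_range_eq ((freeCokEquiv hQ hρ L j).toLinearMap ∘ₗ QRep.cokMap (kernel.ι g) j)
    (z j).hom ?_ (hzl j).1 ?_ (hZ j)
  · refine (freeCokEquiv hQ hρ L j).injective.comp ?_
    rw [injective_iff_map_eq_zero]
    intro c hc
    obtain ⟨x, rfl⟩ := QRep.cokMk_surjective _ j c
    rw [QRep.cokMap_cokMk, QRep.cokMk_eq_zero] at hc
    exact (QRep.cokMk_eq_zero _).2 (hcok j x hc)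
  · ext m
    constructor
    · rintro ⟨c, rfl⟩
      obtain ⟨x, rfl⟩ := QRep.cokMk_surjective _ j c
      apply ((hzl j).2.2 _).1
      change (l j).hom (freeTop ρ L k j (QRep.homAt (kernel.ι g) j x)) = 0
      rw [← hgl, hfg, map_zero]
    · intro hm
      have h0 : (l j).hom m = 0 := ((hzl j).2.2 m).2 hm
      have h1 : QRep.homAt g j (freeGen ρ L k j m) ∈ X.arrowImage j := by
        rw [← QRep.cokMk_eq_zero, hgl, freeTop_freeGen ρ L hρ, h0]
      -- The generator for `m` maps into the arrow images of `X`; subtracting an element `y` of the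
      -- arrow images upstairs moves it into the kernel without changing its top `m`.
      obtain ⟨y, hy, hy'⟩ := QRep.exists_arrowImage_lift g hsurj h1
      obtain ⟨x, hx⟩ := ((hS j).2.2 (freeGen ρ L k j m - y)).1 (by
        change QRep.homAt g j _ = 0
        rw [map_sub, hy', sub_self])
      refine ⟨(kernel g).cokMk j x, ?_⟩
      change freeTop ρ L k j (QRep.homAt (kernel.ι g) j x) = m
      have hx' : QRep.homAt (kernel.ι g) j x = freeGen ρ L k j m - y := hx
      rw [hx', map_sub, freeTop_freeGen ρ L hρ, (mem_arrowImage_freeRep_iff ρ L hQ y).1 hy,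
        sub_zero]

/-- The embeddings `Cok_j(X) → L_j` are realized by a morphism built vertex by vertex, using that
the branches of the direct sum of the `L_i ⊗ P(i)` are injective in `𝒳`. It is injective modulo
arrow images, hence injective with monic cokernel, and `Cok_j` of that cokernel is the cokernel of
`Cok_j(X) → L_j`. -/
theorem exists_freeRep_hull (hQ : IsAcyclicQuiver V) (hρ : IsAdmissible k ρ)
    (h𝒳 : ∀ M : ModuleCat.{u} A, 𝒳 M → Module.Finite A M) (hE : HasEnoughInjectives 𝒳)
    {X : QRep V A} (hX : smon k ρ 𝒳 X) :
    ∃ (L : V → ModuleCat.{u} A) (C : QRep V A) (f : X ⟶ freeRep ρ k L) (g : freeRep ρ k L ⟶ C)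
      (w : f ≫ g = 0), (∀ i, IsInjectiveIn 𝒳 (L i)) ∧ smon k ρ 𝒳 C ∧
      (ShortComplex.mk f g w).ShortExact := by
  obtain ⟨rk, hrk⟩ := hQ.exists_rank
  have hX' := (smon_iff hQ hρ h𝒳 X).1 hX
  choose L Z l z w hL hZ hlz using fun i => hE (X.cok i) (hX'.2 i)
  have hlz := fun i => (shortExact_module_iff _).1 (hlz i)
  have hF := isMonic_freeRep (k := k) ρ L hρ
  obtain ⟨f, hf⟩ := hX'.1.exists_hom hF.relations hrk
    (fun j h => ∀ x, freeTop ρ L k j (h x) = (l j).hom (X.cokMk j x)) (by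
    intro j h _ φ hφ
    obtain ⟨ψ, hψ⟩ := (isInjectiveIn_module_iff.1
      (isInjectiveIn_branch_freeRep (k := k) (ρ := ρ) hQ hL j)).2
      (ModuleCat.of A (X.arrowImage j)) (X.branch j) (X.cok j) (X.arrowImage j).subtype
      (X.cokMk j) (Submodule.injective_subtype _) (X.cokMk_surjective j) (X.exact_arrowImage j)
      (hX'.1.branch_mem hQ hρ hX'.2 j).2 (hX'.1.branch_mem hQ hρ hX'.2 j).1 (hX'.2 j) φ
    -- The extension `ψ` of `φ` has an uncontrolled top component, which is removed and replaced by
    -- `l j`. Nothing changes on the arrow images, where `φ` already has zero top component.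
    refine ⟨ψ - freeGen ρ L k j ∘ₗ freeTop ρ L k j ∘ₗ ψ +
      freeGen ρ L k j ∘ₗ (l j).hom ∘ₗ X.cokMk j, fun w => ?_, fun x => ?_⟩
    · have h0 : X.cokMk j w = 0 := X.cokMk_eq_zero.2 w.2
      have h1 : ψ w = φ w := hψ w
      have h2 : freeTop ρ L k j (φ w) = 0 :=
        (mem_arrowImage_freeRep_iff ρ L hQ _).1 (QRep.map_arrowImage_mem hφ w)
      simp only [LinearMap.add_apply, LinearMap.sub_apply, LinearMap.comp_apply, h0, h1, h2,
        map_zero, sub_zero, add_zero]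
    · simp only [LinearMap.add_apply, LinearMap.sub_apply, LinearMap.comp_apply, map_add, map_sub,
        freeTop_freeGen ρ L hρ, sub_self, zero_add])
  have hcok : ∀ j (x : X.branch j), QRep.homAt f j x ∈ (freeRep ρ k L).arrowImage j →
      x ∈ X.arrowImage j := by
    intro j x hx
    rw [mem_arrowImage_freeRep_iff ρ L hQ, hf] at hx
    rw [← X.cokMk_eq_zero]
    exact (hlz j).1 (hx.trans (map_zero _).symm)
  have hinj := hX'.1.injective_of_cok hQ hF f hcok
  have : ∀ j, Mono (f.app j) := fun j => (ModuleCat.mono_iff_injective _).2 (hinj j)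
  have hmono : Mono f := NatTrans.mono_of_mono_app f
  have hexact : (ShortComplex.mk f (cokernel.π f) (cokernel.condition f)).ShortExact :=
    { exact := ShortComplex.exact_cokernel f }
  have hS := (shortExact_iff _).1 hexact
  have hsurj : ∀ j, Function.Surjective (QRep.homAt (cokernel.π f) j) := fun j => (hS j).2.1
  have hfg : ∀ j x, QRep.homAt (cokernel.π f) j (QRep.homAt f j x) = 0 := fun j =>
    (hS j).2.2.apply_apply_eq_zero
  refine ⟨L, cokernel f, f, cokernel.π f, cokernel.condition f, hL, ?_, hexact⟩
  rw [smon_iff hQ hρ h𝒳]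
  refine ⟨hX'.1.of_exact hQ hF f (cokernel.π f) hcok hsurj (fun j => (hS j).2.2), fun j => ?_⟩
  -- Here `Cok_j` of the cokernel and `Z j` are quotients of the same branch by the same submodule.
  refine mem_of_ker_eq ((cokernel f).cokMk j ∘ₗ QRep.homAt (cokernel.π f) j)
    ((z j).hom ∘ₗ freeTop ρ L k j) ((QRep.cokMk_surjective _ j).comp (hsurj j)) ?_ ?_ (hZ j)
  · intro c
    obtain ⟨m, rfl⟩ := (hlz j).2.1 c
    exact ⟨freeGen ρ L k j m, by
      rw [LinearMap.comp_apply, freeTop_freeGen ρ L hρ]⟩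
  · ext x
    rw [LinearMap.mem_ker, LinearMap.mem_ker, LinearMap.comp_apply, LinearMap.comp_apply,
      QRep.cokMk_eq_zero]
    constructor
    · intro hx
      obtain ⟨y, hy, hy'⟩ := QRep.exists_arrowImage_lift (cokernel.π f) hsurj hx
      obtain ⟨t, ht⟩ := ((hS j).2.2 (x - y)).1 (by
        change QRep.homAt (cokernel.π f) j _ = 0
        rw [map_sub, hy', sub_self])
      have ht' : x = QRep.homAt f j t + y := by
        have : QRep.homAt f j t = x - y := ht
        rw [this, sub_add_cancel]
      rw [ht', map_add, hf, (mem_arrowImage_freeRep_iff ρ L hQ y).1 hy, add_zero]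
      exact (hlz j).2.2.apply_apply_eq_zero _
    · intro hx
      obtain ⟨c, hc⟩ := ((hlz j).2.2 _).1 hx
      obtain ⟨y, rfl⟩ := X.cokMk_surjective j c
      have h1 : x - QRep.homAt f j y ∈ (freeRep ρ k L).arrowImage j := by
        rw [mem_arrowImage_freeRep_iff ρ L hQ, map_sub, hf, sub_eq_zero]
        exact hc.symm
      have h2 := QRep.homAt_mem_arrowImage (cokernel.π f) h1
      rwa [map_sub, hfg, sub_zero] at h2

/-- The cover of a projective object splits. The splitting gives sections of the projections onto
`Cok_j(X)` that factor through `L j`, which both decomposes `X` and exhibits `Cok_j(X)` as a retract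
of `L j`. -/
theorem IsProjectiveIn.exists_iso_freeRep (hQ : IsAcyclicQuiver V) (hρ : IsAdmissible k ρ)
    (h𝒳 : ∀ M : ModuleCat.{u} A, 𝒳 M → Module.Finite A M) (hE : HasEnoughProjectives 𝒳)
    {X : QRep V A} (hX : IsProjectiveIn (smon k ρ 𝒳) X) :
    Nonempty (freeRep ρ k (fun j => X.cok j) ≅ X) ∧ ∀ j, IsProjectiveIn 𝒳 (X.cok j) := by
  have hX' := (smon_iff hQ hρ h𝒳 X).1 hX.mem
  obtain ⟨L, K, f, g, w, hL, hK, hS⟩ := exists_freeRep_cover hQ hρ h𝒳 hE hX.mem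
  obtain ⟨s, hs⟩ := hX.lift _ hS hK (smon_freeRep hQ hρ h𝒳 fun i => (hL i).mem) hX.mem (𝟙 X)
  choose i r hir using exists_section_of_retract hQ hρ s g hs
  exact ⟨hX'.1.exists_iso_freeRep ρ hQ hρ (fun j => r j ∘ₗ i j) hir, fun j =>
    (hL j).of_retract (hX'.2 j) (i j) (X.cokMk j ∘ₗ r j) (hir j)⟩

/-- The argument for projectives applies to the hull, which also presents `X` as a retract of a
direct sum of the `L_i ⊗ P(i)`. -/
theorem IsInjectiveIn.exists_iso_freeRep (hQ : IsAcyclicQuiver V) (hρ : IsAdmissible k ρ)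
    (h𝒳 : ∀ M : ModuleCat.{u} A, 𝒳 M → Module.Finite A M) (hE : HasEnoughInjectives 𝒳)
    {X : QRep V A} (hX : IsInjectiveIn (smon k ρ 𝒳) X) :
    Nonempty (freeRep ρ k (fun j => X.cok j) ≅ X) ∧ ∀ j, IsInjectiveIn 𝒳 (X.cok j) := by
  have hX' := (smon_iff hQ hρ h𝒳 X).1 hX.mem
  obtain ⟨L, C, f, g, w, hL, hC, hS⟩ := exists_freeRep_hull hQ hρ h𝒳 hE hX.mem
  obtain ⟨s, hs⟩ := hX.extend _ hS hX.mem (smon_freeRep hQ hρ h𝒳 fun i => (hL i).mem) hC (𝟙 X)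
  choose i r hir using exists_section_of_retract hQ hρ f s hs
  exact ⟨hX'.1.exists_iso_freeRep ρ hQ hρ (fun j => r j ∘ₗ i j) hir, fun j =>
    (hL j).of_retract (hX'.2 j) (i j) (X.cokMk j ∘ₗ r j) (hir j)⟩

end Enough

end SMon

namespace SMon

/-! ### Functoriality and indecomposable objects -/

section Functors

variable {k : Type u} [Field k] {V : Type} [Quiver.{0} V] {A : Type u} [Ring A] [Algebra k A]
  (ρ : ∀ a b : V, Set (Quiver.Path a b))

/-- The morphism `M ⊗ P(i) ⟶ N ⊗ P(i)` induced by a linear map `M → N`. -/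
def tensorMap (k : Type u) [Field k] [Algebra k A] {M N : ModuleCat.{u} A} (φ : M →ₗ[A] N)
    (i : V) :
    tensorRep M (projRep k ρ i) ⟶ tensorRep N (projRep k ρ i) :=
  tensorDesc k (satisfiesRelations_tensorRep ρ N i)
    (tensorIncl ρ N (Quiver.Path.nil : Quiver.Path i i) ∘ₗ φ)

theorem tensorMap_tensorIncl {M N : ModuleCat.{u} A} (φ : M →ₗ[A] N) {i j : V}
    (p : Quiver.Path i j) (m : M) :
    QRep.homAt (tensorMap ρ k φ i) j (tensorIncl ρ M p m) = tensorIncl ρ N p (φ m) := by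
  rw [tensorMap, tensorDesc_tensorIncl, LinearMap.comp_apply, mapPath_tensorIncl,
    Quiver.Path.nil_comp]

theorem tensorCoord_tensorMap {M N : ModuleCat.{u} A} (φ : M →ₗ[A] N) {i j : V}
    (p : Quiver.Path i j) (t : (tensorRep M (projRep k ρ i)).branch j) :
    tensorCoord ρ N p (QRep.homAt (tensorMap ρ k φ i) j t) = φ (tensorCoord ρ M p t) := by
  refine tensor_induction ρ (P := fun t => tensorCoord ρ N p
    (QRep.homAt (tensorMap ρ k φ i) j t) = φ (tensorCoord ρ M p t)) ?_ ?_ ?_ t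
  · intro q m hq
    rw [tensorMap_tensorIncl]
    by_cases h : q = p
    · subst h
      rw [tensorCoord_tensorIncl ρ _ _ hq, tensorCoord_tensorIncl ρ _ _ hq]
    · rw [tensorCoord_tensorIncl_of_ne ρ _ h, tensorCoord_tensorIncl_of_ne ρ _ h, map_zero]
  · simp only [map_zero]
  · intro s t hs ht
    simp only [map_add, hs, ht]

theorem tensorMap_injective {M N : ModuleCat.{u} A} {φ : M →ₗ[A] N} (hφ : Function.Injective φ)
    (i j : V) : Function.Injective (QRep.homAt (tensorMap ρ k φ i) j) := by
  rw [injective_iff_map_eq_zero]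
  intro t ht
  refine tensor_eq_zero ρ fun p => hφ ?_
  rw [← tensorCoord_tensorMap, ht, map_zero, map_zero]

theorem tensorMap_surjective {M N : ModuleCat.{u} A} {φ : M →ₗ[A] N}
    (hφ : Function.Surjective φ) (i j : V) :
    Function.Surjective (QRep.homAt (tensorMap ρ k φ i) j) := by
  intro t
  refine tensor_induction ρ (P := fun t => ∃ s, QRep.homAt (tensorMap ρ k φ i) j s = t)
    ?_ ⟨0, map_zero _⟩ ?_ t
  · intro p n _
    obtain ⟨m, rfl⟩ := hφ n
    exact ⟨tensorIncl ρ M p m, tensorMap_tensorIncl ρ φ p m⟩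
  · rintro _ _ ⟨s, rfl⟩ ⟨t, rfl⟩
    exact ⟨s + t, map_add _ _ _⟩

/-- On branches the functor is a direct sum of copies of the identity, indexed by paths, so
exactness is checked in each coordinate. -/
theorem tensorMap_exact {M N L : ModuleCat.{u} A} {φ : M →ₗ[A] N} {ψ : N →ₗ[A] L}
    (h : Function.Exact φ ψ) (i j : V) :
    Function.Exact (QRep.homAt (tensorMap ρ k φ i) j) (QRep.homAt (tensorMap ρ k ψ i) j) := by
  intro t
  constructor
  · intro ht
    change t ∈ LinearMap.range (QRep.homAt (tensorMap ρ k φ i) j)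
    rw [← (tensorEquiv ρ N i j).symm_apply_apply t,
      ← Finsupp.sum_single (tensorEquiv ρ N i j t), Finsupp.sum, map_sum]
    refine sum_mem fun p _ => ?_
    rw [← tensorEquiv_tensorIncl ρ N p.1 p.2, LinearEquiv.symm_apply_apply]
    obtain ⟨m, hm⟩ := (h (tensorEquiv ρ N i j t p)).1 (by
      rw [← tensorCoord_eq ρ N p.1 p.2, ← tensorCoord_tensorMap, ht, map_zero])
    exact ⟨tensorIncl ρ M p.1 m, by rw [tensorMap_tensorIncl, hm]⟩
  · rintro ⟨s, rfl⟩
    refine tensor_eq_zero ρ fun p => ?_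
    rw [tensorCoord_tensorMap, tensorCoord_tensorMap, h.apply_apply_eq_zero]

/-- The functor `M ↦ M ⊗ P(i)`. -/
def tensorFunctor (k : Type u) [Field k] [Algebra k A] (i : V) : ModuleCat.{u} A ⥤ QRep V A where
  obj M := tensorRep M (projRep k ρ i)
  map f := tensorMap ρ k f.hom i
  map_id M := tensor_hom_ext fun m => tensorMap_tensorIncl ρ _ _ m
  map_comp f g := tensor_hom_ext fun m => by
    rw [QRep.homAt_comp, tensorMap_tensorIncl, tensorMap_tensorIncl, tensorMap_tensorIncl]
    rfl

instance (i : V) : (tensorFunctor (A := A) ρ k i).Additive where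
  map_add {M N f g} := tensor_hom_ext fun m => by
    change QRep.homAt (tensorMap ρ k (f + g).hom i) i _ =
      QRep.homAt (tensorMap ρ k f.hom i) i _ + QRep.homAt (tensorMap ρ k g.hom i) i _
    rw [tensorMap_tensorIncl, tensorMap_tensorIncl, tensorMap_tensorIncl, ← map_add]
    rfl

/-- The functor `X ↦ Cok_j(X)`. -/
def cokFunctor {R : Type u} [Ring R] (j : V) : QRep V R ⥤ ModuleCat.{u} R where
  obj X := X.cok j
  map f := ModuleCat.ofHom (QRep.cokMap f j)
  map_id X := by
    apply ModuleCat.hom_ext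
    refine LinearMap.ext fun (c : X.cok j) => ?_
    obtain ⟨x, rfl⟩ := X.cokMk_surjective j c
    rfl
  map_comp {X Y Z} f g := by
    apply ModuleCat.hom_ext
    refine LinearMap.ext fun (c : X.cok j) => ?_
    obtain ⟨x, rfl⟩ := X.cokMk_surjective j c
    rfl

instance {R : Type u} [Ring R] (j : V) : (cokFunctor (V := V) (R := R) j).Additive where
  map_add {X Y f g} := by
    apply ModuleCat.hom_ext
    refine LinearMap.ext fun (c : X.cok j) => ?_
    obtain ⟨x, rfl⟩ := X.cokMk_surjective j c
    rfl

end Functors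

/-! ### Zero representations and splitting off a factor. -/

section Zero

variable {V : Type} [Quiver.{0} V] {R : Type u} [Ring R]

theorem isZero_of_subsingleton_branch {X : QRep V R} (h : ∀ j, Subsingleton (X.branch j)) :
    IsZero X :=
  (IsZero.iff_id_eq_zero X).2 (QRep.hom_ext fun j _ => (h j).elim _ _)

theorem subsingleton_branch_of_isZero {X : QRep V R} (h : IsZero X) (j : V) :
    Subsingleton (X.branch j) :=
  subsingleton_of_forall_eq 0 fun x =>
    LinearMap.congr_fun (congrArg (fun t => QRep.homAt t j) ((IsZero.iff_id_eq_zero X).1 h)) x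

/-- A form of Nakayama's lemma: the zero endomorphism is surjective modulo arrow images, hence
surjective. -/
theorem isZero_of_subsingleton_cok [Finite V] (hQ : IsAcyclicQuiver V) {X : QRep V R}
    (h : ∀ j, Subsingleton (X.cok j)) : IsZero X := by
  obtain ⟨rk, hrk⟩ := hQ.exists_rank
  refine isZero_of_subsingleton_branch fun j => subsingleton_of_forall_eq 0 fun x => ?_
  obtain ⟨y, hy⟩ := QRep.surjective_of_cok (0 : X ⟶ X) hrk
    (fun j y => ⟨0, X.sub_mem_arrowImage.2 ((h j).elim _ _)⟩) j x
  exact hy.symm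

theorem subsingleton_of_isZero_module {M : ModuleCat.{u} R} (h : IsZero M) : Subsingleton M :=
  ModuleCat.isZero_iff_subsingleton.1 h

/-- A product is the direct sum of one factor and the product of the other ones. -/
theorem nonempty_piRep_iso_biprod {ι : Type} (T : ι → QRep V R) (i : ι) :
    Nonempty (piRep T ≅ T i ⊞ piRep fun a : {a // a ≠ i} => T a) := by
  classical
  let snd : piRep T ⟶ piRep fun a : {a // a ≠ i} => T a :=
    QRep.homMk (fun j => (LinearMap.pi fun a => LinearMap.proj a.1 :
      (∀ a, (T a).branch j) →ₗ[R] (∀ a : {a // a ≠ i}, (T a).branch j))) fun _ _ _ _ => rfl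
  let c : ∀ (j : V) (a : ι), (∀ a : {a // a ≠ i}, (T a).branch j) →ₗ[R] (T a).branch j :=
    fun j a => if h : a = i then 0 else LinearMap.proj (⟨a, h⟩ : {a // a ≠ i})
  have hc : ∀ (j : V) (a : ι) x, c j a x = if h : a = i then 0 else x ⟨a, h⟩ := by
    intro j a x
    change (if h : a = i then 0 else LinearMap.proj (⟨a, h⟩ : {a // a ≠ i}) :
      (∀ a : {a // a ≠ i}, (T a).branch j) →ₗ[R] (T a).branch j) x = _
    split_ifs <;> rfl
  let inr : (piRep fun a : {a // a ≠ i} => T a) ⟶ piRep T :=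
    QRep.homMk (fun j => LinearMap.pi (c j)) fun j l α x => by
      funext a
      refine (hc _ a _).trans (Eq.trans ?_ (congrArg ((T a).mapArrow α) (hc _ a _)).symm)
      by_cases h : a = i
      · rw [dif_pos h, dif_pos h, map_zero]
      · rw [dif_neg h, dif_neg h]
        rfl
  have hinr : ∀ {j : V} (x : ∀ a : {a // a ≠ i}, (T a).branch j) (a : ι),
      (QRep.homAt inr j x : ∀ a, (T a).branch j) a =
        if h : a = i then 0 else x ⟨a, h⟩ := fun x a => hc _ a x
  let b : BinaryBicone (T i) (piRep fun a : {a // a ≠ i} => T a) :=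
    { pt := piRep T
      fst := piProj T i
      snd := snd
      inl := piIncl T i
      inr := inr
      inl_fst := QRep.hom_ext fun j x => piIncl_apply_same T i x
      inl_snd := QRep.hom_ext fun j x => by
        funext a
        exact piIncl_apply_of_ne T a.2 x
      inr_fst := QRep.hom_ext fun j x => by
        refine (hinr x i).trans ?_
        rw [dif_pos rfl]
        rfl
      inr_snd := QRep.hom_ext fun j x => by
        funext a
        refine (hinr x a).trans ?_
        rw [dif_neg a.2]
        rfl }
  refine ⟨biprod.uniqueUpToIso _ _ (isBinaryBilimitOfTotal b ?_)⟩
  refine QRep.hom_ext fun j x => ?_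
  funext a
  change (QRep.homAt (piIncl T i) j ((x : ∀ a, (T a).branch j) i) : ∀ a, (T a).branch j) a +
    (QRep.homAt inr j (QRep.homAt snd j x) : ∀ a, (T a).branch j) a =
      (x : ∀ a, (T a).branch j) a
  refine (congrArg (_ + ·) (hinr _ a)).trans ?_
  by_cases h : a = i
  · subst h
    rw [piIncl_apply_same, dif_pos rfl, add_zero]
  · rw [piIncl_apply_of_ne T h, dif_neg h, zero_add]
    rfl

end Zero

section Transfer

universe v w

variable {C : Type w} [Category.{v} C] [HasZeroMorphisms C] {P : ObjectProperty C}

theorem IsProjectiveIn.of_iso {X Y : C} (hX : IsProjectiveIn P X) (e : X ≅ Y) (hY : P Y) :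
    IsProjectiveIn P Y where
  mem := hY
  lift S hS h1 h2 h3 h := by
    obtain ⟨g, hg⟩ := hX.lift S hS h1 h2 h3 (e.hom ≫ h)
    exact ⟨e.inv ≫ g, by rw [Category.assoc, hg, e.inv_hom_id_assoc]⟩

theorem IsInjectiveIn.of_iso {X Y : C} (hX : IsInjectiveIn P X) (e : X ≅ Y) (hY : P Y) :
    IsInjectiveIn P Y where
  mem := hY
  extend S hS h1 h2 h3 h := by
    obtain ⟨g, hg⟩ := hX.extend S hS h1 h2 h3 (h ≫ e.inv)
    exact ⟨g ≫ e.hom, by rw [← Category.assoc, hg, Category.assoc, e.inv_hom_id, Category.comp_id]⟩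

end Transfer

section ZeroTensor

variable {k : Type u} [Field k] {V : Type} [Quiver.{0} V] {A : Type u} [Ring A] [Algebra k A]
  {ρ : ∀ a b : V, Set (Quiver.Path a b)}

theorem isZero_of_isZero_tensorRep (hQ : IsAcyclicQuiver V) (hρ : IsAdmissible k ρ)
    {M : ModuleCat.{u} A} {i : V} (h : IsZero (tensorRep M (projRep k ρ i))) : IsZero M := by
  have := subsingleton_branch_of_isZero h i
  have := (tensorBranchEquiv hQ hρ M i).toEquiv.subsingleton
  exact ModuleCat.isZero_of_subsingleton M

end ZeroTensor

/-! ### Indecomposable objects of `smon`. -/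

section Indecomposable

variable {k : Type u} [Field k] {V : Type} [Quiver.{0} V] [Finite V]
  [∀ j : V, Fintype (Σ i : V, (i ⟶ j))] {A : Type u} [Ring A] [Algebra k A]
  {ρ : ∀ a b : V, Set (Quiver.Path a b)}
  {𝒳 : ObjectProperty (ModuleCat.{u} A)} [𝒳.IsClosedUnderIsomorphisms] [𝒳.ContainsZero]
  [𝒳.IsClosedUnderExtensions]

theorem smon_of_iso (hQ : IsAcyclicQuiver V) (hρ : IsAdmissible k ρ)
    (h𝒳 : ∀ M : ModuleCat.{u} A, 𝒳 M → Module.Finite A M) {X Y : QRep V A} (e : X ≅ Y)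
    (hX : smon k ρ 𝒳 X) : smon k ρ 𝒳 Y := by
  rw [smon_iff hQ hρ h𝒳] at hX ⊢
  have he : ∀ j y, QRep.homAt e.hom j (QRep.homAt e.inv j y) = y := fun j y => by
    rw [← QRep.homAt_comp, e.inv_hom_id, QRep.homAt_id]
  exact ⟨hX.1.of_injective hQ e.inv
    (fun j => Function.LeftInverse.injective (g := QRep.homAt e.hom j) (he j))
    fun j y hy => by
      have := QRep.homAt_mem_arrowImage e.hom hy
      rwa [he] at this, fun j =>
    𝒳.prop_of_iso ((cokFunctor (V := V) (R := A) j).mapIso e) (hX.2 j)⟩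

theorem smon_piRep (hQ : IsAcyclicQuiver V) (hρ : IsAdmissible k ρ)
    (h𝒳 : ∀ M : ModuleCat.{u} A, 𝒳 M → Module.Finite A M) {ι : Type} [Finite ι]
    {T : ι → QRep V A} (hT : ∀ a, smon k ρ 𝒳 (T a)) : smon k ρ 𝒳 (piRep T) := by
  simp only [smon_iff hQ hρ h𝒳] at hT ⊢
  refine ⟨isMonic_piRep T fun a => (hT a).1, fun j => ?_⟩
  let g : (piRep T).branch j →ₗ[A] (∀ a, (T a).cok j) :=
    LinearMap.pi fun a => (T a).cokMk j ∘ₗ QRep.homAt (piProj T a) j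
  refine mem_of_ker_eq (Z := ModuleCat.of A (∀ a, (T a).cok j)) ((piRep T).cokMk j) g
    (QRep.cokMk_surjective _ j) ?_ ?_
    (mem_pi (fun a => (T a).cok j) (fun a => (hT a).2 j) _ (LinearEquiv.refl A _))
  · intro c
    choose x hx using fun a => (T a).cokMk_surjective j (c a)
    exact ⟨x, funext hx⟩
  · ext x
    rw [LinearMap.mem_ker, LinearMap.mem_ker, QRep.cokMk_eq_zero, mem_arrowImage_piRep_iff]
    refine ⟨fun h => funext fun a => (QRep.cokMk_eq_zero _).2 (h a), fun h a => ?_⟩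
    exact (QRep.cokMk_eq_zero _).1 (congrFun h a)

/-- An indecomposable direct sum of representations `M ⊗ P(i)` has only one summand. -/
theorem IsIndecomposableIn.exists_iso_tensorRep (hQ : IsAcyclicQuiver V) (hρ : IsAdmissible k ρ)
    (h𝒳 : ∀ M : ModuleCat.{u} A, 𝒳 M → Module.Finite A M) {X : QRep V A}
    (hX : IsIndecomposableIn (smon k ρ 𝒳) X) (e : freeRep ρ k (fun j => X.cok j) ≅ X) :
    ∃ i, IsIndecomposableIn 𝒳 (X.cok i) ∧
      Nonempty (X ≅ tensorRep (X.cok i) (projRep k ρ i)) := by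
  have hcok := ((smon_iff hQ hρ h𝒳 X).1 hX.mem).2
  obtain ⟨i, hi⟩ : ∃ i, ¬ Subsingleton (X.cok i) := by
    by_contra! h
    exact hX.not_isZero (isZero_of_subsingleton_cok hQ h)
  let T : V → QRep V A := fun i => tensorRep (X.cok i) (projRep k ρ i)
  have hT : ∀ a, smon k ρ 𝒳 (T a) := fun a => smon_tensorRep hQ hρ h𝒳 (hcok a) a
  have e' : freeRep ρ k (fun j => X.cok j) ≅ T i ⊞ piRep fun a : {a // a ≠ i} => T a :=
    Classical.choice (nonempty_piRep_iso_biprod T i)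
  have hnz : ¬ IsZero (X.cok i) := fun h => hi (subsingleton_of_isZero_module h)
  -- A nonzero `Cok_i(X)` gives a nonzero summand, so indecomposability forces the product of all
  -- other summands to vanish.
  have hZ : IsZero (piRep fun a : {a // a ≠ i} => T a) :=
    (hX.isZero_or_isZero _ (piRep fun a : {a // a ≠ i} => T a) (hT i)
      (smon_piRep hQ hρ h𝒳 fun a => hT a)
      ⟨e.symm ≪≫ e'⟩).resolve_left fun h => hnz (isZero_of_isZero_tensorRep hQ hρ h)
  let e₁ : X ≅ T i := (e.symm ≪≫ e') ≪≫ (isoBiprodZero hZ).symm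
  refine ⟨i, ⟨hcok i, hnz, fun Y Z hY hZ ⟨e₂⟩ => ?_⟩, ⟨e₁⟩⟩
  -- A decomposition of `Cok_i(X)` would tensor up to one of `X`, and tensoring with `P(i)` reflects
  -- zero objects.
  have := preservesBinaryBiproducts_of_preservesBiproducts (tensorFunctor (A := A) ρ k i)
  have e₃ : T i ≅ tensorRep Y (projRep k ρ i) ⊞ tensorRep Z (projRep k ρ i) :=
    (tensorFunctor (A := A) ρ k i).mapIso e₂ ≪≫ (tensorFunctor (A := A) ρ k i).mapBiprod Y Z
  exact (hX.isZero_or_isZero _ _ (smon_tensorRep hQ hρ h𝒳 hY i) (smon_tensorRep hQ hρ h𝒳 hZ i)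
    ⟨e₁ ≪≫ e₃⟩).imp (isZero_of_isZero_tensorRep hQ hρ) (isZero_of_isZero_tensorRep hQ hρ)

/-- Applying `Cok_i` to a decomposition of `M ⊗ P(i)` decomposes `M`, so one summand has zero
`Cok_i`. Its other `Cok_j` are retracts of zero modules, so that summand vanishes. -/
theorem IsIndecomposableIn.of_iso_tensorRep (hQ : IsAcyclicQuiver V) (hρ : IsAdmissible k ρ)
    (h𝒳 : ∀ M : ModuleCat.{u} A, 𝒳 M → Module.Finite A M) {M : ModuleCat.{u} A}
    (hM : IsIndecomposableIn 𝒳 M) (i : V) {X : QRep V A}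
    (e : X ≅ tensorRep M (projRep k ρ i)) : IsIndecomposableIn (smon k ρ 𝒳) X := by
  refine ⟨smon_of_iso hQ hρ h𝒳 e.symm (smon_tensorRep hQ hρ h𝒳 hM.mem i),
    fun h => hM.not_isZero (isZero_of_isZero_tensorRep hQ hρ (h.of_iso e.symm)), ?_⟩
  rintro Y Z hY hZ ⟨e'⟩
  let F := cokFunctor (V := V) (R := A)
  have hsub : ∀ j, i ≠ j → Subsingleton ((Y ⊞ Z).cok j) := fun j h => by
    have : Subsingleton ((F j).obj (tensorRep M (projRep k ρ i))) := subsingleton_cok_tensorRep h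
    exact ((F j).mapIso (e'.symm ≪≫ e)).toLinearEquiv.toEquiv.subsingleton
  have := preservesBinaryBiproducts_of_preservesBiproducts (F i)
  have e₁ : M ≅ Y.cok i ⊞ Z.cok i :=
    (tensorCokEquiv hQ hρ M i).toModuleIso ≪≫ (F i).mapIso (e.symm ≪≫ e') ≪≫ (F i).mapBiprod Y Z
  have key : ∀ {W : QRep V A} (s : W ⟶ Y ⊞ Z) (r : Y ⊞ Z ⟶ W), s ≫ r = 𝟙 W →
      IsZero (W.cok i) → IsZero W := by
    intro W s r hsr hW
    refine isZero_of_subsingleton_cok hQ fun j => ?_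
    by_cases h : i = j
    · subst h
      exact subsingleton_of_isZero_module hW
    · have := hsub j h
      refine subsingleton_of_forall_eq 0 fun c => ?_
      have h1 : (F j).map s ≫ (F j).map r = 𝟙 _ := by rw [← (F j).map_comp, hsr, (F j).map_id]
      have h2 : ((F j).map r).hom (((F j).map s).hom c) = c :=
        LinearMap.congr_fun (congrArg ModuleCat.Hom.hom h1) c
      have h3 : ((F j).map s).hom c = 0 := (hsub j h).elim _ _
      exact h2.symm.trans ((congrArg _ h3).trans (map_zero _))
  exact (hM.isZero_or_isZero _ _ (((smon_iff hQ hρ h𝒳 Y).1 hY).2 i)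
    (((smon_iff hQ hρ h𝒳 Z).1 hZ).2 i) ⟨e₁⟩).imp (key biprod.inl biprod.fst biprod.inl_fst)
      (key biprod.inr biprod.snd biprod.inr_snd)

end Indecomposable

end SMon

namespace SMon

/-! ### Comparison of the subcategories -/

section Sinks

variable {k : Type u} [Field k] {V : Type} [Quiver.{0} V] {A : Type u} [Ring A] [Algebra k A]
  {ρ : ∀ a b : V, Set (Quiver.Path a b)}

theorem IsAcyclicQuiver.exists_sink [Finite V] [Nonempty V] (hQ : IsAcyclicQuiver V) :
    ∃ i : V, ∀ j : V, IsEmpty (i ⟶ j) := by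
  obtain ⟨rk, hrk⟩ := hQ.exists_rank
  obtain ⟨i, hi⟩ := Finite.exists_max rk
  exact ⟨i, fun j => ⟨fun α => (hrk α).not_ge (hi j)⟩⟩

theorem eq_of_path_of_sink {i : V} (hi : ∀ j : V, IsEmpty (i ⟶ j)) {j : V}
    (p : Quiver.Path i j) : i = j := by
  induction p with
  | nil => rfl
  | cons p α ih =>
    subst ih
    exact (hi _).elim α

theorem subsingleton_branch_tensorRep_of_sink {i : V} (hi : ∀ j : V, IsEmpty (i ⟶ j))
    (M : ModuleCat.{u} A) {j : V} (h : i ≠ j) :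
    Subsingleton ((tensorRep M (projRep k ρ i)).branch j) :=
  subsingleton_of_forall_eq 0 fun _ =>
    tensor_eq_zero ρ fun p => absurd (eq_of_path_of_sink hi p) h

/-- At a sink `i`, morphisms to `M ⊗ P(i)` correspond to linear maps from the quotient by the
images of the arrows to `M`. -/
theorem exists_hom_tensorRep_of_sink (hQ : IsAcyclicQuiver V) {i : V}
    (hi : ∀ j : V, IsEmpty (i ⟶ j)) {L : QRep V A} {M : ModuleCat.{u} A} (t : L.cok i →ₗ[A] M) :
    ∃ h : L ⟶ tensorRep M (projRep k ρ i), ∀ x : L.branch i,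
      QRep.homAt h i x = tensorIncl ρ M Quiver.Path.nil (t (L.cokMk i x)) := by
  -- Quantifying over the paths from `i` to `j`, of which there are none unless `i = j`, allows a
  -- definition at all vertices without transport along that equality.
  have hloc : ∀ j, ∃ h : L.branch j →ₗ[A] (tensorRep M (projRep k ρ i)).branch j,
      ∀ (p : Quiver.Path i j) (x : L.branch i), h (L.mapPath p x) =
        tensorIncl ρ M p (t (L.cokMk i x)) := by
    intro j
    by_cases h : i = j
    · subst h
      refine ⟨tensorIncl ρ M Quiver.Path.nil ∘ₗ t ∘ₗ L.cokMk i, fun p x => ?_⟩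
      obtain rfl : p = Quiver.Path.nil := Quiver.Path.eq_nil_of_length_zero p (hQ i p)
      rw [QRep.mapPath_nil]
      rfl
    · exact ⟨0, fun p => absurd (eq_of_path_of_sink hi p) h⟩
  choose h hh using hloc
  have hnil : ∀ x, h i x = tensorIncl ρ M Quiver.Path.nil (t (L.cokMk i x)) := fun x => by
    rw [← hh, QRep.mapPath_nil]
  refine ⟨QRep.homMk h fun a b α x => ?_, hnil⟩
  have ha : i ≠ a := by
    rintro rfl
    exact (hi b).elim α
  have := subsingleton_branch_tensorRep_of_sink (k := k) (ρ := ρ) hi M ha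
  rw [Subsingleton.elim (h a x) 0, map_zero]
  by_cases hb : i = b
  · subst hb
    rw [hnil, L.cokMk_eq_zero.2 (L.mapArrow_mem_arrowImage α x), map_zero, map_zero]
  · exact (subsingleton_branch_tensorRep_of_sink hi M hb).elim _ _

end Sinks

/-! ### Passing between `𝒳` and `smon`. -/

section Comparison

variable {k : Type u} [Field k] {V : Type} [Quiver.{0} V] [Finite V]
  [∀ j : V, Fintype (Σ i : V, (i ⟶ j))] {A : Type u} [Ring A] [Algebra k A]
  {ρ : ∀ a b : V, Set (Quiver.Path a b)}
  {𝒳 : ObjectProperty (ModuleCat.{u} A)} [𝒳.IsClosedUnderIsomorphisms] [𝒳.ContainsZero]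
  [𝒳.IsClosedUnderExtensions]

theorem isProjectiveIn_tensorRep (hQ : IsAcyclicQuiver V) (hρ : IsAdmissible k ρ)
    (h𝒳 : ∀ M : ModuleCat.{u} A, 𝒳 M → Module.Finite A M) {M : ModuleCat.{u} A}
    (hM : IsProjectiveIn 𝒳 M) (i : V) :
    IsProjectiveIn (smon k ρ 𝒳) (tensorRep M (projRep k ρ i)) := by
  refine isProjectiveIn_smon hQ hρ h𝒳 (smon_tensorRep hQ hρ h𝒳 hM.mem i) fun j => ?_
  by_cases h : i = j
  · subst h
    exact hM.of_retract (mem_of_linearEquiv (tensorCokEquiv hQ hρ M i) hM.mem)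
      (tensorCokEquiv hQ hρ M i).symm.toLinearMap (tensorCokEquiv hQ hρ M i).toLinearMap
      (tensorCokEquiv hQ hρ M i).apply_symm_apply
  · have := subsingleton_cok_tensorRep (k := k) (ρ := ρ) (M := M) h
    exact hM.of_retract (mem_of_subsingleton _) 0 0 fun _ => Subsingleton.elim _ _

theorem isInjectiveIn_tensorRep (hQ : IsAcyclicQuiver V) (hρ : IsAdmissible k ρ)
    (h𝒳 : ∀ M : ModuleCat.{u} A, 𝒳 M → Module.Finite A M) {M : ModuleCat.{u} A}
    (hM : IsInjectiveIn 𝒳 M) (i : V) :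
    IsInjectiveIn (smon k ρ 𝒳) (tensorRep M (projRep k ρ i)) :=
  isInjectiveIn_smon hQ hρ h𝒳 (smon_tensorRep hQ hρ h𝒳 hM.mem i)
    (isInjectiveIn_branch_tensorRep hQ hM i)

theorem hasEnoughProjectives_smon (hQ : IsAcyclicQuiver V) (hρ : IsAdmissible k ρ)
    (h𝒳 : ∀ M : ModuleCat.{u} A, 𝒳 M → Module.Finite A M) (hE : HasEnoughProjectives 𝒳) :
    HasEnoughProjectives (smon k ρ 𝒳) := by
  intro X hX
  obtain ⟨L, K, f, g, w, hL, hK, hS⟩ := exists_freeRep_cover hQ hρ h𝒳 hE hX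
  exact ⟨K, _, f, g, w, hK, isProjectiveIn_freeRep hQ hρ h𝒳 hL, hS⟩

theorem hasEnoughInjectives_smon (hQ : IsAcyclicQuiver V) (hρ : IsAdmissible k ρ)
    (h𝒳 : ∀ M : ModuleCat.{u} A, 𝒳 M → Module.Finite A M) (hE : HasEnoughInjectives 𝒳) :
    HasEnoughInjectives (smon k ρ 𝒳) := by
  intro X hX
  obtain ⟨L, C, f, g, w, hL, hC, hS⟩ := exists_freeRep_hull hQ hρ h𝒳 hE hX
  exact ⟨_, C, f, g, w, isInjectiveIn_freeRep hQ hρ h𝒳 hL, hC, hS⟩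

/-- An exact sequence in `𝒳` tensored with `P(i)` is exact in `smon`. At a sink, a map from
`Cok_i(L)` becomes a morphism from `L`, which lifts; reading the lift off on `Cok_i` solves the
original problem. -/
theorem isProjectiveIn_cok_of_sink (hQ : IsAcyclicQuiver V) (hρ : IsAdmissible k ρ)
    (h𝒳 : ∀ M : ModuleCat.{u} A, 𝒳 M → Module.Finite A M) {L : QRep V A}
    (hL : IsProjectiveIn (smon k ρ 𝒳) L) {i : V} (hi : ∀ j : V, IsEmpty (i ⟶ j)) :
    IsProjectiveIn 𝒳 (L.cok i) := by
  rw [isProjectiveIn_module_iff]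
  refine ⟨((smon_iff hQ hρ h𝒳 L).1 hL.mem).2 i, fun X Y Z f g hf hg hfg hX hY hZ t => ?_⟩
  obtain ⟨h, hh⟩ := exists_hom_tensorRep_of_sink (k := k) (ρ := ρ) hQ hi t
  obtain ⟨l, hl⟩ := hL.exists_lift (tensorMap ρ k f i) (tensorMap ρ k g i)
    (tensorMap_injective ρ hf i) (tensorMap_surjective ρ hg i) (tensorMap_exact ρ hfg i)
    (smon_tensorRep hQ hρ h𝒳 hX i) (smon_tensorRep hQ hρ h𝒳 hY i)
    (smon_tensorRep hQ hρ h𝒳 hZ i) h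
  refine ⟨L.cokDesc (tensorCoord ρ Y Quiver.Path.nil ∘ₗ QRep.homAt l i) fun x hx =>
    tensorCoord_nil_of_mem ρ (QRep.homAt_mem_arrowImage l hx), fun c => ?_⟩
  obtain ⟨x, rfl⟩ := L.cokMk_surjective i c
  rw [QRep.cokDesc_cokMk, LinearMap.comp_apply, ← tensorCoord_tensorMap, ← QRep.homAt_comp, hl, hh,
    tensorCoord_tensorIncl ρ _ _ (hρ.not_memIdeal_nil ρ i)]

/-- Take a sink `i` and a cover of `M ⊗ P(i)` in `smon`, and apply `Cok_i`: the sequence stays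
exact, ends in `M`, and has a projective middle term. -/
theorem hasEnoughProjectives_of_smon [Nonempty V] (hQ : IsAcyclicQuiver V)
    (hρ : IsAdmissible k ρ) (h𝒳 : ∀ M : ModuleCat.{u} A, 𝒳 M → Module.Finite A M)
    (hE : HasEnoughProjectives (smon k ρ 𝒳)) : HasEnoughProjectives 𝒳 := by
  intro M hM
  obtain ⟨i, hi⟩ := hQ.exists_sink
  obtain ⟨Z, L, f, g, w, hZ, hL, hS⟩ := hE _ (smon_tensorRep hQ hρ h𝒳 hM i)
  have hS' := (shortExact_iff _).1 hS
  have hf : ∀ j, Function.Injective (QRep.homAt f j) := fun j => (hS' j).1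
  have hg : ∀ j, Function.Surjective (QRep.homAt g j) := fun j => (hS' j).2.1
  have hfg : ∀ j, Function.Exact (QRep.homAt f j) (QRep.homAt g j) := fun j => (hS' j).2.2
  have hnil := hρ.not_memIdeal_nil ρ i
  let g' : L.cok i →ₗ[A] M := L.cokDesc (tensorCoord ρ M Quiver.Path.nil ∘ₗ QRep.homAt g i)
    fun x hx => tensorCoord_nil_of_mem ρ (QRep.homAt_mem_arrowImage g hx)
  have hg' : ∀ x, g' (L.cokMk i x) = tensorCoord ρ M Quiver.Path.nil (QRep.homAt g i x) :=
    fun _ => rfl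
  have hinj : Function.Injective (QRep.cokMap f i) := by
    rw [injective_iff_map_eq_zero]
    intro c hc
    obtain ⟨z, rfl⟩ := Z.cokMk_surjective i c
    rw [QRep.cokMap_cokMk, QRep.cokMk_eq_zero] at hc
    exact Z.cokMk_eq_zero.2 (IsMonic.mem_arrowImage_of_exact
      ((smon_iff hQ hρ h𝒳 L).1 hL.mem).1.relations (isMonic_tensorRep ρ M hρ i) f g hf hg hfg hc)
  have hsurj : Function.Surjective g' := by
    intro m
    obtain ⟨x, hx⟩ := hg i (tensorIncl ρ M Quiver.Path.nil m)
    exact ⟨L.cokMk i x, by rw [hg', hx, tensorCoord_tensorIncl ρ _ _ hnil]⟩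
  have hex : Function.Exact (QRep.cokMap f i) g' := by
    intro c
    constructor
    · intro hc
      obtain ⟨x, rfl⟩ := L.cokMk_surjective i c
      obtain ⟨z, rfl⟩ := (hfg i x).1 (by
        rw [eq_tensorIncl_nil ρ hQ (QRep.homAt g i x), ← hg', hc, map_zero])
      exact ⟨Z.cokMk i z, QRep.cokMap_cokMk f z⟩
    · rintro ⟨c, rfl⟩
      obtain ⟨z, rfl⟩ := Z.cokMk_surjective i c
      rw [QRep.cokMap_cokMk, hg', (hfg i).apply_apply_eq_zero, map_zero]
  exact ⟨Z.cok i, L.cok i, ModuleCat.ofHom (QRep.cokMap f i), ModuleCat.ofHom g',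
    ModuleCat.hom_ext hex.linearMap_comp_eq_zero, ((smon_iff hQ hρ h𝒳 Z).1 hZ).2 i,
    isProjectiveIn_cok_of_sink hQ hρ h𝒳 hL hi, (shortExact_module_iff _).2 ⟨hinj, hsurj, hex⟩⟩

/-- The functor `M ↦ M ⊗ P(i)` sends exact sequences in `𝒳` to exact sequences in `smon`, and maps
from `M ⊗ P(i)` to `L` are maps from `M` to `L_i`. -/
theorem isInjectiveIn_branch (hQ : IsAcyclicQuiver V) (hρ : IsAdmissible k ρ)
    (h𝒳 : ∀ M : ModuleCat.{u} A, 𝒳 M → Module.Finite A M) {L : QRep V A}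
    (hL : IsInjectiveIn (smon k ρ 𝒳) L) (i : V) : IsInjectiveIn 𝒳 (L.branch i) := by
  have hL' := (smon_iff hQ hρ h𝒳 L).1 hL.mem
  rw [isInjectiveIn_module_iff]
  refine ⟨(hL'.1.branch_mem hQ hρ hL'.2 i).1, fun X Y Z f g hf hg hfg hX hY hZ t => ?_⟩
  obtain ⟨l, hl⟩ := hL.exists_extension (tensorMap ρ k f i) (tensorMap ρ k g i)
    (tensorMap_injective ρ hf i) (tensorMap_surjective ρ hg i) (tensorMap_exact ρ hfg i)
    (smon_tensorRep hQ hρ h𝒳 hX i) (smon_tensorRep hQ hρ h𝒳 hY i)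
    (smon_tensorRep hQ hρ h𝒳 hZ i) (tensorDesc k hL'.1.relations t)
  refine ⟨QRep.homAt l i ∘ₗ tensorIncl ρ Y Quiver.Path.nil, fun x => ?_⟩
  rw [LinearMap.comp_apply, ← tensorMap_tensorIncl, ← QRep.homAt_comp, hl, tensorDesc_tensorIncl,
    QRep.mapPath_nil]

/-- The branch at any vertex `i` of a hull of `M ⊗ P(i)` is a hull of `M`; its cokernel is a branch
of an object of `smon`, hence in `𝒳`. -/
theorem hasEnoughInjectives_of_smon [Nonempty V] (hQ : IsAcyclicQuiver V)
    (hρ : IsAdmissible k ρ) (h𝒳 : ∀ M : ModuleCat.{u} A, 𝒳 M → Module.Finite A M)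
    (hE : HasEnoughInjectives (smon k ρ 𝒳)) : HasEnoughInjectives 𝒳 := by
  intro M hM
  obtain ⟨i⟩ := ‹Nonempty V›
  obtain ⟨L, Z, f, g, w, hL, hZ, hS⟩ := hE _ (smon_tensorRep hQ hρ h𝒳 hM i)
  obtain ⟨hf, hg, hfg⟩ := (shortExact_iff _).1 hS i
  let e := tensorBranchEquiv hQ hρ M i
  have hex : Function.Exact (QRep.homAt f i ∘ₗ e.toLinearMap) (QRep.homAt g i) := by
    intro x
    refine (hfg x).trans ⟨?_, ?_⟩
    · rintro ⟨y, rfl⟩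
      exact ⟨e.symm y, congrArg (QRep.homAt f i) (e.apply_symm_apply y)⟩
    · rintro ⟨m, rfl⟩
      exact ⟨e m, rfl⟩
  have hZ' := (smon_iff hQ hρ h𝒳 Z).1 hZ
  exact ⟨L.branch i, Z.branch i, ModuleCat.ofHom (QRep.homAt f i ∘ₗ e.toLinearMap),
    ModuleCat.ofHom (QRep.homAt g i), ModuleCat.hom_ext hex.linearMap_comp_eq_zero,
    isInjectiveIn_branch hQ hρ h𝒳 hL i, (hZ'.1.branch_mem hQ hρ hZ'.2 i).1,
    (shortExact_module_iff _).2 ⟨hf.comp e.injective, hg, hex⟩⟩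

/-- By the structure of projectives, the branch is a finite product of copies of the modules
`Cok_j(L)`, each projective in `𝒳`. -/
theorem isProjectiveIn_branch (hQ : IsAcyclicQuiver V) (hρ : IsAdmissible k ρ)
    (h𝒳 : ∀ M : ModuleCat.{u} A, 𝒳 M → Module.Finite A M) (hE : HasEnoughProjectives 𝒳)
    {L : QRep V A} (hL : IsProjectiveIn (smon k ρ 𝒳) L) (i : V) :
    IsProjectiveIn 𝒳 (L.branch i) := by
  obtain ⟨⟨e⟩, hcok⟩ := hL.exists_iso_freeRep hQ hρ h𝒳 hE
  have hL' := (smon_iff hQ hρ h𝒳 L).1 hL.mem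
  exact (isProjectiveIn_branch_freeRep (k := k) (ρ := ρ) hQ hcok i).of_iso (e.app i)
    (hL'.1.branch_mem hQ hρ hL'.2 i).1

theorem isIndecomposableIn_isProjectiveIn_iff (hQ : IsAcyclicQuiver V) (hρ : IsAdmissible k ρ)
    (h𝒳 : ∀ M : ModuleCat.{u} A, 𝒳 M → Module.Finite A M) (hE : HasEnoughProjectives 𝒳)
    (X : QRep V A) :
    (IsIndecomposableIn (smon k ρ 𝒳) X ∧ IsProjectiveIn (smon k ρ 𝒳) X) ↔
      ∃ (M : ModuleCat.{u} A) (i : V), IsIndecomposableIn 𝒳 M ∧ IsProjectiveIn 𝒳 M ∧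
        Nonempty (X ≅ tensorRep M (projRep k ρ i)) := by
  constructor
  · rintro ⟨h1, h2⟩
    obtain ⟨⟨e⟩, hcok⟩ := h2.exists_iso_freeRep hQ hρ h𝒳 hE
    obtain ⟨i, hi, he⟩ := h1.exists_iso_tensorRep hQ hρ h𝒳 e
    exact ⟨X.cok i, i, hi, hcok i, he⟩
  · rintro ⟨M, i, h1, h2, ⟨e⟩⟩
    have h3 := h1.of_iso_tensorRep hQ hρ h𝒳 i e
    exact ⟨h3, (isProjectiveIn_tensorRep hQ hρ h𝒳 h2 i).of_iso e.symm h3.mem⟩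

theorem isIndecomposableIn_isInjectiveIn_iff (hQ : IsAcyclicQuiver V) (hρ : IsAdmissible k ρ)
    (h𝒳 : ∀ M : ModuleCat.{u} A, 𝒳 M → Module.Finite A M) (hE : HasEnoughInjectives 𝒳)
    (X : QRep V A) :
    (IsIndecomposableIn (smon k ρ 𝒳) X ∧ IsInjectiveIn (smon k ρ 𝒳) X) ↔
      ∃ (M : ModuleCat.{u} A) (i : V), IsIndecomposableIn 𝒳 M ∧ IsInjectiveIn 𝒳 M ∧
        Nonempty (X ≅ tensorRep M (projRep k ρ i)) := by
  constructor
  · rintro ⟨h1, h2⟩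
    obtain ⟨⟨e⟩, hcok⟩ := h2.exists_iso_freeRep hQ hρ h𝒳 hE
    obtain ⟨i, hi, he⟩ := h1.exists_iso_tensorRep hQ hρ h𝒳 e
    exact ⟨X.cok i, i, hi, hcok i, he⟩
  · rintro ⟨M, i, h1, h2, ⟨e⟩⟩
    have h3 := h1.of_iso_tensorRep hQ hρ h𝒳 i e
    exact ⟨h3, (isInjectiveIn_tensorRep hQ hρ h𝒳 h2 i).of_iso e.symm h3.mem⟩

end Comparison

end SMon

end

theorem corollary4p2
    {k : Type u} [Field k]
    {A : Type u} [Ring A] [Algebra k A] [Module.Finite k A]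
    {V : Type} [Quiver.{0} V] [Finite V] [Nonempty V] [∀ a b : V, Finite (a ⟶ b)]
    (hQ : SMon.IsAcyclicQuiver V)
    (ρ : ∀ a b : V, Set (Quiver.Path a b)) (hρ : SMon.IsAdmissible k ρ)
    (𝒳 : ObjectProperty (ModuleCat.{u} A))
    [𝒳.IsClosedUnderIsomorphisms] [𝒳.ContainsZero] [𝒳.IsClosedUnderExtensions]
    (h𝒳 : ∀ M : ModuleCat.{u} A, 𝒳 M → Module.Finite A M) :
    ((SMon.HasEnoughProjectives (SMon.smon k ρ 𝒳) ↔ SMon.HasEnoughProjectives 𝒳) ∧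
      (SMon.HasEnoughProjectives 𝒳 →
        (∀ X : SMon.QRep V A,
          (SMon.IsIndecomposableIn (SMon.smon k ρ 𝒳) X ∧
              SMon.IsProjectiveIn (SMon.smon k ρ 𝒳) X) ↔
            ∃ (M : ModuleCat.{u} A) (i : V),
              SMon.IsIndecomposableIn 𝒳 M ∧ SMon.IsProjectiveIn 𝒳 M ∧
                Nonempty (X ≅ SMon.tensorRep M (SMon.projRep k ρ i))) ∧
        (∀ i : V, (∀ j : V, IsEmpty (i ⟶ j)) → ∀ M : ModuleCat.{u} A,
          SMon.IsProjectiveIn 𝒳 M ↔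
            ∃ L : SMon.QRep V A, SMon.IsProjectiveIn (SMon.smon k ρ 𝒳) L ∧
              Nonempty (M ≅ L.branch i)))) ∧
    ((SMon.HasEnoughInjectives (SMon.smon k ρ 𝒳) ↔ SMon.HasEnoughInjectives 𝒳) ∧
      (SMon.HasEnoughInjectives 𝒳 →
        (∀ X : SMon.QRep V A,
          (SMon.IsIndecomposableIn (SMon.smon k ρ 𝒳) X ∧
              SMon.IsInjectiveIn (SMon.smon k ρ 𝒳) X) ↔
            ∃ (M : ModuleCat.{u} A) (i : V),
              SMon.IsIndecomposableIn 𝒳 M ∧ SMon.IsInjectiveIn 𝒳 M ∧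
                Nonempty (X ≅ SMon.tensorRep M (SMon.projRep k ρ i))) ∧
        (∀ i : V, (∀ j : V, IsEmpty (i ⟶ j)) → ∀ M : ModuleCat.{u} A,
          SMon.IsInjectiveIn 𝒳 M ↔
            ∃ L : SMon.QRep V A, SMon.IsInjectiveIn (SMon.smon k ρ 𝒳) L ∧
              Nonempty (M ≅ L.branch i)))) := by
  have : ∀ j : V, Fintype (Σ i : V, (i ⟶ j)) := fun j => Fintype.ofFinite _
  refine ⟨⟨⟨SMon.hasEnoughProjectives_of_smon hQ hρ h𝒳, SMon.hasEnoughProjectives_smon hQ hρ h𝒳⟩,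
    -- The witness for a given `M` is `M ⊗ P(i)`, whose branch at `i` is `M` because the only path
    -- from `i` to itself is trivial.
    fun hE => ⟨SMon.isIndecomposableIn_isProjectiveIn_iff hQ hρ h𝒳 hE, fun i _ M => ⟨fun hM =>
      ⟨_, SMon.isProjectiveIn_tensorRep hQ hρ h𝒳 hM i,
        ⟨(SMon.tensorBranchEquiv hQ hρ M i).toModuleIso⟩⟩, ?_⟩⟩⟩,
    ⟨SMon.hasEnoughInjectives_of_smon hQ hρ h𝒳, SMon.hasEnoughInjectives_smon hQ hρ h𝒳⟩,
    fun hE => ⟨SMon.isIndecomposableIn_isInjectiveIn_iff hQ hρ h𝒳 hE, fun i _ M => ⟨fun hM =>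
      ⟨_, SMon.isInjectiveIn_tensorRep hQ hρ h𝒳 hM i,
        ⟨(SMon.tensorBranchEquiv hQ hρ M i).toModuleIso⟩⟩, ?_⟩⟩⟩
  · rintro ⟨L, hL, ⟨e⟩⟩
    have h := SMon.isProjectiveIn_branch hQ hρ h𝒳 hE hL i
    exact h.of_iso e.symm (𝒳.prop_of_iso e.symm h.mem)
  · rintro ⟨L, hL, ⟨e⟩⟩
    have h := SMon.isInjectiveIn_branch hQ hρ h𝒳 hL i
    exact h.of_iso e.symm (𝒳.prop_of_iso e.symm h.mem)
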